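/- Let $\Sigma$ be an oriented smooth surface (Hausdorff, second countable, without boundary; not necessarily compact or connected). A simple closed curve in $\Sigma$ is the image $c\subset\Sigma$ of a smooth embedding $S^1\to\Sigma$, and two simple closed curves are isotopic if some smooth isotopy of $\Sigma$ starting at the identity carries one to the other; let $D(\Sigma)$ be the set of isotopy classes. A bicollar of $c$ is an orientation preserving diffeomorphism $\phi=(r_\phi,\theta_\phi)$ from an open neighbourhood $U$ of $c$ onto $A=\{z\in\mathbb C : 1<|z|<2\}$ with $\phi(c)=\{|z|=\tfrac32\}$. Given such a $\phi$ and a smooth function $f:\mathbb R\to\mathbb R$ (a smoothing of $r\mapsto r$ on $[1,2]$) for which there are $1<a<b<2$ with $f(r)=1$ for $r\le a$ and $f(r)=2$ for $r\ge b$, consider the diffeomorphisms of $\Sigma$ $$t(x)=\begin{cases}x & x\in\Sigma\setminus U,\\ \phi^{-1}\bigl(r_\phi(x),\,\theta_\phi(x)\pm 2\pi f(r_\phi(x))\bigr) & x\in U.\end{cases}$$ A positive (resp. negative) Dehn twist $t_c^{+}$ (resp. $t_c^{-}$) about $c$ is any self-diffeomorphism of $\Sigma$ smoothly isotopic to such a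 $t$ with the sign $+$ (resp. $-$), for some choice of $\phi$ and $f$. Then every simple closed curve in $\Sigma$ has a positive and a negative Dehn twist, and the operations $$[x]\rhd[y]=[t_y^+(x)],\qquad [x]\unrhd[y]=[t_y^-(x)]$$ on $D(\Sigma)$ are well defined, that is, they do not depend on the representatives $x,y$ of the isotopy classes or on the chosen Dehn twists about $y$. They satisfy the quandle axioms: for all $u,v,w\in D(\Sigma)$, $$u\rhd u=u,\qquad (u\rhd v)\unrhd v=u=(u\unrhd v)\rhd v,\qquad (u\rhd v)\rhd w=(u\rhd w)\rhd(v\rhd w).$$ -/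

import Mathlib

open scoped Manifold ContDiff

/-- An oriented surface: a Hausdorff, second countable, smooth real 2-manifold without boundary
(charts take values in `ℂ = ℝ²`, all smoothness is over `ℝ`), given by an atlas whose
transition maps all have positive Jacobian determinant.  Compactness and connectedness are not
required. -/
class OrientedSurface (S : Type*) [TopologicalSpace S] [ChartedSpace ℂ S] : Prop extends
    T2Space S, SecondCountableTopology S, IsManifold 𝓘(ℝ, ℂ) ∞ S where
  det_pos : ∀ e ∈ atlas ℂ S, ∀ e' ∈ atlas ℂ S, ∀ z ∈ (e.symm ≫ₕ e').source,
    0 < (fderiv ℝ (e.symm ≫ₕ e') z).det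

namespace DehnQuandle

/-- Smooth self-diffeomorphisms of a surface. -/
abbrev SelfDiffeo (S : Type*) [TopologicalSpace S] [ChartedSpace ℂ S] :=
  S ≃ₘ^∞⟮𝓘(ℝ, ℂ), 𝓘(ℝ, ℂ)⟯ S

section Curves

variable {S : Type*} [TopologicalSpace S] [ChartedSpace ℂ S]

/-- A family of self-diffeomorphisms which depends smoothly on the time parameter. -/
def IsSmoothFamily (H : ℝ → SelfDiffeo S) : Prop :=
  ContMDiff (𝓘(ℝ, ℝ).prod 𝓘(ℝ, ℂ)) 𝓘(ℝ, ℂ) ∞ (fun p : ℝ × S => H p.1 p.2)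

/-- Two self-diffeomorphisms are isotopic if a smooth family of self-diffeomorphisms
joins them. -/
def DiffeoIsotopic (τ₀ τ₁ : SelfDiffeo S) : Prop :=
  ∃ H : ℝ → SelfDiffeo S, IsSmoothFamily H ∧ H 0 = τ₀ ∧ H 1 = τ₁

/-- The image of a smooth embedding under a diffeomorphism is a smooth embedding. -/
theorem isSmoothEmbedding_comp [IsManifold 𝓘(ℝ, ℂ) ∞ S] {γ : Circle → S}
    (hγ : Manifold.IsSmoothEmbedding (𝓡 1) 𝓘(ℝ, ℂ) ∞ γ) (τ : SelfDiffeo S) :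
    Manifold.IsSmoothEmbedding (𝓡 1) 𝓘(ℝ, ℂ) ∞ (τ ∘ γ) := by
  refine ⟨?_, τ.toHomeomorph.isEmbedding.comp hγ.isEmbedding⟩
  obtain ⟨F, _, _, hF⟩ := hγ.isImmersion
  refine ⟨F, inferInstance, inferInstance, fun x => ?_⟩
  have h := hF x
  have hτ : τ.symm.toHomeomorph.toOpenPartialHomeomorph ≫ₕ h.codChart ∈
      IsManifold.maximalAtlas 𝓘(ℝ, ℂ) ∞ S := by
    apply OpenPartialHomeomorph.mem_maximalAtlas_of_contMDiffOn
    · exact (contMDiffOn_of_mem_maximalAtlas h.codChart_mem_maximalAtlas).comp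
        τ.symm.contMDiff.contMDiffOn (fun y hy => by simpa using hy)
    · exact τ.contMDiff.comp_contMDiffOn
        ((contMDiffOn_symm_of_mem_maximalAtlas h.codChart_mem_maximalAtlas).mono
          (fun y hy => by simpa using hy))
  refine Manifold.IsImmersionAtOfComplement.mk_of_charts h.equiv h.domChart _
    h.mem_domChart_source ?_ h.domChart_mem_maximalAtlas hτ ?_ ?_
  · simpa using h.mem_codChart_source
  · intro y hy
    simpa using h.source_subset_preimage_source hy
  · intro u hu
    have := h.writtenInCharts hu
    simpa using this

/-- An (unoriented) simple closed curve: a subset which is the image of a smooth embedding of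
the circle. -/
def SimpleClosedCurve (S : Type*) [TopologicalSpace S] [ChartedSpace ℂ S] :=
  {c : Set S // ∃ γ : Circle → S,
    Manifold.IsSmoothEmbedding (𝓡 1) 𝓘(ℝ, ℂ) ∞ γ ∧ Set.range γ = c}

/-- The image `τ(c)` of a simple closed curve under a self-diffeomorphism. -/
def SimpleClosedCurve.map [IsManifold 𝓘(ℝ, ℂ) ∞ S] (τ : SelfDiffeo S)
    (c : SimpleClosedCurve S) : SimpleClosedCurve S :=
  ⟨τ '' c.1, by
    obtain ⟨γ, hγ, hc⟩ := c.2
    exact ⟨τ ∘ γ, isSmoothEmbedding_comp hγ τ, by rw [Set.range_comp, hc]⟩⟩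

/-- Two simple closed curves are isotopic if a smooth isotopy of the surface, starting at the
identity, carries the first one to the second one. -/
def CurveIsotopic (c c' : SimpleClosedCurve S) : Prop :=
  ∃ H : ℝ → SelfDiffeo S, IsSmoothFamily H ∧ H 0 = Diffeomorph.refl 𝓘(ℝ, ℂ) S ∞ ∧
    H 1 '' c.1 = c'.1

theorem curveIsotopic_refl (c : SimpleClosedCurve S) : CurveIsotopic c c :=
  ⟨fun _ => Diffeomorph.refl 𝓘(ℝ, ℂ) S ∞, contMDiff_snd, rfl, by simp⟩

theorem curveIsotopic_symm {c c' : SimpleClosedCurve S} (h : CurveIsotopic c c') :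
    CurveIsotopic c' c := by
  obtain ⟨H, hH, h0, h1⟩ := h
  refine ⟨fun t => (H 1).symm.trans (H (1 - t)), ?_, ?_, ?_⟩
  · have hs : ContMDiff 𝓘(ℝ, ℝ) 𝓘(ℝ, ℝ) ∞ (fun t : ℝ => 1 - t) :=
      (contDiff_const.sub contDiff_id).contMDiff
    exact hH.comp ((hs.comp contMDiff_fst).prodMk ((H 1).symm.contMDiff.comp contMDiff_snd))
  · ext x
    simp
  · simp [← h1, h0, Set.image_image]

theorem curveIsotopic_trans {c c' c'' : SimpleClosedCurve S} (h : CurveIsotopic c c')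
    (h' : CurveIsotopic c' c'') : CurveIsotopic c c'' := by
  obtain ⟨H, hH, h0, h1⟩ := h
  obtain ⟨K, hK, k0, k1⟩ := h'
  refine ⟨fun t => (H t).trans (K t), ?_, ?_, ?_⟩
  · exact hK.comp (contMDiff_fst.prodMk hH)
  · ext x
    simp [h0, k0]
  · rw [← k1, ← h1, Set.image_image]
    rfl

/-- Isotopy as an equivalence relation on the simple closed curves. -/
instance curveSetoid (S : Type*) [TopologicalSpace S] [ChartedSpace ℂ S] :
    Setoid (SimpleClosedCurve S) where
  r := CurveIsotopic
  iseqv := ⟨curveIsotopic_refl, curveIsotopic_symm, curveIsotopic_trans⟩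

/-- The set `D(S)` of isotopy classes of simple closed curves. -/
abbrev IsotopyClass (S : Type*) [TopologicalSpace S] [ChartedSpace ℂ S] :=
  Quotient (curveSetoid S)

end Curves

section Twists

variable {S : Type*} [TopologicalSpace S] [ChartedSpace ℂ S]

/-- `φ` is a bicollar of `c`: an orientation preserving diffeomorphism from an open neighbourhood
`φ.source` of `c` onto the annulus `{z | 1 < |z| < 2}` which maps `c` onto the circle
`{z | |z| = 3/2}`. -/
structure IsBicollar (c : Set S) (φ : OpenPartialHomeomorph S ℂ) : Prop where
  target_eq : φ.target = {z : ℂ | 1 < ‖z‖ ∧ ‖z‖ < 2}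
  smooth : ContMDiffOn 𝓘(ℝ, ℂ) 𝓘(ℝ, ℂ) ∞ φ φ.source
  smooth_symm : ContMDiffOn 𝓘(ℝ, ℂ) 𝓘(ℝ, ℂ) ∞ φ.symm φ.target
  det_pos : ∀ e ∈ atlas ℂ S, ∀ z ∈ (e.symm ≫ₕ φ).source,
    0 < (fderiv ℝ (e.symm ≫ₕ φ) z).det
  subset_source : c ⊆ φ.source
  image_eq : φ '' c = {z : ℂ | ‖z‖ = 3 / 2}

/-- A smoothing of the function `r ↦ r` on `[1, 2]`: a smooth function which is `1` up to some
point `a > 1`, and `2` from some point `b < 2` on. -/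
structure IsTwistProfile (f : ℝ → ℝ) : Prop where
  smooth : ContDiff ℝ ∞ f
  eq_ends : ∃ a b : ℝ, 1 < a ∧ a < b ∧ b < 2 ∧ (∀ r ≤ a, f r = 1) ∧ (∀ r, b ≤ r → f r = 2)

/-- The twist with sign `ε` along `c` for some bicollar `φ = (r, θ)` of `c` and some profile `f`:
the diffeomorphism which is the identity off the bicollar, and
`(r, θ) ↦ (r, θ + ε 2π f(r))` in the bicollar. -/
def IsModelTwist (ε : ℤ) (c : Set S) (τ : SelfDiffeo S) : Prop :=
  ∃ (φ : OpenPartialHomeomorph S ℂ) (f : ℝ → ℝ), IsBicollar c φ ∧ IsTwistProfile f ∧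
    (∀ x ∉ φ.source, τ x = x) ∧
    ∀ x ∈ φ.source,
      τ x = φ.symm (φ x * Complex.exp ((ε * (2 * Real.pi * f ‖φ x‖) : ℝ) * Complex.I))

/-- A positive (right-handed) Dehn twist about `c`.  Smoothings of the piecewise smooth twist are
determined only up to isotopy, so all diffeomorphisms isotopic to a model are admitted. -/
def IsPositiveDehnTwist (c : SimpleClosedCurve S) (τ : SelfDiffeo S) : Prop :=
  ∃ τ₀ : SelfDiffeo S, IsModelTwist 1 c.1 τ₀ ∧ DiffeoIsotopic τ₀ τ

/-- A negative (left-handed) Dehn twist about `c`. -/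
def IsNegativeDehnTwist (c : SimpleClosedCurve S) (τ : SelfDiffeo S) : Prop :=
  ∃ τ₀ : SelfDiffeo S, IsModelTwist (-1) c.1 τ₀ ∧ DiffeoIsotopic τ₀ τ

end Twists

/-- The quandle axioms for a pair of binary operations `act x y = x ▷ y`, `inv x y = x ⊵ y`. -/
structure IsQuandle {Q : Type*} (act inv : Q → Q → Q) : Prop where
  idem : ∀ x, act x x = x
  inv_act : ∀ x y, inv (act x y) y = x
  act_inv : ∀ x y, act (inv x y) y = x
  distrib : ∀ x y z, act (act x y) z = act (act x z) (act y z)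

end DehnQuandle

/-! Everything reduces to model twists along bicollars. Four facts carry the proof: every curve has
a bicollar (`SimpleClosedCurve.exists_isBicollar`); model twists of the same sign about the same
curve are isotopic (`IsBicollar.isotopic`); if `h` preserves orientation and `t` is a model twist
about `c`, then `h t h⁻¹` is a model twist of the same sign about `h(c)` (`IsModelTwist.map`); the
end of an isotopy from the identity preserves orientation (`preservesOrientationAt_of_isotopic`). If
an isotopy ending in `h` carries `c` to `d`, then `h t h⁻¹` is both isotopic to `t` and a twist
about `d`, so the operations are well defined.

The axioms then hold for model twists on the nose. A twist about `c` preserves `c` as a set; its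
inverse is the twist of opposite sign along the same collar; and a twist `h` preserves orientation,
so `h t_y h⁻¹` is a twist about `h(y)`, which is self-distributivity.

Uniqueness is the core of the argument. Let `ψ` be the transition between two bicollars, a map near
the core circle `|z| = 3/2`. On the core it is a change of angle `t ↦ g(t)` with `g'` nowhere zero.
If `g' < 0`, one collar is replaced by its flip `(r, θ) ↦ (3 - r, -θ)`, along which the same
diffeomorphism is again a twist of the same sign. If `g' > 0`, then `g` has degree one, so `ψ(z)/z`
has a smooth logarithm `L` near the core, and `z ↦ z exp(s L(z))` joins the identity to `ψ`. These
maps are bijective on the core with invertible differentials there. By compactness they are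
diffeomorphisms onto neighbourhoods containing one thin annulus for all `s` in `[0, 1]`, and
twisting inside that annulus gives the isotopy.

For existence, local functions which straighten the curve onto the core circle are glued by a
partition of unity. Their differentials agree on the velocity of the curve, so a convex combination
keeps positive determinant; the inverse function theorem near the compact curve and a radial
rescaling give the bicollar. -/

namespace DehnQuandle

/-! ### Calculus of isotopies of diffeomorphisms and curves -/

section Isotopies

variable {S : Type*} [TopologicalSpace S] [ChartedSpace ℂ S]

theorem DiffeoIsotopic.refl (τ : SelfDiffeo S) : DiffeoIsotopic τ τ :=
  ⟨fun _ => τ, τ.contMDiff.comp contMDiff_snd, rfl, rfl⟩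

theorem DiffeoIsotopic.symm {τ τ' : SelfDiffeo S} (h : DiffeoIsotopic τ τ') :
    DiffeoIsotopic τ' τ := by
  obtain ⟨H, hH, h0, h1⟩ := h
  refine ⟨fun t => H (1 - t), ?_, by simp [h1], by simp [h0]⟩
  have hs : ContMDiff 𝓘(ℝ, ℝ) 𝓘(ℝ, ℝ) ∞ (fun t : ℝ => 1 - t) :=
    (contDiff_const.sub contDiff_id).contMDiff
  exact hH.comp ((hs.comp contMDiff_fst).prodMk contMDiff_snd)

/-- Composing an isotopy with a fixed diffeomorphism applied first. -/
theorem DiffeoIsotopic.comp_right {τ τ' : SelfDiffeo S} (h : DiffeoIsotopic τ τ')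
    (σ : SelfDiffeo S) : DiffeoIsotopic (σ.trans τ) (σ.trans τ') := by
  obtain ⟨H, hH, h0, h1⟩ := h
  exact ⟨fun t => σ.trans (H t), hH.comp (contMDiff_fst.prodMk (σ.contMDiff.comp contMDiff_snd)),
    by simp [h0], by simp [h1]⟩

/-- Composing an isotopy with a fixed diffeomorphism applied last. -/
theorem DiffeoIsotopic.comp_left {τ τ' : SelfDiffeo S} (h : DiffeoIsotopic τ τ')
    (σ : SelfDiffeo S) : DiffeoIsotopic (τ.trans σ) (τ'.trans σ) := by
  obtain ⟨H, hH, h0, h1⟩ := h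
  exact ⟨fun t => (H t).trans σ, σ.contMDiff.comp hH, by simp [h0], by simp [h1]⟩

/-- The path `K_t ∘ τ'⁻¹ ∘ H_t` runs both isotopies at once; unlike concatenation, it needs no
smoothing at a junction. -/
theorem DiffeoIsotopic.trans {τ τ' τ'' : SelfDiffeo S} (h : DiffeoIsotopic τ τ')
    (h' : DiffeoIsotopic τ' τ'') : DiffeoIsotopic τ τ'' := by
  obtain ⟨H, hH, h0, h1⟩ := h
  obtain ⟨K, hK, k0, k1⟩ := h'
  refine ⟨fun t => ((H t).trans τ'.symm).trans (K t), ?_, ?_, ?_⟩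
  · exact hK.comp (contMDiff_fst.prodMk (τ'.symm.contMDiff.comp hH))
  · ext x
    simp [h0, k0]
  · ext x
    simp [h1, k1]

/-- Conjugation by a diffeomorphism isotopic to the identity does not change isotopy classes. -/
theorem DiffeoIsotopic.conj {h : SelfDiffeo S}
    (hh : DiffeoIsotopic (Diffeomorph.refl 𝓘(ℝ, ℂ) S ∞) h) (τ : SelfDiffeo S) :
    DiffeoIsotopic τ ((h.symm.trans τ).trans h) := by
  -- Both `τ` and `h τ h⁻¹` are isotopic to `τ h⁻¹`.
  have h₁ := (hh.comp_right h.symm).comp_left τ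
  have h₂ := hh.comp_right (h.symm.trans τ)
  have e₁ : (h.symm.trans (Diffeomorph.refl 𝓘(ℝ, ℂ) S ∞)).trans τ = h.symm.trans τ := by
    ext x; simp
  have e₂ : (h.symm.trans h).trans τ = τ := by
    ext x; simp
  have e₃ : (h.symm.trans τ).trans (Diffeomorph.refl 𝓘(ℝ, ℂ) S ∞) = h.symm.trans τ := by
    ext x; simp
  rw [e₁, e₂] at h₁
  rw [e₃] at h₂
  exact h₁.symm.trans h₂

variable [IsManifold 𝓘(ℝ, ℂ) ∞ S]

theorem curveIsotopic_map_of_diffeoIsotopic {τ τ' : SelfDiffeo S} (h : DiffeoIsotopic τ τ')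
    (c : SimpleClosedCurve S) : CurveIsotopic (c.map τ) (c.map τ') := by
  obtain ⟨H, hH, h0, h1⟩ := h
  refine ⟨fun t => τ.symm.trans (H t), ?_, ?_, ?_⟩
  · exact hH.comp (contMDiff_fst.prodMk (τ.symm.contMDiff.comp contMDiff_snd))
  · ext x
    simp [h0]
  · simp [SimpleClosedCurve.map, Set.image_image, h1]

theorem CurveIsotopic.map {c c' : SimpleClosedCurve S} (h : CurveIsotopic c c')
    (τ : SelfDiffeo S) : CurveIsotopic (c.map τ) (c'.map τ) := by
  obtain ⟨H, hH, h0, h1⟩ := h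
  refine ⟨fun t => (τ.symm.trans (H t)).trans τ, ?_, ?_, ?_⟩
  · exact τ.contMDiff.comp
      (hH.comp (contMDiff_fst.prodMk (τ.symm.contMDiff.comp contMDiff_snd)))
  · ext x
    simp [h0]
  · simp [SimpleClosedCurve.map, Set.image_image, ← h1]

theorem SimpleClosedCurve.map_trans (c : SimpleClosedCurve S) (σ τ : SelfDiffeo S) :
    c.map (σ.trans τ) = (c.map σ).map τ := by
  apply Subtype.ext
  simp [SimpleClosedCurve.map, Set.image_image]

theorem SimpleClosedCurve.map_symm_map (c : SimpleClosedCurve S) (τ : SelfDiffeo S) :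
    (c.map τ).map τ.symm = c := by
  apply Subtype.ext
  simp [SimpleClosedCurve.map, Set.image_image]

end Isotopies

/-! ### Rotation phases and twists along families of collars -/

/-- The rotation factor `exp(ε 2π r i)` of a twist at the height where the profile is `r`. -/
noncomputable def twistPhase (ε : ℤ) (r : ℝ) : ℂ :=
  Complex.exp ((ε * (2 * Real.pi * r) : ℝ) * Complex.I)

theorem norm_twistPhase (ε : ℤ) (r : ℝ) : ‖twistPhase ε r‖ = 1 :=
  Complex.norm_exp_ofReal_mul_I _

theorem twistPhase_add (ε : ℤ) (r r' : ℝ) :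
    twistPhase ε (r + r') = twistPhase ε r * twistPhase ε r' := by
  simp only [twistPhase, ← Complex.exp_add]
  congr 1
  push_cast
  ring

/-- Profiles end at the integers 1 and 2, so this makes a twist the identity near both ends of its
collar. -/
theorem twistPhase_intCast (ε n : ℤ) : twistPhase ε n = 1 := by
  have : ((ε * (2 * Real.pi * n) : ℝ) * Complex.I) =
      ((ε * n : ℤ) : ℂ) * (2 * Real.pi * Complex.I) := by push_cast; ring
  rw [twistPhase, this, Complex.exp_int_mul_two_pi_mul_I]

@[simp] theorem twistPhase_one (ε : ℤ) : twistPhase ε 1 = 1 := by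
  simpa using twistPhase_intCast ε 1

@[simp] theorem twistPhase_two (ε : ℤ) : twistPhase ε 2 = 1 := by
  simpa using twistPhase_intCast ε 2

theorem twistPhase_neg_mul (ε : ℤ) (r : ℝ) : twistPhase ε r * twistPhase (-ε) r = 1 := by
  simp only [twistPhase, ← Complex.exp_add]
  rw [← Complex.exp_zero]
  congr 1
  push_cast
  ring

theorem contDiff_twistPhase (ε : ℤ) : ContDiff ℝ ∞ (twistPhase ε) := by
  unfold twistPhase
  have : ContDiff ℝ ∞ (fun r : ℝ => (((ε * (2 * Real.pi * r) : ℝ)) : ℂ)) :=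
    Complex.ofRealCLM.contDiff.comp
      (contDiff_const.mul (contDiff_const.mul contDiff_id))
  exact (this.mul contDiff_const).cexp

section TwistFun

open Classical in
/-- The twist along the member `F (s, ·)` of a family of collars. -/
noncomputable def twistFun {S : Type*} (ε : ℤ) (N : Set (ℝ × S)) (F : ℝ × S → ℂ) (B : ℝ × ℂ → S)
    (f : ℝ × ℝ → ℝ) (p : ℝ × S) : S :=
  if p ∈ N then B (p.1, F p * twistPhase ε (f (p.1, ‖F p‖))) else p.2

variable {S : Type*} {N : Set (ℝ × S)} {F : ℝ × S → ℂ} {B : ℝ × ℂ → S} {f : ℝ × ℝ → ℝ}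

theorem twistFun_of_mem {p : ℝ × S} (hp : p ∈ N) (ε : ℤ) :
    twistFun ε N F B f p = B (p.1, F p * twistPhase ε (f (p.1, ‖F p‖))) := if_pos hp

theorem twistFun_of_notMem {p : ℝ × S} (hp : p ∉ N) (ε : ℤ) :
    twistFun ε N F B f p = p.2 := if_neg hp

end TwistFun

section Families

variable {S : Type*} [TopologicalSpace S] [ChartedSpace ℂ S]

/-- A smooth one-parameter family of collars `F (s, ·)` with values in the annulus
`{a < |z| < b}`, with inverses `B (s, ·)`. -/
structure IsCollarFamily (N : Set (ℝ × S)) (F : ℝ × S → ℂ) (B : ℝ × ℂ → S) (a b : ℝ) : Prop where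
  isOpen : IsOpen N
  mapsTo : ∀ p ∈ N, a < ‖F p‖ ∧ ‖F p‖ < b
  left_inv : ∀ p ∈ N, B (p.1, F p) = p.2
  mem : ∀ s z, a < ‖z‖ → ‖z‖ < b → (s, B (s, z)) ∈ N
  right_inv : ∀ s z, a < ‖z‖ → ‖z‖ < b → F (s, B (s, z)) = z
  smooth : ContMDiffOn (𝓘(ℝ, ℝ).prod 𝓘(ℝ, ℂ)) 𝓘(ℝ, ℂ) ∞ F N
  smooth_inv : ContMDiffOn (𝓘(ℝ, ℝ).prod 𝓘(ℝ, ℂ)) 𝓘(ℝ, ℂ) ∞ B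
    {q : ℝ × ℂ | a < ‖q.2‖ ∧ ‖q.2‖ < b}

/-- A smooth one-parameter family of functions equal to `1` before `a` and to `2` after `b`. -/
structure IsProfileFamily (f : ℝ × ℝ → ℝ) (a b : ℝ) : Prop where
  smooth : ContDiff ℝ ∞ f
  eq_one : ∀ s r, r ≤ a → f (s, r) = 1
  eq_two : ∀ s r, b ≤ r → f (s, r) = 2

variable {N : Set (ℝ × S)} {F : ℝ × S → ℂ} {B : ℝ × ℂ → S} {f : ℝ × ℝ → ℝ} {a b a' b' : ℝ}

/-- A rotation does not change the norm, hence not the profile value either, so the opposite phases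
cancel. -/
theorem IsCollarFamily.twistFun_neg (h : IsCollarFamily N F B a b) (ε : ℤ) (s : ℝ) (x : S) :
    twistFun (-ε) N F B f (s, twistFun ε N F B f (s, x)) = x := by
  by_cases hp : (s, x) ∈ N
  · have hn : ‖F (s, x) * twistPhase ε (f (s, ‖F (s, x)‖))‖ = ‖F (s, x)‖ := by
      rw [norm_mul, norm_twistPhase, mul_one]
    have h1 := h.mapsTo _ hp
    rw [← hn] at h1
    have h2 := h.mem s _ h1.1 h1.2
    have h3 := h.right_inv s _ h1.1 h1.2
    rw [twistFun_of_mem hp, twistFun_of_mem h2]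
    simp only [h3, hn]
    rw [mul_assoc, twistPhase_neg_mul, mul_one]
    exact h.left_inv _ hp
  · rw [twistFun_of_notMem hp, twistFun_of_notMem hp]

/-- Over a bounded time interval the core is the continuous image of a compact set, hence closed in
a Hausdorff space; closedness is local in time. Off this set twists are the identity, so they extend
smoothly past the boundary of the collar. -/
theorem IsCollarFamily.isClosed_core [T2Space S] (h : IsCollarFamily N F B a b) (ha' : a < a')
    (hb' : b' < b) : IsClosed {p | p ∈ N ∧ a' ≤ ‖F p‖ ∧ ‖F p‖ ≤ b'} := by
  have key : ∀ R : ℝ, IsClosed {p | p ∈ N ∧ p.1 ∈ Set.Icc (-R) R ∧ a' ≤ ‖F p‖ ∧ ‖F p‖ ≤ b'} := by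
    intro R
    have hK : IsCompact (Set.Icc (-R) R ×ˢ {z : ℂ | a' ≤ ‖z‖ ∧ ‖z‖ ≤ b'}) := by
      refine isCompact_Icc.prod ?_
      refine (isCompact_closedBall (0 : ℂ) b').of_isClosed_subset ?_ ?_
      · exact (isClosed_le continuous_const continuous_norm).inter
          (isClosed_le continuous_norm continuous_const)
      · rintro z ⟨_, hz⟩
        simpa using hz
    have hc : ContinuousOn (fun q : ℝ × ℂ => (q.1, B q))
        (Set.Icc (-R) R ×ˢ {z : ℂ | a' ≤ ‖z‖ ∧ ‖z‖ ≤ b'}) := by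
      refine continuousOn_fst.prodMk (h.smooth_inv.continuousOn.mono ?_)
      rintro ⟨s, z⟩ ⟨_, hz⟩
      exact ⟨ha'.trans_le hz.1, hz.2.trans_lt hb'⟩
    convert (hK.image_of_continuousOn hc).isClosed using 1
    ext ⟨s, x⟩
    constructor
    · rintro ⟨hp, hs, hz⟩
      exact ⟨(s, F (s, x)), ⟨hs, hz⟩, Prod.ext rfl (h.left_inv _ hp)⟩
    · rintro ⟨⟨s', z⟩, ⟨hs, hz⟩, he⟩
      obtain ⟨rfl, rfl⟩ := Prod.mk.inj he
      have h1 := ha'.trans_le hz.1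
      have h2 := hz.2.trans_lt hb'
      exact ⟨h.mem _ _ h1 h2, hs, by rw [h.right_inv _ _ h1 h2]; exact hz⟩
  rw [← isOpen_compl_iff, isOpen_iff_mem_nhds]
  rintro ⟨s, x⟩ hp
  have hs : {p : ℝ × S | p.1 ∈ Set.Ioo (-(|s| + 1)) (|s| + 1)} ∈ nhds (s, x) := by
    refine (isOpen_Ioo.preimage continuous_fst).mem_nhds ?_
    have := abs_le.1 (le_refl |s|)
    constructor <;> dsimp <;> linarith [this.1, this.2]
  have hc := (key (|s| + 1)).isOpen_compl.mem_nhds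
    (show (s, x) ∈ _ from fun hq => hp ⟨hq.1, hq.2.2⟩)
  filter_upwards [hs, hc] with q hq1 hq2 hq3
  exact hq2 ⟨hq3.1, ⟨hq1.1.le, hq1.2.le⟩, hq3.2⟩

/-- Two open sets cover the space: the collar, where the formula is smooth because `0 ≤ a` keeps the
norm away from zero, and the complement of the closed core, where the profile is 1 or 2 and the map
is the projection. -/
theorem IsCollarFamily.contMDiff_twistFun [T2Space S] (h : IsCollarFamily N F B a b)
    (hf : IsProfileFamily f a' b') (ha : 0 ≤ a) (ha' : a < a') (hb' : b' < b) (ε : ℤ) :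
    ContMDiff (𝓘(ℝ, ℝ).prod 𝓘(ℝ, ℂ)) 𝓘(ℝ, ℂ) ∞ (twistFun ε N F B f) := by
  intro p
  by_cases hp : p ∈ N
  · have hN := h.isOpen.mem_nhds hp
    have hF : ContMDiffAt (𝓘(ℝ, ℝ).prod 𝓘(ℝ, ℂ)) 𝓘(ℝ, ℂ) ∞ F p := (h.smooth p hp).contMDiffAt hN
    have h0 : F p ≠ 0 := norm_pos_iff.1 (ha.trans_lt (h.mapsTo p hp).1)
    have hrot : ContDiffAt ℝ ∞ (fun q : ℝ × ℂ => q.2 * twistPhase ε (f (q.1, ‖q.2‖)))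
        (p.1, F p) := by
      refine contDiffAt_snd.mul ((contDiff_twistPhase ε).contDiffAt.comp _
        (hf.smooth.contDiffAt.comp _ (contDiffAt_fst.prodMk ?_)))
      exact (contDiffAt_norm ℝ h0).comp (p.1, F p) contDiffAt_snd
    have hpair : ContMDiffAt (𝓘(ℝ, ℝ).prod 𝓘(ℝ, ℂ)) (𝓘(ℝ, ℝ).prod 𝓘(ℝ, ℂ)) ∞
        (fun q => (q.1, F q)) p := contMDiffAt_fst.prodMk hF
    have hpair' : ContMDiffAt (𝓘(ℝ, ℝ).prod 𝓘(ℝ, ℂ)) 𝓘(ℝ, ℝ × ℂ) ∞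
        (fun q => (q.1, F q)) p := contMDiffAt_fst.prodMk_space hF
    have hcomp := hrot.contMDiffAt.comp (f := fun q : ℝ × S => (q.1, F q)) p hpair'
    have hB : ContMDiffAt (𝓘(ℝ, ℝ).prod 𝓘(ℝ, ℂ)) 𝓘(ℝ, ℂ) ∞ B
        (p.1, F p * twistPhase ε (f (p.1, ‖F p‖))) := by
      refine (h.smooth_inv _ ?_).contMDiffAt (IsOpen.mem_nhds ?_ ?_)
      · have := h.mapsTo p hp
        simpa [norm_twistPhase] using this
      · exact (isOpen_lt continuous_const continuous_snd.norm).inter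
          (isOpen_lt continuous_snd.norm continuous_const)
      · have := h.mapsTo p hp
        simpa [norm_twistPhase] using this
    have hfin := hB.comp (f := fun q : ℝ × S => (q.1, F q * twistPhase ε (f (q.1, ‖F q‖)))) p
      (contMDiffAt_fst.prodMk hcomp)
    refine hfin.congr_of_eventuallyEq ?_
    filter_upwards [hN] with q hq
    exact twistFun_of_mem hq ε
  · have hZ := (h.isClosed_core ha' hb').isOpen_compl.mem_nhds
      (show p ∈ _ from fun hq => hp hq.1)
    have : ContMDiffAt (𝓘(ℝ, ℝ).prod 𝓘(ℝ, ℂ)) 𝓘(ℝ, ℂ) ∞ (Prod.snd : ℝ × S → S) p :=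
      contMDiffAt_snd
    refine this.congr_of_eventuallyEq ?_
    filter_upwards [hZ] with q hq
    by_cases hqN : q ∈ N
    · have hph : twistPhase ε (f (q.1, ‖F q‖)) = 1 := by
        by_cases h1 : ‖F q‖ ≤ a'
        · rw [hf.eq_one _ _ h1, twistPhase_one]
        · by_cases h2 : b' ≤ ‖F q‖
          · rw [hf.eq_two _ _ h2, twistPhase_two]
          · exact absurd ⟨hqN, (not_le.1 h1).le, (not_le.1 h2).le⟩ hq
      rw [twistFun_of_mem hqN, hph, mul_one, h.left_inv q hqN]
    · exact twistFun_of_notMem hqN ε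

/-- A family of collars and a family of profiles determine a smooth family of twists. -/
theorem IsCollarFamily.exists_twists [T2Space S] (h : IsCollarFamily N F B a b)
    (hf : IsProfileFamily f a' b') (ha : 0 ≤ a) (ha' : a < a') (hb' : b' < b) (ε : ℤ) :
    ∃ H : ℝ → SelfDiffeo S, IsSmoothFamily H ∧ ∀ s x, H s x = twistFun ε N F B f (s, x) := by
  have hsm := fun ε => h.contMDiff_twistFun hf ha ha' hb' ε
  have hsl : ∀ ε s, ContMDiff 𝓘(ℝ, ℂ) 𝓘(ℝ, ℂ) ∞ (fun x => twistFun ε N F B f (s, x)) :=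
    fun ε s => (hsm ε).comp (contMDiff_const.prodMk contMDiff_id)
  refine ⟨fun s =>
    { toFun := fun x => twistFun ε N F B f (s, x)
      invFun := fun x => twistFun (-ε) N F B f (s, x)
      left_inv := fun x => h.twistFun_neg ε s x
      right_inv := fun x => by simpa using h.twistFun_neg (f := f) (-ε) s x
      contMDiff_toFun := hsl ε s
      contMDiff_invFun := hsl (-ε) s }, hsm ε, fun s x => rfl⟩

end Families

/-! ### Determinants and orientation -/

section Determinants

theorem det_eq_re_mul_im_sub (A : ℂ →L[ℝ] ℂ) :
    A.det = (A 1).re * (A Complex.I).im - (A Complex.I).re * (A 1).im := by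
  rw [ContinuousLinearMap.det, ← LinearMap.det_toMatrix Complex.basisOneI, Matrix.det_fin_two]
  simp [LinearMap.toMatrix_apply, Complex.coe_basisOneI_repr]

theorem det_comp (A B : ℂ →L[ℝ] ℂ) : (A.comp B).det = A.det * B.det := by
  simp [ContinuousLinearMap.det, LinearMap.det_comp]

end Determinants

section Orientation

variable {S : Type*} [TopologicalSpace S] [ChartedSpace ℂ S]

/-- A complex valued function preserves the orientation at `x` if its differential has positive
determinant in every chart of the atlas. -/
def IsOrientedAt (f : S → ℂ) (x : S) : Prop :=
  ∀ e ∈ atlas ℂ S, x ∈ e.source → 0 < (fderiv ℝ (f ∘ e.symm) (e x)).det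

theorem IsOrientedAt.congr {f g : S → ℂ} {x : S} (hf : IsOrientedAt f x) (h : g =ᶠ[nhds x] f) :
    IsOrientedAt g x := by
  intro e he hx
  have : g ∘ e.symm =ᶠ[nhds (e x)] f ∘ e.symm := by
    have ht : Filter.Tendsto e.symm (nhds (e x)) (nhds x) := by
      simpa [e.left_inv hx] using (e.continuousAt_symm (e.map_source hx)).tendsto
    exact ht.eventually h
  rw [this.fderiv_eq]
  exact hf e he hx

section Charts

variable [IsManifold 𝓘(ℝ, ℂ) ∞ S]

theorem contDiffAt_comp_chart_symm {f : S → ℂ} {x : S}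
    (hf : ContMDiffAt 𝓘(ℝ, ℂ) 𝓘(ℝ, ℂ) ∞ f x) {e : OpenPartialHomeomorph S ℂ}
    (he : e ∈ atlas ℂ S) (hx : x ∈ e.source) : ContDiffAt ℝ ∞ (f ∘ e.symm) (e x) := by
  rw [← contMDiffAt_iff_contDiffAt]
  have h1 := (contMDiffOn_symm_of_mem_maximalAtlas (I := 𝓘(ℝ, ℂ)) (n := ∞)
    (IsManifold.subset_maximalAtlas he)).contMDiffAt (e.open_target.mem_nhds (e.map_source hx))
  refine ContMDiffAt.comp (I' := 𝓘(ℝ, ℂ)) (e x) ?_ h1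
  rwa [e.left_inv hx]

theorem contMDiffAt_of_mem_atlas {e : OpenPartialHomeomorph S ℂ} (he : e ∈ atlas ℂ S) {x : S}
    (hx : x ∈ e.source) : ContMDiffAt 𝓘(ℝ, ℂ) 𝓘(ℝ, ℂ) ∞ e x :=
  (contMDiffOn_of_mem_maximalAtlas (I := 𝓘(ℝ, ℂ)) (n := ∞)
    (IsManifold.subset_maximalAtlas he)).contMDiffAt (e.open_source.mem_nhds hx)

theorem differentiableAt_comp_chart_symm {f : S → ℂ} {x : S}
    (hf : ContMDiffAt 𝓘(ℝ, ℂ) 𝓘(ℝ, ℂ) ∞ f x) {e : OpenPartialHomeomorph S ℂ}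
    (he : e ∈ atlas ℂ S) (hx : x ∈ e.source) : DifferentiableAt ℝ (f ∘ e.symm) (e x) :=
  (contDiffAt_comp_chart_symm hf he hx).differentiableAt (by simp)

/-- The differential of a composition `g ∘ f` in a chart. -/
theorem det_fderiv_comp {f : S → ℂ} {g : ℂ → ℂ} {x : S} (hg : DifferentiableAt ℝ g (f x))
    (hf : ContMDiffAt 𝓘(ℝ, ℂ) 𝓘(ℝ, ℂ) ∞ f x) {e : OpenPartialHomeomorph S ℂ}
    (he : e ∈ atlas ℂ S) (hx : x ∈ e.source) :
    (fderiv ℝ ((g ∘ f) ∘ e.symm) (e x)).det =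
      (fderiv ℝ g (f x)).det * (fderiv ℝ (f ∘ e.symm) (e x)).det := by
  have hfe : (f ∘ e.symm) (e x) = f x := by simp [e.left_inv hx]
  rw [Function.comp_assoc, fderiv_comp (e x) (by rwa [hfe])
    (differentiableAt_comp_chart_symm hf he hx), det_comp, hfe]

/-- The differential of `f` in a chart in terms of the differential in another one. -/
theorem det_fderiv_change {f : S → ℂ} {x : S} (hf : ContMDiffAt 𝓘(ℝ, ℂ) 𝓘(ℝ, ℂ) ∞ f x)
    {e e' : OpenPartialHomeomorph S ℂ} (he : e ∈ atlas ℂ S) (he' : e' ∈ atlas ℂ S)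
    (hx : x ∈ e.source) (hx' : x ∈ e'.source) :
    (fderiv ℝ (f ∘ e'.symm) (e' x)).det =
      (fderiv ℝ (f ∘ e.symm) (e x)).det * (fderiv ℝ (e ∘ e'.symm) (e' x)).det := by
  have h := det_fderiv_comp (f := e) (g := f ∘ e.symm) (x := x)
    (differentiableAt_comp_chart_symm hf he hx) (contMDiffAt_of_mem_atlas he hx) he' hx'
  rw [← h]
  have : f ∘ e'.symm =ᶠ[nhds (e' x)] (((f ∘ e.symm) ∘ e) ∘ e'.symm) := by
    have ht : Filter.Tendsto e'.symm (nhds (e' x)) (nhds x) := by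
      simpa [e'.left_inv hx'] using (e'.continuousAt_symm (e'.map_source hx')).tendsto
    filter_upwards [ht.eventually (e.open_source.mem_nhds hx)] with z hz
    simp [e.left_inv hz]
  rw [this.fderiv_eq]

theorem IsOrientedAt.comp_iff {f : S → ℂ} {g : ℂ → ℂ} {x : S} (h : IsOrientedAt f x)
    (hg : DifferentiableAt ℝ g (f x)) (hf : ContMDiffAt 𝓘(ℝ, ℂ) 𝓘(ℝ, ℂ) ∞ f x) :
    IsOrientedAt (g ∘ f) x ↔ 0 < (fderiv ℝ g (f x)).det := by
  constructor
  · intro h'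
    have h1 := h' (chartAt ℂ x) (chart_mem_atlas ℂ x) (mem_chart_source ℂ x)
    rw [det_fderiv_comp hg hf (chart_mem_atlas ℂ x) (mem_chart_source ℂ x)] at h1
    exact pos_of_mul_pos_left h1 (h _ (chart_mem_atlas ℂ x) (mem_chart_source ℂ x)).le
  · intro h' e he hx
    rw [det_fderiv_comp hg hf he hx]
    exact mul_pos h' (h e he hx)

end Charts

variable [OrientedSurface S]

theorem isOrientedAt_of_mem_atlas {e : OpenPartialHomeomorph S ℂ} (he : e ∈ atlas ℂ S) {x : S}
    (hx : x ∈ e.source) : IsOrientedAt e x := by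
  intro e' he' hx'
  have := OrientedSurface.det_pos e' he' e he (e' x) (by simp [hx, hx', e'.left_inv hx'])
  simpa using this

/-- One chart suffices, since the transition maps of the atlas have positive determinant. -/
theorem isOrientedAt_of_det_pos {f : S → ℂ} {x : S} (hf : ContMDiffAt 𝓘(ℝ, ℂ) 𝓘(ℝ, ℂ) ∞ f x)
    {e : OpenPartialHomeomorph S ℂ} (he : e ∈ atlas ℂ S) (hx : x ∈ e.source)
    (h : 0 < (fderiv ℝ (f ∘ e.symm) (e x)).det) : IsOrientedAt f x := by
  intro e' he' hx'
  rw [det_fderiv_change hf he he' hx hx']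
  exact mul_pos h (isOrientedAt_of_mem_atlas he hx e' he' hx')

/-- A self-map of a surface preserves the orientation at `x` if its differential at `x` has
positive determinant in the charts of the atlas. -/
def PreservesOrientationAt (h : S → S) (x : S) : Prop :=
  ∀ e ∈ atlas ℂ S, h x ∈ e.source → IsOrientedAt (e ∘ h) x

theorem PreservesOrientationAt.isOrientedAt_comp {h : S → S} {f : S → ℂ} {x : S}
    (hx : PreservesOrientationAt h x) (hh : ContMDiffAt 𝓘(ℝ, ℂ) 𝓘(ℝ, ℂ) ∞ h x)
    (hf : ContMDiffAt 𝓘(ℝ, ℂ) 𝓘(ℝ, ℂ) ∞ f (h x)) (hfx : IsOrientedAt f (h x)) :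
    IsOrientedAt (f ∘ h) x := by
  set e := chartAt ℂ (h x)
  have he : e ∈ atlas ℂ S := chart_mem_atlas ℂ _
  have hs : h x ∈ e.source := mem_chart_source ℂ _
  have h1 := ((hx e he hs).comp_iff (g := f ∘ e.symm)
    (differentiableAt_comp_chart_symm hf he hs)
    ((contMDiffAt_of_mem_atlas he hs).comp x hh)).2 (hfx e he hs)
  refine h1.congr ?_
  filter_upwards [hh.continuousAt.eventually (e.open_source.mem_nhds hs)] with y hy
  simp [e.left_inv hy]

/-- Allows any oriented function, such as a collar, to serve as the chart at the image point. -/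
theorem preservesOrientationAt_of_comp {h : S → S} {f : S → ℂ} {x : S}
    (hh : ContMDiffAt 𝓘(ℝ, ℂ) 𝓘(ℝ, ℂ) ∞ h x)
    (hf : ContMDiffAt 𝓘(ℝ, ℂ) 𝓘(ℝ, ℂ) ∞ f (h x)) (hfx : IsOrientedAt f (h x))
    (hx : IsOrientedAt (f ∘ h) x) : PreservesOrientationAt h x := by
  intro e he hs
  have hes := (contMDiffAt_of_mem_atlas he hs).comp x hh
  set k := chartAt ℂ x
  have hk : k ∈ atlas ℂ S := chart_mem_atlas ℂ _
  have hks : x ∈ k.source := mem_chart_source ℂ _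
  refine isOrientedAt_of_det_pos hes hk hks ?_
  have h1 := det_fderiv_comp (f := e ∘ h) (g := f ∘ e.symm) (x := x)
    (differentiableAt_comp_chart_symm hf he hs) hes hk hks
  have h2 : IsOrientedAt ((f ∘ e.symm) ∘ (e ∘ h)) x := by
    refine hx.congr ?_
    filter_upwards [hh.continuousAt.eventually (e.open_source.mem_nhds hs)] with y hy
    simp [e.left_inv hy]
  have h3 := h2 k hk hks
  rw [h1] at h3
  exact pos_of_mul_pos_right h3 (hfx e he hs).le

theorem PreservesOrientationAt.symm {h : SelfDiffeo S} {x : S} (hx : PreservesOrientationAt h x) :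
    PreservesOrientationAt h.symm (h x) := by
  set k := chartAt ℂ x
  have hk : k ∈ atlas ℂ S := chart_mem_atlas ℂ _
  have hks : x ∈ k.source := mem_chart_source ℂ _
  have hks' : h.symm (h x) ∈ k.source := by simpa using hks
  set e := chartAt ℂ (h x)
  have he : e ∈ atlas ℂ S := chart_mem_atlas ℂ _
  have hes : h x ∈ e.source := mem_chart_source ℂ _
  have hsm : ContMDiffAt 𝓘(ℝ, ℂ) 𝓘(ℝ, ℂ) ∞ (k ∘ h.symm) (h x) :=
    (contMDiffAt_of_mem_atlas hk hks').comp _ h.symm.contMDiff.contMDiffAt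
  refine preservesOrientationAt_of_comp (f := k) h.symm.contMDiff.contMDiffAt
    (contMDiffAt_of_mem_atlas hk hks') (isOrientedAt_of_mem_atlas hk hks')
    (isOrientedAt_of_det_pos hsm he hes ?_)
  have h1 := (hx e he hes).comp_iff (g := (k ∘ h.symm) ∘ e.symm)
    (differentiableAt_comp_chart_symm hsm he hes)
    ((contMDiffAt_of_mem_atlas he hes).comp x h.contMDiff.contMDiffAt)
  refine h1.1 ((isOrientedAt_of_mem_atlas hk hks).congr ?_)
  filter_upwards [h.contMDiff.continuous.continuousAt.eventually
    (e.open_source.mem_nhds hes)] with y hy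
  simp [e.left_inv hy]

theorem preservesOrientationAt_refl (x : S) :
    PreservesOrientationAt (Diffeomorph.refl 𝓘(ℝ, ℂ) S ∞) x :=
  fun _ he hx => isOrientedAt_of_mem_atlas he hx

/-- The differential of a diffeomorphism in charts is invertible. -/
theorem det_fderiv_diffeo_ne_zero (h : SelfDiffeo S) {x : S} {e k : OpenPartialHomeomorph S ℂ}
    (he : e ∈ atlas ℂ S) (hk : k ∈ atlas ℂ S) (hx : h x ∈ e.source) (hxk : x ∈ k.source) :
    (fderiv ℝ ((e ∘ h) ∘ k.symm) (k x)).det ≠ 0 := by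
  have hks' : h.symm (h x) ∈ k.source := by simpa using hxk
  have hsm : ContMDiffAt 𝓘(ℝ, ℂ) 𝓘(ℝ, ℂ) ∞ (k ∘ h.symm) (h x) :=
    (contMDiffAt_of_mem_atlas hk hks').comp _ h.symm.contMDiff.contMDiffAt
  have h1 := det_fderiv_comp (f := e ∘ h) (g := (k ∘ h.symm) ∘ e.symm) (x := x)
    (differentiableAt_comp_chart_symm hsm he hx)
    ((contMDiffAt_of_mem_atlas he hx).comp x h.contMDiff.contMDiffAt) hk hxk
  have h2 : IsOrientedAt (((k ∘ h.symm) ∘ e.symm) ∘ (e ∘ h)) x := by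
    refine (isOrientedAt_of_mem_atlas hk hxk).congr ?_
    filter_upwards [h.contMDiff.continuous.continuousAt.eventually
      (e.open_source.mem_nhds hx)] with y hy
    simp [e.left_inv hy]
  have h3 := h2 k hk hxk
  rw [h1] at h3
  exact right_ne_zero_of_mul h3.ne'

/-- Orientation is preserved along an isotopy. -/
theorem preservesOrientationAt_of_isotopic {h : SelfDiffeo S}
    (hh : DiffeoIsotopic (Diffeomorph.refl 𝓘(ℝ, ℂ) S ∞) h) (x : S) :
    PreservesOrientationAt h x := by
  obtain ⟨H, hH, h0, h1⟩ := hh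
  set k := chartAt ℂ x
  have hk : k ∈ atlas ℂ S := chart_mem_atlas ℂ _
  have hks : x ∈ k.source := mem_chart_source ℂ _
  have hsl : ∀ s, ContMDiffAt 𝓘(ℝ, ℂ) 𝓘(ℝ, ℂ) ∞ (H s) x := fun s => (H s).contMDiff.contMDiffAt
  -- In charts fixed near time `s₀`, orientation at `x` is decided by the sign of a continuous
  -- function of time that is nonzero at `s₀`. Hence the good times form a clopen subset of the
  -- connected line.
  have key : ∀ s₀ : ℝ, ∃ d : ℝ → ℝ, ContinuousAt d s₀ ∧ d s₀ ≠ 0 ∧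
      ∀ᶠ s in nhds s₀, (PreservesOrientationAt (H s) x ↔ 0 < d s) := by
    intro s₀
    set e := chartAt ℂ (H s₀ x)
    have he : e ∈ atlas ℂ S := chart_mem_atlas ℂ _
    have hes : H s₀ x ∈ e.source := mem_chart_source ℂ _
    refine ⟨fun s => (fderiv ℝ ((e ∘ H s) ∘ k.symm) (k x)).det, ?_,
      det_fderiv_diffeo_ne_zero (H s₀) he hk hes hks, ?_⟩
    · have hjoint : ContDiffAt ℝ ∞ (Function.uncurry fun (s : ℝ) (z : ℂ) =>
          ((e ∘ H s) ∘ k.symm) z) (s₀, k x) := by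
        rw [← contMDiffAt_iff_contDiffAt]
        have hks1 := (contMDiffOn_symm_of_mem_maximalAtlas (I := 𝓘(ℝ, ℂ)) (n := ∞)
          (IsManifold.subset_maximalAtlas hk)).contMDiffAt
          (k.open_target.mem_nhds (k.map_source hks))
        have hk2 : ContMDiffAt 𝓘(ℝ, ℝ × ℂ) (𝓘(ℝ, ℝ).prod 𝓘(ℝ, ℂ)) ∞
            (fun p : ℝ × ℂ => (p.1, k.symm p.2)) (s₀, k x) := by
          refine ContMDiffAt.prodMk contDiffAt_fst.contMDiffAt ?_
          exact ContMDiffAt.comp (I' := 𝓘(ℝ, ℂ)) (s₀, k x) (g := k.symm) (f := Prod.snd) hks1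
            contDiffAt_snd.contMDiffAt
        have hH2 := ContMDiffAt.comp (s₀, k x) (g := fun p : ℝ × S => H p.1 p.2)
          (f := fun p : ℝ × ℂ => (p.1, k.symm p.2)) hH.contMDiffAt hk2
        refine ContMDiffAt.comp (I' := 𝓘(ℝ, ℂ)) (s₀, k x) (g := e)
          (f := fun p : ℝ × ℂ => H p.1 (k.symm p.2)) ?_ hH2
        simp only [k.left_inv hks]
        exact contMDiffAt_of_mem_atlas he hes
      have hc : ContDiffAt ℝ 0 (fun s => fderiv ℝ ((e ∘ H s) ∘ k.symm) (k x)) s₀ :=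
        ContDiffAt.fderiv (n := 1) (g := fun _ => k x) (hjoint.of_le (by simp)) contDiffAt_const
          (by simp)
      exact ContinuousLinearMap.continuous_det.continuousAt.comp hc.continuousAt
    · have hcont : ContinuousAt (fun s => H s x) s₀ :=
        (hH.continuous.comp (continuous_id.prodMk continuous_const)).continuousAt
      filter_upwards [hcont.eventually (e.open_source.mem_nhds hes)] with s hs
      have hes' := (contMDiffAt_of_mem_atlas he hs).comp x (hsl s)
      constructor
      · intro h
        exact h e he hs k hk hks
      · intro h
        exact preservesOrientationAt_of_comp (hsl s) (contMDiffAt_of_mem_atlas he hs)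
          (isOrientedAt_of_mem_atlas he hs) (isOrientedAt_of_det_pos hes' hk hks h)
  have hcl : IsClopen {s | PreservesOrientationAt (H s) x} := by
    constructor
    · rw [← isOpen_compl_iff, isOpen_iff_mem_nhds]
      intro s hs
      obtain ⟨d, hd, hd0, hev⟩ := key s
      have : d s < 0 := lt_of_le_of_ne (not_lt.1 fun h => hs (hev.self_of_nhds.2 h)) hd0
      filter_upwards [hev, hd.eventually_lt_const this] with t ht ht' hP
      exact absurd (ht.1 hP) ht'.not_gt
    · rw [isOpen_iff_mem_nhds]
      intro s hs
      obtain ⟨d, hd, hd0, hev⟩ := key s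
      filter_upwards [hev, hd.eventually_const_lt (hev.self_of_nhds.1 hs)] with t ht ht'
      exact ht.2 ht'
  have huniv := hcl.eq_univ ⟨0, by rw [Set.mem_ofPred_eq, h0]; exact preservesOrientationAt_refl x⟩
  have : (1 : ℝ) ∈ {s | PreservesOrientationAt (H s) x} := huniv ▸ Set.mem_univ _
  rwa [Set.mem_ofPred_eq, h1] at this

end Orientation

/-! ### Twists along a fixed bicollar -/

section ModelTwists

variable {S : Type*} [TopologicalSpace S] [ChartedSpace ℂ S]

/-- `τ` is the twist along the collar `φ` with profile `f`. -/
def IsTwistAlong (ε : ℤ) (φ : OpenPartialHomeomorph S ℂ) (f : ℝ → ℝ) (τ : SelfDiffeo S) : Prop :=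
  (∀ x ∉ φ.source, τ x = x) ∧
    ∀ x ∈ φ.source, τ x = φ.symm (φ x * twistPhase ε (f ‖φ x‖))

theorem IsTwistAlong.unique {ε : ℤ} {φ : OpenPartialHomeomorph S ℂ} {f : ℝ → ℝ}
    {τ τ' : SelfDiffeo S} (h : IsTwistAlong ε φ f τ) (h' : IsTwistAlong ε φ f τ') : τ = τ' := by
  ext x
  by_cases hx : x ∈ φ.source
  · rw [h.2 x hx, h'.2 x hx]
  · rw [h.1 x hx, h'.1 x hx]

variable {c : Set S} {φ : OpenPartialHomeomorph S ℂ} {f : ℝ → ℝ} {τ : SelfDiffeo S} {ε : ℤ}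

theorem IsBicollar.mem_target (hφ : IsBicollar c φ) {z : ℂ} :
    z ∈ φ.target ↔ 1 < ‖z‖ ∧ ‖z‖ < 2 := by
  rw [hφ.target_eq]; rfl

theorem IsBicollar.norm_mem (hφ : IsBicollar c φ) {x : S} (hx : x ∈ φ.source) :
    1 < ‖φ x‖ ∧ ‖φ x‖ < 2 :=
  hφ.mem_target.1 (φ.map_source hx)

theorem IsBicollar.mul_phase_mem (hφ : IsBicollar c φ) {x : S} (hx : x ∈ φ.source) (r : ℝ) :
    φ x * twistPhase ε r ∈ φ.target := by
  rw [hφ.mem_target, norm_mul, norm_twistPhase, mul_one]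
  exact hφ.norm_mem hx

theorem IsBicollar.mem_iff (hφ : IsBicollar c φ) {x : S} (hx : x ∈ φ.source) :
    x ∈ c ↔ ‖φ x‖ = 3 / 2 := by
  constructor
  · intro h
    have : φ x ∈ φ '' c := Set.mem_image_of_mem _ h
    rw [hφ.image_eq] at this
    exact this
  · intro h
    have : φ x ∈ φ '' c := by rw [hφ.image_eq]; exact h
    obtain ⟨y, hy, hyx⟩ := this
    rwa [← φ.injOn (hφ.subset_source hy) hx hyx]

/-- Affine interpolation keeps the end values 1 and 2 at every real time, also outside `[0, 1]`,
because the coefficients sum to one. -/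
theorem IsTwistProfile.exists_isProfileFamily {f f' : ℝ → ℝ} (hf : IsTwistProfile f)
    (hf' : IsTwistProfile f') : ∃ (F : ℝ × ℝ → ℝ) (a b : ℝ), 1 < a ∧ b < 2 ∧
      IsProfileFamily F a b ∧ (∀ r, F (0, r) = f r) ∧ ∀ r, F (1, r) = f' r := by
  obtain ⟨a, b, ha, hab, hb, h1, h2⟩ := hf.eq_ends
  obtain ⟨a', b', ha', hab', hb', h1', h2'⟩ := hf'.eq_ends
  refine ⟨fun p => (1 - p.1) * f p.2 + p.1 * f' p.2, min a a', max b b', lt_min ha ha',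
    max_lt hb hb', ⟨?_, ?_, ?_⟩, by simp, by simp⟩
  · exact ((contDiff_const.sub contDiff_fst).mul (hf.smooth.comp contDiff_snd)).add
      (contDiff_fst.mul (hf'.smooth.comp contDiff_snd))
  · intro s r hr
    simp [h1 r (hr.trans (min_le_left _ _)), h1' r (hr.trans (min_le_right _ _))]
  · intro s r hr
    simp only [h2 r ((le_max_left _ _).trans hr), h2' r ((le_max_right _ _).trans hr)]
    ring

/-- The constant family of collars given by a bicollar. -/
theorem IsBicollar.isCollarFamily (hφ : IsBicollar c φ) :
    IsCollarFamily (Prod.snd ⁻¹' φ.source : Set (ℝ × S)) (fun p => φ p.2)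
      (fun q => φ.symm q.2) 1 2 where
  isOpen := φ.open_source.preimage continuous_snd
  mapsTo p hp := hφ.norm_mem hp
  left_inv p hp := φ.left_inv hp
  mem s z h1 h2 := φ.map_target (hφ.mem_target.2 ⟨h1, h2⟩)
  right_inv s z h1 h2 := φ.right_inv (hφ.mem_target.2 ⟨h1, h2⟩)
  smooth := hφ.smooth.comp contMDiff_snd.contMDiffOn (fun _ h => h)
  smooth_inv := by
    have h2 : ContMDiffOn (𝓘(ℝ, ℝ).prod 𝓘(ℝ, ℂ)) 𝓘(ℝ, ℂ) ∞ (Prod.snd : ℝ × ℂ → ℂ)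
      {q : ℝ × ℂ | 1 < ‖q.2‖ ∧ ‖q.2‖ < 2} := contMDiff_snd.contMDiffOn
    exact hφ.smooth_symm.comp h2 (fun q hq => hφ.mem_target.2 hq)

theorem IsBicollar.isTwistAlong_of_eq {s : ℝ} {F : ℝ × ℝ → ℝ} (hF : ∀ r, F (s, r) = f r)
    (hτ : ∀ x, τ x = twistFun ε (Prod.snd ⁻¹' φ.source : Set (ℝ × S)) (fun p => φ p.2)
      (fun q => φ.symm q.2) F (s, x)) : IsTwistAlong ε φ f τ := by
  constructor
  · intro x hx
    rw [hτ, twistFun_of_notMem (by exact hx)]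
  · intro x hx
    rw [hτ, twistFun_of_mem (by exact hx)]
    simp only [hF]

/-- Changing the profile of a twist is an isotopy. -/
theorem IsBicollar.isotopic_of_profiles [T2Space S] (hφ : IsBicollar c φ) {f' : ℝ → ℝ}
    (hf : IsTwistProfile f) (hf' : IsTwistProfile f') {τ' : SelfDiffeo S}
    (hτ : IsTwistAlong ε φ f τ) (hτ' : IsTwistAlong ε φ f' τ') : DiffeoIsotopic τ τ' := by
  obtain ⟨F, a, b, ha, hb, hF, hF0, hF1⟩ := hf.exists_isProfileFamily hf'
  obtain ⟨H, hH, hHt⟩ := hφ.isCollarFamily.exists_twists hF zero_le_one ha hb ε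
  exact ⟨H, hH, (IsBicollar.isTwistAlong_of_eq hF0 (hHt 0)).unique hτ,
    (IsBicollar.isTwistAlong_of_eq hF1 (hHt 1)).unique hτ'⟩

theorem IsBicollar.exists_isTwistAlong [T2Space S] (hφ : IsBicollar c φ) (hf : IsTwistProfile f)
    (ε : ℤ) : ∃ τ : SelfDiffeo S, IsTwistAlong ε φ f τ := by
  obtain ⟨F, a, b, ha, hb, hF, hF0, hF1⟩ := hf.exists_isProfileFamily hf
  obtain ⟨H, hH, hHt⟩ := hφ.isCollarFamily.exists_twists hF zero_le_one ha hb ε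
  exact ⟨H 0, IsBicollar.isTwistAlong_of_eq hF0 (hHt 0)⟩

theorem IsTwistAlong.apply_mem (h : IsTwistAlong ε φ f τ) (hφ : IsBicollar c φ) {x : S}
    (hx : x ∈ φ.source) : τ x ∈ φ.source ∧ φ (τ x) = φ x * twistPhase ε (f ‖φ x‖) := by
  rw [h.2 x hx]
  exact ⟨φ.map_target (hφ.mul_phase_mem hx _), φ.right_inv (hφ.mul_phase_mem hx _)⟩

theorem IsTwistAlong.symm (h : IsTwistAlong ε φ f τ) (hφ : IsBicollar c φ) :
    IsTwistAlong (-ε) φ f τ.symm := by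
  constructor
  · intro x hx
    apply τ.injective
    change τ (τ.symm x) = τ x
    rw [h.1 x hx, τ.apply_symm_apply]
  · intro x hx
    apply τ.injective
    change τ (τ.symm x) = τ _
    have h1 := hφ.mul_phase_mem (ε := -ε) hx (f ‖φ x‖)
    rw [τ.apply_symm_apply, h.2 _ (φ.map_target h1), φ.right_inv h1, norm_mul, norm_twistPhase, mul_one, mul_assoc,
      mul_comm (twistPhase (-ε) _), twistPhase_neg_mul, mul_one, φ.left_inv hx]

/-- A twist about `c` maps `c` onto itself. -/
theorem IsTwistAlong.image_eq (h : IsTwistAlong ε φ f τ) (hφ : IsBicollar c φ) : τ '' c = c := by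
  have key : ∀ {ε : ℤ} {τ : SelfDiffeo S}, IsTwistAlong ε φ f τ → ∀ x ∈ c, τ x ∈ c := by
    intro ε τ h x hx
    have hxs := hφ.subset_source hx
    obtain ⟨h1, h2⟩ := h.apply_mem hφ hxs
    rw [hφ.mem_iff h1, h2, norm_mul, norm_twistPhase, mul_one]
    exact (hφ.mem_iff hxs).1 hx
  apply Set.Subset.antisymm
  · rintro _ ⟨x, hx, rfl⟩
    exact key h x hx
  · intro x hx
    exact ⟨τ.symm x, key (h.symm hφ) x hx, by simp⟩

/-- The planar twist `z ↦ z exp(ε 2π f(|z|) i)` preserves the orientation. -/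
theorem det_fderiv_planar_twist (hf : ContDiff ℝ ∞ f) (ε : ℤ) {z : ℂ} (hz : z ≠ 0) :
    DifferentiableAt ℝ (fun w : ℂ => w * twistPhase ε (f ‖w‖)) z ∧
      0 < (fderiv ℝ (fun w : ℂ => w * twistPhase ε (f ‖w‖)) z).det := by
  set α : ℂ → ℝ := fun w => ε * (2 * Real.pi * f ‖w‖) with hα
  -- The angle depends only on the norm, so its differential is a multiple of the inner product with
  -- `z`. The differential of the twist is a rotation composed with `v ↦ v + k⟨z, v⟩ i z`; as `⟨z, i
  -- z⟩ = 0`, the determinant is 1 whatever `k` is.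
  obtain ⟨k, hk⟩ : ∃ k : ℝ, HasFDerivAt α (k • innerSL ℝ z) z := by
    have h1 : HasFDerivAt (fun w : ℂ => ‖w‖ ^ 2) (2 • innerSL ℝ z) z :=
      (hasStrictFDerivAt_norm_sq z).hasFDerivAt
    have hpos : (0 : ℝ) < ‖z‖ ^ 2 := by positivity
    have h2 := h1.sqrt hpos.ne'
    rw [← Nat.cast_smul_eq_nsmul ℝ, smul_smul] at h2
    have hg : DifferentiableAt ℝ (fun r => ε * (2 * Real.pi * f r)) (Real.sqrt (‖z‖ ^ 2)) :=
      (((hf.differentiable (by simp)) _).const_mul _).const_mul _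
    have h3 := hg.hasDerivAt.comp_hasFDerivAt z h2
    rw [smul_smul] at h3
    refine ⟨_, h3.congr_of_eventuallyEq (Filter.Eventually.of_forall fun w => ?_)⟩
    simp [hα]
  have hph : HasFDerivAt (fun w : ℂ => Complex.exp ((α w : ℂ) * Complex.I))
      (Complex.exp ((α z : ℂ) * Complex.I) • Complex.I • Complex.ofRealCLM.comp
        (k • innerSL ℝ z)) z := by
    have h1 := Complex.ofRealCLM.hasFDerivAt.comp z hk
    exact (h1.mul_const Complex.I).cexp
  have hT := (hasFDerivAt_id z).mul hph
  refine ⟨hT.differentiableAt, ?_⟩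
  rw [show (fun w : ℂ => w * twistPhase ε (f ‖w‖)) = id * (fun w : ℂ =>
    Complex.exp ((α w : ℂ) * Complex.I)) from rfl, hT.fderiv, det_eq_re_mul_im_sub]
  have hu : Complex.exp ((α z : ℂ) * Complex.I) = ⟨Real.cos (α z), Real.sin (α z)⟩ := by
    rw [Complex.exp_mul_I]
    apply Complex.ext <;> simp [← Complex.ofReal_cos, ← Complex.ofReal_sin]
  rw [hu]
  simp [Complex.inner]
  nlinarith [Real.sin_sq_add_cos_sq (α z)]

end ModelTwists

/-! ### Orientation of twists and transport of bicollars by diffeomorphisms -/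

section Transport

variable {S : Type*} [TopologicalSpace S] [ChartedSpace ℂ S]
variable {c : Set S} {φ : OpenPartialHomeomorph S ℂ} {f : ℝ → ℝ} {τ : SelfDiffeo S} {ε : ℤ}

theorem IsBicollar.contMDiffAt (hφ : IsBicollar c φ) {x : S} (hx : x ∈ φ.source) :
    ContMDiffAt 𝓘(ℝ, ℂ) 𝓘(ℝ, ℂ) ∞ φ x :=
  hφ.smooth.contMDiffAt (φ.open_source.mem_nhds hx)

theorem IsBicollar.isOrientedAt (hφ : IsBicollar c φ) {x : S} (hx : x ∈ φ.source) :
    IsOrientedAt φ x := by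
  intro e he hxe
  have := hφ.det_pos e he (e x) (by simp [hx, hxe, e.left_inv hxe])
  simpa using this

variable [OrientedSurface S]

/-- A twist preserves the orientation. -/
theorem IsTwistAlong.preservesOrientationAt (h : IsTwistAlong ε φ f τ) (hφ : IsBicollar c φ)
    (hf : IsTwistProfile f) (x : S) : PreservesOrientationAt τ x := by
  by_cases hx : x ∈ φ.source
  · have hτx := h.apply_mem hφ hx
    refine preservesOrientationAt_of_comp τ.contMDiff.contMDiffAt (hφ.contMDiffAt hτx.1)
      (hφ.isOrientedAt hτx.1) ?_
    have hz : φ x ≠ 0 := norm_pos_iff.1 (zero_lt_one.trans (hφ.norm_mem hx).1)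
    have hT := det_fderiv_planar_twist hf.smooth ε hz
    refine IsOrientedAt.congr (((hφ.isOrientedAt hx).comp_iff hT.1 (hφ.contMDiffAt hx)).2 hT.2) ?_
    filter_upwards [φ.open_source.mem_nhds hx] with y hy
    exact (h.apply_mem hφ hy).2
  -- The point may lie on the boundary of the collar, but the core is closed, so `τ` is the identity
  -- in a whole neighbourhood.
  · obtain ⟨F, a, b, ha, hb, hF, hF0, -⟩ := hf.exists_isProfileFamily hf
    have hcl := (hφ.isCollarFamily.isClosed_core ha hb).preimage
      (Continuous.prodMk_right (X := ℝ) (Y := S) 0)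
    have hev : τ =ᶠ[nhds x] Diffeomorph.refl 𝓘(ℝ, ℂ) S ∞ := by
      filter_upwards [hcl.isOpen_compl.mem_nhds (fun hx' => hx hx'.1)] with y hy
      by_cases hys : y ∈ φ.source
      · have hph : twistPhase ε (f ‖φ y‖) = 1 := by
          rw [← hF0]
          by_cases h1 : ‖φ y‖ ≤ a
          · rw [hF.eq_one _ _ h1, twistPhase_one]
          · by_cases h2 : b ≤ ‖φ y‖
            · rw [hF.eq_two _ _ h2, twistPhase_two]
            · exact absurd ⟨hys, (not_le.1 h1).le, (not_le.1 h2).le⟩ hy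
        rw [h.2 y hys, hph, mul_one, φ.left_inv hys]
        rfl
      · rw [h.1 y hys]
        rfl
    intro e he hxe
    have hτx : τ x = x := hev.self_of_nhds
    rw [hτx] at hxe
    refine (isOrientedAt_of_mem_atlas he hxe).congr ?_
    filter_upwards [hev] with y hy
    simp [hy]

/-- The image of a bicollar under a diffeomorphism. -/
noncomputable def mapCollar (h : SelfDiffeo S) (φ : OpenPartialHomeomorph S ℂ) :
    OpenPartialHomeomorph S ℂ :=
  h.symm.toHomeomorph.toOpenPartialHomeomorph ≫ₕ φ

omit [OrientedSurface S] in
@[simp] theorem mem_mapCollar_source {h : SelfDiffeo S} {x : S} :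
    x ∈ (mapCollar h φ).source ↔ h.symm x ∈ φ.source := by
  simp [mapCollar]

omit [OrientedSurface S] in
@[simp] theorem mapCollar_apply (h : SelfDiffeo S) (x : S) :
    mapCollar h φ x = φ (h.symm x) := by
  simp [mapCollar]

omit [OrientedSurface S] in
@[simp] theorem mapCollar_symm_apply (h : SelfDiffeo S) (z : ℂ) :
    (mapCollar h φ).symm z = h (φ.symm z) := by
  simp [mapCollar]

/-- Orientation enters through `det_pos` alone: the transported collar is `φ ∘ h⁻¹`, and `h⁻¹`
preserves orientation because `h` does. -/
theorem IsBicollar.map (hφ : IsBicollar c φ) {h : SelfDiffeo S}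
    (hh : ∀ x, PreservesOrientationAt h x) : IsBicollar (h '' c) (mapCollar h φ) where
  target_eq := by simp [mapCollar, hφ.target_eq]
  smooth := by
    refine (hφ.smooth.comp h.symm.contMDiff.contMDiffOn
      (s := (mapCollar h φ).source) ?_).congr ?_
    · intro x hx
      exact mem_mapCollar_source.1 hx
    · intro x _
      simp
  smooth_symm := by
    have ht : (mapCollar h φ).target = φ.target := by simp [mapCollar]
    rw [ht]
    refine (h.contMDiff.comp_contMDiffOn hφ.smooth_symm).congr ?_
    intro x _
    simp
  det_pos := by
    intro e he z hz
    have hz1 : z ∈ e.target := by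
      have := hz.1
      simpa using this
    have hz2 : h.symm (e.symm z) ∈ φ.source := by
      have := hz.2
      simpa using this
    have hxe : e.symm z ∈ e.source := e.map_target hz1
    have hP : PreservesOrientationAt h.symm (e.symm z) := by
      simpa using (hh (h.symm (e.symm z))).symm
    have := hP.isOrientedAt_comp h.symm.contMDiff.contMDiffAt (hφ.contMDiffAt hz2)
      (hφ.isOrientedAt hz2) e he hxe
    rw [e.right_inv hz1] at this
    convert this using 3
    ext w
    simp
  subset_source := by
    rintro _ ⟨x, hx, rfl⟩
    simpa using hφ.subset_source hx
  image_eq := by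
    rw [← hφ.image_eq, Set.image_image]
    simp

omit [OrientedSurface S] in
theorem IsTwistAlong.map (hτ : IsTwistAlong ε φ f τ) (h : SelfDiffeo S) :
    IsTwistAlong ε (mapCollar h φ) f ((h.symm.trans τ).trans h) := by
  constructor
  · intro x hx
    rw [mem_mapCollar_source] at hx
    simp [hτ.1 _ hx]
  · intro x hx
    rw [mem_mapCollar_source] at hx
    simp [hτ.2 _ hx]

end Transport

section Profiles

/-- There are profiles with their transition in any given interval. -/
theorem exists_isTwistProfile {a b : ℝ} (ha : 1 < a) (hab : a < b) (hb : b < 2) :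
    ∃ f : ℝ → ℝ, IsTwistProfile f ∧ (∀ r ≤ a, f r = 1) ∧ ∀ r, b ≤ r → f r = 2 := by
  have h1 : ∀ r ≤ a, 1 + Real.smoothTransition ((r - a) / (b - a)) = 1 := by
    intro r hr
    rw [Real.smoothTransition.zero_of_nonpos, add_zero]
    exact div_nonpos_of_nonpos_of_nonneg (by linarith) (by linarith)
  have h2 : ∀ r, b ≤ r → 1 + Real.smoothTransition ((r - a) / (b - a)) = 2 := by
    intro r hr
    rw [Real.smoothTransition.one_of_one_le]
    · norm_num
    · rw [le_div_iff₀ (by linarith)]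
      linarith
  refine ⟨fun r => 1 + Real.smoothTransition ((r - a) / (b - a)), ⟨?_, a, b, ha, hab, hb, h1, h2⟩,
    h1, h2⟩
  exact contDiff_const.add (Real.smoothTransition.contDiff.comp
    ((contDiff_id.sub contDiff_const).div_const _))

end Profiles

/-! ### Inverse function theorem at a point and near a compact set -/

section InverseFunction

/-- The smooth inverse function theorem as a statement on local diffeomorphisms. -/
theorem isLocalDiffeomorphAt_of_contDiffOn {E F : Type*} [NormedAddCommGroup E] [NormedSpace ℝ E]
    [CompleteSpace E] [NormedAddCommGroup F] [NormedSpace ℝ F] {f : E → F} {U : Set E}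
    (hU : IsOpen U) (hf : ContDiffOn ℝ ∞ f U) {a : E} (ha : a ∈ U) {f' : E ≃L[ℝ] F}
    (hf' : HasFDerivAt f (f' : E →L[ℝ] F) a) :
    IsLocalDiffeomorphAt 𝓘(ℝ, E) 𝓘(ℝ, F) ∞ f a := by
  have hfa : ContDiffAt ℝ ∞ f a := hf.contDiffAt (hU.mem_nhds ha)
  set e := hfa.toOpenPartialHomeomorph f hf' (by simp) with he
  have hcoe : ⇑e = f := hfa.toOpenPartialHomeomorph_coe hf' (by simp)
  -- The local inverse is known to be smooth only where the differential is invertible, so the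
  -- source is cut down to such points, which form an open set.
  set V : Set E := U ∩ fderiv ℝ f ⁻¹' Set.range ((↑) : (E ≃L[ℝ] F) → E →L[ℝ] F)
  have hV : IsOpen V :=
    (hf.continuousOn_fderiv_of_isOpen hU (by simp)).isOpen_inter_preimage hU
      ContinuousLinearEquiv.isOpen
  have haV : a ∈ V := ⟨ha, f', hf'.fderiv.symm⟩
  set e' := e.restr V
  have hs : e'.source = e.source ∩ V := e.restr_source' V hV
  have hcoe' : ⇑e' = f := hcoe
  refine ⟨⟨e'.toPartialEquiv, e'.open_source, e'.open_target, ?_, ?_⟩, ?_, ?_⟩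
  · change ContMDiffOn 𝓘(ℝ, E) 𝓘(ℝ, F) ∞ e' e'.source
    rw [contMDiffOn_iff_contDiffOn, hcoe', hs]
    exact hf.mono fun x hx => hx.2.1
  · change ContMDiffOn 𝓘(ℝ, F) 𝓘(ℝ, E) ∞ e'.symm e'.target
    rw [contMDiffOn_iff_contDiffOn]
    intro y hy
    have hx : e'.symm y ∈ e.source ∩ V := hs ▸ e'.map_target hy
    obtain ⟨-, hxU, g, hg⟩ := hx
    have hd : HasFDerivAt f (g : E →L[ℝ] F) (e'.symm y) := by
      rw [hg]
      exact ((hf.contDiffAt (hU.mem_nhds hxU)).differentiableAt (by simp)).hasFDerivAt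
    refine (e'.contDiffAt_symm hy (f₀' := g) ?_ ?_).contDiffWithinAt
    · rwa [hcoe']
    · rw [hcoe']
      exact hf.contDiffAt (hU.mem_nhds hxU)
  · change a ∈ e'.source
    rw [hs]
    exact ⟨hfa.mem_toOpenPartialHomeomorph_source hf' (by simp), haV⟩
  · intro x _
    change f x = e' x
    rw [hcoe']

variable {E F H G M N : Type*} [NormedAddCommGroup E] [NormedSpace ℝ E]
  [NormedAddCommGroup F] [NormedSpace ℝ F] [TopologicalSpace H] [TopologicalSpace G]
  {I : ModelWithCorners ℝ E H} {J : ModelWithCorners ℝ F G}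
  [TopologicalSpace M] [ChartedSpace H M] [TopologicalSpace N] [ChartedSpace G N]

/-- A map which is injective on a compact set and a local diffeomorphism at its points is a
diffeomorphism from a neighbourhood of the compact set onto an open set. -/
theorem exists_openPartialHomeomorph_of_injOn [Nonempty M] [T2Space N] {f : M → N} {K U : Set M}
    (hK : IsCompact K) (hinj : Set.InjOn f K)
    (hf : ∀ x ∈ K, IsLocalDiffeomorphAt I J ∞ f x) (hU : IsOpen U) (hKU : K ⊆ U) :
    ∃ e : OpenPartialHomeomorph M N, ⇑e = f ∧ K ⊆ e.source ∧ e.source ⊆ U ∧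
      ContMDiffOn I J ∞ f e.source ∧ ContMDiffOn J I ∞ e.symm e.target := by
  set V : Set M := {x | IsLocalDiffeomorphAt I J ∞ f x} with hVdef
  have hV : IsOpen V := by
    rw [isOpen_iff_mem_nhds]
    rintro x ⟨Φ, hx, hΦ⟩
    filter_upwards [Φ.open_source.mem_nhds hx] with y hy
    exact ⟨Φ, hy, hΦ⟩
  obtain ⟨T, hT, hKT, hTinj⟩ := hinj.exists_isOpen_superset hK
    (fun x hx => (hf x hx).contMDiffAt.continuousAt) (fun x hx => by
      obtain ⟨Φ, hxΦ, hΦ⟩ := hf x hx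
      exact ⟨Φ.source, Φ.open_source.mem_nhds hxΦ, Φ.injOn.congr hΦ.symm⟩)
  set W : Set M := T ∩ V ∩ U
  have hW : IsOpen W := (hT.inter hV).inter hU
  have hWinj : Set.InjOn f W := hTinj.mono fun x hx => hx.1.1
  have hsm : ContMDiffOn I J ∞ f W := fun x hx => hx.1.2.contMDiffAt.contMDiffWithinAt
  have hloc : IsLocalHomeomorphOn f W :=
    (IsLocalDiffeomorphOn.isLocalHomeomorphOn (n := ∞) (I := I) (J := J) fun x => x.2.1.2)
  have hopen : IsOpenMap (W.domRestrict f) := by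
    refine IsOpenMap.of_nhds_le fun x => ?_
    have h1 : Filter.map (W.domRestrict f) (nhds x) = nhds (f x) := by
      rw [← hloc.map_nhds_eq x.2, ← map_nhds_subtype_coe_eq_nhds x.2 (hW.mem_nhds x.2),
        Filter.map_map]
      rfl
    exact h1.ge
  set e := OpenPartialHomeomorph.ofContinuousOpenRestrict hWinj.toPartialEquiv hsm.continuousOn
    hopen hW
  have hcoe : ⇑e = f := rfl
  have hsrc : e.source = W := rfl
  refine ⟨e, hcoe, fun x hx => ⟨⟨hKT hx, hf x hx⟩, hKU hx⟩, fun x hx => hx.2, hsm, ?_⟩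
  intro y hy
  have hx : e.symm y ∈ W := e.map_target hy
  have hyx : f (e.symm y) = y := e.right_inv hy
  obtain ⟨Φ, hxΦ, hΦ⟩ := hx.1.2
  have hyΦ : Φ (e.symm y) = y := by rw [← hΦ hxΦ, hyx]
  have hyt : y ∈ Φ.target := by
    rw [← hyΦ]
    exact Φ.map_source hxΦ
  have hinv : Φ.invFun y = e.symm y := by
    have := Φ.left_inv hxΦ
    rwa [hyΦ] at this
  have hΦs : ContMDiffAt J I ∞ Φ.invFun y :=
    (Φ.contMDiffOn_invFun y hyt).contMDiffAt (Φ.open_target.mem_nhds hyt)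
  refine (hΦs.congr_of_eventuallyEq ?_).contMDiffWithinAt
  -- Near `y` the local inverse takes values in `W`, where `f` is injective, so it coincides with
  -- `e.symm` and passes its smoothness on.
  have hev : ∀ᶠ z in nhds y, Φ.invFun z ∈ W := hΦs.continuousAt.eventually
    (hW.mem_nhds (by rw [hinv]; exact hx))
  filter_upwards [hev, Φ.open_target.mem_nhds hyt] with z hz hzt
  have h1 : f (Φ.invFun z) = z := (hΦ (Φ.map_target hzt)).trans (Φ.right_inv hzt)
  have h2 : e.symm (e (Φ.invFun z)) = Φ.invFun z := e.left_inv hz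
  rw [hcoe, h1] at h2
  exact h2

end InverseFunction

/-! ### Angle functions and logarithms near the core circle -/

section AngularLift

/-- The parametrization `t ↦ (3/2) exp(it)` of the core circle of the annulus. -/
noncomputable def coreCircle (t : ℝ) : ℂ := 3 / 2 * Complex.exp (t * Complex.I)

theorem norm_coreCircle (t : ℝ) : ‖coreCircle t‖ = 3 / 2 := by
  rw [coreCircle, norm_mul, Complex.norm_exp_ofReal_mul_I]
  norm_num

theorem coreCircle_ne_zero (t : ℝ) : coreCircle t ≠ 0 := by
  rw [← norm_pos_iff, norm_coreCircle]
  norm_num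

theorem coreCircle_arg {z : ℂ} (hz : ‖z‖ = 3 / 2) : coreCircle (Complex.arg z) = z := by
  have := Complex.norm_mul_exp_arg_mul_I z
  rw [hz] at this
  rw [coreCircle]
  simpa using this

theorem coreCircle_eq_iff {t t' : ℝ} :
    coreCircle t = coreCircle t' ↔ ∃ n : ℤ, t = t' + n * (2 * Real.pi) := by
  rw [coreCircle, coreCircle, mul_right_inj' (by norm_num), Complex.exp_eq_exp_iff_exists_int]
  refine exists_congr fun n => ?_
  constructor
  · intro h
    have := congrArg Complex.im h
    simpa using this
  · intro h
    rw [h]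
    push_cast
    ring

theorem hasDerivAt_coreCircle (t : ℝ) : HasDerivAt coreCircle (coreCircle t * Complex.I) t := by
  have h := ((Complex.ofRealCLM.hasDerivAt (x := t)).mul_const Complex.I).cexp.const_mul (3 / 2 : ℂ)
  refine h.congr_deriv ?_
  simp only [coreCircle, Complex.ofRealCLM_apply, Complex.ofReal_one, one_mul]
  ring

theorem contDiff_coreCircle : ContDiff ℝ ∞ coreCircle :=
  contDiff_const.mul (Complex.ofRealCLM.contDiff.mul contDiff_const).cexp

/-- A curve in the core circle has an angle function. -/
theorem exists_angle {β : ℝ → ℂ} (hβ : ContDiff ℝ 1 β) (hn : ∀ t, ‖β t‖ = 3 / 2) :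
    ∃ g g' : ℝ → ℝ, Continuous g' ∧ (∀ t, HasDerivAt g (g' t) t) ∧
      ∀ t, β t = coreCircle (g t) := by
  have hβ0 : ∀ t, β t ≠ 0 := fun t => by
    rw [← norm_pos_iff, hn]; norm_num
  have hd : ∀ t, HasDerivAt β (deriv β t) t := fun t =>
    (hβ.differentiable (by simp) t).hasDerivAt
  -- A curve of constant norm is orthogonal to its velocity, so its logarithmic derivative is
  -- imaginary; integrating it gives the angle.
  have hre : ∀ t, (deriv β t / β t).re = 0 := by
    intro t
    have h1 : HasDerivAt (fun t => ‖β t‖ ^ 2) (2 * inner ℝ (β t) (deriv β t)) t := (hd t).norm_sq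
    have h2 : (fun t => ‖β t‖ ^ 2) = fun _ => (3 / 2 : ℝ) ^ 2 := funext fun t => by rw [hn]
    rw [h2] at h1
    have h3 := h1.unique (hasDerivAt_const t _)
    have h4 : inner ℝ (β t) (deriv β t) = 0 := by linarith
    rw [Complex.inner] at h4
    simp only [Complex.mul_re, Complex.conj_re, Complex.conj_im] at h4
    rw [Complex.div_re, ← add_div, div_eq_zero_iff]
    left
    linarith
  set h : ℝ → ℝ := fun t => (deriv β t / β t).im with hh
  have hcont : Continuous h :=
    Complex.continuous_im.comp ((hβ.continuous_deriv (by simp)).div hβ.continuous hβ0)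
  have hform : ∀ t, deriv β t = β t * (h t * Complex.I) := by
    intro t
    have : deriv β t / β t = h t * Complex.I := by
      apply Complex.ext <;> simp [hre t, hh]
    rw [← this, mul_div_cancel₀ _ (hβ0 t)]
  set g : ℝ → ℝ := fun t => Complex.arg (β 0) + ∫ u in (0 : ℝ)..t, h u with hg
  have hgd : ∀ t, HasDerivAt g (h t) t := fun t =>
    (intervalIntegral.integral_hasDerivAt_right (hcont.intervalIntegrable _ _)
      (hcont.stronglyMeasurableAtFilter _ _) hcont.continuousAt).const_add _
  refine ⟨g, h, hcont, hgd, ?_⟩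
  have hconst : ∀ t, HasDerivAt (fun t => β t * Complex.exp (-(g t * Complex.I))) 0 t := by
    intro t
    have h1 : HasDerivAt (fun t => (g t : ℂ)) (h t : ℂ) t := (hgd t).ofReal_comp
    have h2 := (hd t).mul ((h1.mul_const Complex.I).neg.cexp)
    refine h2.congr_deriv ?_
    rw [hform t]
    simp only [Pi.neg_apply]
    ring
  intro t
  have hc := is_const_of_deriv_eq_zero (fun t => (hconst t).differentiableAt)
    (fun t => (hconst t).deriv) t 0
  have hg0 : g 0 = Complex.arg (β 0) := by simp [hg]
  have h0 : β 0 * Complex.exp (-(g 0 * Complex.I)) = 3 / 2 := by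
    have := coreCircle_arg (hn 0)
    rw [hg0]
    nth_rewrite 1 [← this]
    rw [coreCircle, mul_assoc, ← Complex.exp_add, add_neg_cancel, Complex.exp_zero, mul_one]
  simp only [h0] at hc
  rw [coreCircle, ← hc, mul_assoc, ← Complex.exp_add, neg_add_cancel, Complex.exp_zero, mul_one]

/-- The angle function of an injective map of the circle to itself has degree one, provided that
it is increasing. -/
theorem angle_add_two_pi {g g' : ℝ → ℝ} (hg : ∀ t, HasDerivAt g (g' t) t) (hpos : ∀ t, 0 < g' t)
    (hinj : ∀ t t', coreCircle (g t) = coreCircle (g t') ↔ coreCircle t = coreCircle t') (t : ℝ) :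
    g (t + 2 * Real.pi) = g t + 2 * Real.pi := by
  have hmono : StrictMono g := strictMono_of_deriv_pos fun t => by
    rw [(hg t).deriv]
    exact hpos t
  have hcont : Continuous g := continuous_iff_continuousAt.2 fun t => (hg t).continuousAt
  have hpi := Real.two_pi_pos
  obtain ⟨n, hn⟩ := coreCircle_eq_iff.1 ((hinj (t + 2 * Real.pi) t).2
    (coreCircle_eq_iff.2 ⟨1, by simp⟩))
  have hlt : g t < g (t + 2 * Real.pi) := hmono (by linarith)
  have hn0 : 0 < n := by
    by_contra hneg
    have : (n : ℝ) ≤ 0 := by exact_mod_cast not_lt.1 hneg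
    nlinarith
  -- If `g` gained two turns or more, it would gain exactly one at some `u` strictly between `t` and
  -- `t + 2π`, against injectivity on the circle.
  have hn1 : n ≤ 1 := by
    by_contra hbig
    have h2 : (2 : ℝ) ≤ n := by exact_mod_cast (by omega : (2 : ℤ) ≤ n)
    have hle : g t + 2 * Real.pi < g (t + 2 * Real.pi) := by nlinarith
    obtain ⟨u, hu, hgu⟩ := intermediate_value_Ioo (by linarith : t ≤ t + 2 * Real.pi)
      hcont.continuousOn ⟨by linarith, hle⟩
    obtain ⟨m, hm⟩ := coreCircle_eq_iff.1 ((hinj u t).1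
      (coreCircle_eq_iff.2 ⟨1, by rw [hgu]; simp⟩))
    have h3 : 0 < (m : ℝ) := by
      by_contra hc
      nlinarith [hu.1, hu.2]
    have h4 : (m : ℝ) < 1 := by
      by_contra hc
      nlinarith [hu.1, hu.2]
    have h5 : 0 < m := by exact_mod_cast h3
    have h6 : m < 1 := by exact_mod_cast h4
    omega
  have : n = 1 := by omega
  rw [hn, this]
  simp

end AngularLift

section Logarithm

/-- A continuous logarithm of a smooth function is smooth. -/
theorem contDiffOn_of_exp_eq {L q : ℂ → ℂ} {D : Set ℂ} (hD : IsOpen D) (hL : ContinuousOn L D)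
    (hq : ContDiffOn ℝ ∞ q D) (h : ∀ z ∈ D, Complex.exp (L z) = q z) : ContDiffOn ℝ ∞ L D := by
  intro z hz
  refine ContDiffAt.contDiffWithinAt ?_
  have hDz := hD.mem_nhds hz
  have hLz : ContinuousAt L z := hL.continuousAt hDz
  have hq0 : q z ≠ 0 := by
    rw [← h z hz]
    exact Complex.exp_ne_zero _
  -- This is the smooth branch through `L z`. It agrees with `L` near `z`, since by continuity the
  -- imaginary parts differ from that of `L z` by less than `π`.
  have hsm : ContDiffAt ℝ ∞ (fun w => L z + Complex.log (q w / q z)) z := by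
    have hlog : ContDiffAt ℝ ∞ Complex.log (q z / q z) := by
      rw [div_self hq0]
      exact (Complex.contDiffAt_log Complex.one_mem_slitPlane).restrict_scalars ℝ
    exact contDiffAt_const.add (ContDiffAt.comp (g := Complex.log) (f := fun w => q w / q z) z hlog
      ((hq.contDiffAt hDz).div_const _))
  refine hsm.congr_of_eventuallyEq ?_
  have him : ∀ᶠ w in nhds z, |(L w - L z).im| < Real.pi := by
    have : ContinuousAt (fun w => |(L w - L z).im|) z :=
      (Complex.continuous_im.continuousAt.comp (hLz.sub continuousAt_const)).abs
    refine this.eventually_lt_const ?_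
    simp [Real.pi_pos]
  filter_upwards [him, hDz] with w hw hwD
  have := abs_lt.1 hw
  rw [← h w hwD, ← h z hz, ← Complex.exp_sub, Complex.log_exp this.1 this.2.le]
  ring

/-- If the angle function of `ψ` on the core circle has degree one, then `ψ z / z` has a smooth
logarithm near the core circle. -/
theorem exists_log_near_core {ψ : ℂ → ℂ} {D : Set ℂ} (hD : IsOpen D)
    (hCD : ∀ t, coreCircle t ∈ D) (hψ : ContDiffOn ℝ ∞ ψ D) {g : ℝ → ℝ} (hg : Continuous g)
    (hgψ : ∀ t, ψ (coreCircle t) = coreCircle (g t))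
    (hdeg : ∀ t, g (t + 2 * Real.pi) = g t + 2 * Real.pi) :
    ∃ (L : ℂ → ℂ) (D' : Set ℂ), IsOpen D' ∧ D' ⊆ D ∧ (∀ t, coreCircle t ∈ D') ∧
      ContDiffOn ℝ ∞ L D' ∧ (∀ z ∈ D', ψ z = z * Complex.exp (L z)) ∧
      ∀ t, L (coreCircle t) = (g t - t : ℝ) * Complex.I := by
  have hper : Function.Periodic (fun t => g t - t) (2 * Real.pi) := fun t => by
    simp only [hdeg]; ring
  -- Degree one makes `g t - t` periodic. Its descent to the circle gives a logarithm of `ψ z / z`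
  -- on the core, which extends radially through the projection `p`.
  set η : Real.Angle → ℝ := hper.lift with hη
  have hηc : ∀ t : ℝ, η (t : Real.Angle) = g t - t := fun t => hper.lift_coe t
  have hηcont : Continuous η := continuous_coinduced_dom.2 (hg.sub continuous_id)
  set p : ℂ → ℂ := fun z => coreCircle (Complex.arg z) with hp
  have hpform : ∀ z ≠ 0, p z = (3 / 2 / ‖z‖ : ℝ) * z := by
    intro z hz
    have h1 := Complex.norm_mul_exp_arg_mul_I z
    have h2 : (‖z‖ : ℂ) ≠ 0 := by simpa using hz
    simp only [hp, coreCircle]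
    nth_rewrite 3 [← h1]
    push_cast
    field_simp
  have hpcont : ContinuousOn p {0}ᶜ := by
    have : ContinuousOn (fun z : ℂ => ((3 / 2 / ‖z‖ : ℝ) : ℂ) * z) {0}ᶜ := by
      refine ContinuousOn.mul (Complex.continuous_ofReal.comp_continuousOn
        (ContinuousOn.div continuousOn_const continuous_norm.continuousOn ?_)) continuousOn_id
      intro z hz
      simpa using hz
    exact this.congr fun z hz => hpform z hz
  have hpcore : ∀ t, p (coreCircle t) = coreCircle t := fun t => coreCircle_arg (norm_coreCircle t)
  set q : ℂ → ℂ := fun z => ψ z / z with hq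
  have hqp : ∀ z, q (p z) = Complex.exp (η (Complex.arg z : Real.Angle) * Complex.I) := by
    intro z
    simp only [hq, hp]
    rw [hgψ, hηc, coreCircle, coreCircle, mul_div_mul_left _ _ (by norm_num), ← Complex.exp_sub]
    congr 1
    push_cast
    ring
  have hqp0 : ∀ z, q (p z) ≠ 0 := fun z => by
    rw [hqp]
    exact Complex.exp_ne_zero _
  have hD₀ : IsOpen (D ∩ {0}ᶜ) := hD.inter isOpen_compl_singleton
  have hqs : ContDiffOn ℝ ∞ q (D ∩ {0}ᶜ) :=
    ((hψ.mono Set.inter_subset_left).mul (contDiffOn_id.inv fun z hz => hz.2)).congr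
      fun z _ => div_eq_mul_inv _ _
  -- The quotient is 1 on the core, so near the core it lies in the slit plane and the principal
  -- logarithm corrects the radial extension.
  set Q : ℂ → ℂ := fun z => q z / q (p z) with hQ
  have hQc : ContinuousOn Q (D ∩ {0}ᶜ) := by
    refine hqs.continuousOn.div ?_ fun z _ => hqp0 z
    refine hqs.continuousOn.comp (hpcont.mono Set.inter_subset_right) fun z _ => ?_
    exact ⟨hCD _, coreCircle_ne_zero _⟩
  set D' : Set ℂ := (D ∩ {0}ᶜ) ∩ Q ⁻¹' Complex.slitPlane with hD'
  have hD'o : IsOpen D' := hQc.isOpen_inter_preimage hD₀ Complex.isOpen_slitPlane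
  set L : ℂ → ℂ := fun z => η (Complex.arg z : Real.Angle) * Complex.I + Complex.log (Q z) with hL
  have hQ0 : ∀ z ∈ D', Q z ≠ 0 := fun z hz => Complex.slitPlane_ne_zero hz.2
  have hexp : ∀ z ∈ D', Complex.exp (L z) = q z := by
    intro z hz
    simp only [hL]
    rw [Complex.exp_add, Complex.exp_log (hQ0 z hz), ← hqp, mul_div_cancel₀ _ (hqp0 z)]
  have hLc : ContinuousOn L D' := by
    refine ContinuousOn.add (ContinuousOn.mul ?_ continuousOn_const) ?_
    · refine Complex.continuous_ofReal.comp_continuousOn ?_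
      intro z hz
      exact (hηcont.continuousAt.comp
        (Complex.continuousAt_arg_coe_angle hz.1.2)).continuousWithinAt
    · exact (hQc.mono Set.inter_subset_left).clog fun z hz => hz.2
  -- Only continuity of `L` has been built in, `g` being merely continuous here; smoothness comes
  -- from `contDiffOn_of_exp_eq`.
  refine ⟨L, D', hD'o, fun z hz => hz.1.1, ?_, ?_, ?_, ?_⟩
  · intro t
    refine ⟨⟨hCD t, coreCircle_ne_zero t⟩, ?_⟩
    have : Q (coreCircle t) = 1 := by
      have h0 := hqp0 (coreCircle t)
      simp only [hQ]
      rw [hpcore] at h0 ⊢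
      exact div_self h0
    rw [Set.mem_preimage, this]
    exact Complex.one_mem_slitPlane
  · exact contDiffOn_of_exp_eq hD'o hLc (hqs.mono Set.inter_subset_left) hexp
  · intro z hz
    rw [hexp z hz]
    simp only [hq]
    rw [mul_div_cancel₀ _ hz.1.2]
  · intro t
    have hQ1 : Q (coreCircle t) = 1 := by
      have h0 := hqp0 (coreCircle t)
      simp only [hQ]
      rw [hpcore] at h0 ⊢
      exact div_self h0
    have harg : (Complex.arg (coreCircle t) : Real.Angle) = (t : Real.Angle) := by
      have h1 := coreCircle_eq_iff.1 (hpcore t)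
      obtain ⟨n, hn⟩ := h1
      rw [hn, Real.Angle.angle_eq_iff_two_pi_dvd_sub]
      exact ⟨n, by ring⟩
    simp only [hL, hQ1, Complex.log_one, add_zero, harg]
    rw [hηc]

end Logarithm

/-! ### Interpolation between the identity and a transition map -/

section PlanarIsotopy

/-- The linear interpolation `z exp(s L z)` between the identity and `z exp(L z)` in logarithmic
coordinates. -/
noncomputable def logInterp (L : ℂ → ℂ) (p : ℝ × ℂ) : ℂ := p.2 * Complex.exp (p.1 * L p.2)

theorem logInterp_coreCircle {L : ℂ → ℂ} {g : ℝ → ℝ}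
    (hL : ∀ t, L (coreCircle t) = (g t - t : ℝ) * Complex.I) (s t : ℝ) :
    logInterp L (s, coreCircle t) = coreCircle ((1 - s) * t + s * g t) := by
  simp only [logInterp, hL]
  rw [coreCircle, coreCircle, mul_assoc, ← Complex.exp_add]
  congr 2
  push_cast
  ring

theorem contDiffOn_logInterp {L : ℂ → ℂ} {D : Set ℂ} (hL : ContDiffOn ℝ ∞ L D) :
    ContDiffOn ℝ ∞ (logInterp L) (Prod.snd ⁻¹' D) := by
  refine contDiffOn_snd.mul (ContDiffOn.cexp (ContDiffOn.mul ?_ ?_))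
  · exact Complex.ofRealCLM.contDiff.comp_contDiffOn contDiffOn_fst
  · exact hL.comp contDiffOn_snd fun p hp => hp

theorem hasFDerivAt_logInterp {L : ℂ → ℂ} {z : ℂ} {L' : ℂ →L[ℝ] ℂ} (hL : HasFDerivAt L L' z)
    (s : ℝ) : ∃ A : ℂ →L[ℝ] ℂ, HasFDerivAt (fun w => logInterp L (s, w)) A z ∧
      ∀ v, A v = Complex.exp (s * L z) * (v + s * z * L' v) := by
  have h := (hasFDerivAt_id (𝕜 := ℝ) z).mul ((hL.const_mul (s : ℂ)).cexp)
  refine ⟨_, h, fun v => ?_⟩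
  simp
  ring

/-- Increasing degree one interpolations of angles give bijections of the core circle. -/
theorem exists_interp_eq {g g' : ℝ → ℝ} (hg : ∀ t, HasDerivAt g (g' t) t) (hpos : ∀ t, 0 < g' t)
    (hdeg : ∀ t, g (t + 2 * Real.pi) = g t + 2 * Real.pi) {s : ℝ} (hs : s ∈ Set.Icc (0 : ℝ) 1) :
    (∀ t t', coreCircle ((1 - s) * t + s * g t) = coreCircle ((1 - s) * t' + s * g t') →
      coreCircle t = coreCircle t') ∧
    ∀ u, ∃ t, coreCircle ((1 - s) * t + s * g t) = coreCircle u := by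
  set k : ℝ → ℝ := fun t => (1 - s) * t + s * g t with hk
  have hkd : ∀ t, HasDerivAt k ((1 - s) * 1 + s * g' t) t := fun t =>
    ((hasDerivAt_id t).const_mul _).add ((hg t).const_mul _)
  have hkpos : ∀ t, 0 < (1 - s) * 1 + s * g' t := by
    intro t
    rcases hs.1.eq_or_lt with h0 | h0
    · rw [← h0]; norm_num
    · have := mul_pos h0 (hpos t)
      linarith [hs.2]
  have hmono : StrictMono k := strictMono_of_deriv_pos fun t => by
    rw [(hkd t).deriv]
    exact hkpos t
  have hcont : Continuous k := continuous_iff_continuousAt.2 fun t => (hkd t).continuousAt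
  have hk1 : Function.Periodic (fun t => k t - t) (2 * Real.pi) := by
    intro t
    simp only [hk, hdeg]
    ring
  have hkn : ∀ (t : ℝ) (n : ℤ), k (t + n * (2 * Real.pi)) = k t + n * (2 * Real.pi) := by
    intro t n
    have : k (t + n * (2 * Real.pi)) - (t + n * (2 * Real.pi)) = k t - t := hk1.int_mul n t
    linarith
  constructor
  · intro t t' h
    obtain ⟨n, hn⟩ := coreCircle_eq_iff.1 h
    refine coreCircle_eq_iff.2 ⟨n, hmono.injective ?_⟩
    rw [hkn]
    exact hn
  · intro u
    have hpi := Real.two_pi_pos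
    set n : ℤ := ⌊(u - k 0) / (2 * Real.pi)⌋ with hn
    have h1 : (n : ℝ) * (2 * Real.pi) ≤ u - k 0 := by
      rw [← le_div_iff₀ hpi]
      exact Int.floor_le _
    have h2 : u - k 0 < (n + 1) * (2 * Real.pi) := by
      rw [← div_lt_iff₀ hpi]
      exact Int.lt_floor_add_one _
    have h3 := hkn 0 n
    have h4 := hkn 0 (n + 1)
    push_cast at h4
    obtain ⟨t, -, ht⟩ := intermediate_value_Icc (f := k)
      (by nlinarith : 0 + (n : ℝ) * (2 * Real.pi) ≤ 0 + ((n : ℝ) + 1) * (2 * Real.pi))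
      hcont.continuousOn (show u ∈ _ by
        rw [h3, h4]
        constructor <;> linarith)
    exact ⟨t, by rw [← ht]⟩

/-- The interpolations in logarithmic coordinates have invertible differentials on the core
circle. -/
theorem logInterp_fderiv_injective {ψ L : ℂ → ℂ} {D : Set ℂ} (hD : IsOpen D)
    (hL : ContDiffOn ℝ ∞ L D) (hψL : ∀ z ∈ D, ψ z = z * Complex.exp (L z)) {g g' : ℝ → ℝ}
    (hg : ∀ t, HasDerivAt g (g' t) t) (hpos : ∀ t, 0 < g' t)
    (hLg : ∀ t, L (coreCircle t) = (g t - t : ℝ) * Complex.I) {t : ℝ} (ht : coreCircle t ∈ D)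
    (hdet : 0 < (fderiv ℝ ψ (coreCircle t)).det) {s : ℝ} (hs : s ∈ Set.Icc (0 : ℝ) 1) {v : ℂ}
    (hv : fderiv ℝ (fun w => logInterp L (s, w)) (coreCircle t) v = 0) : v = 0 := by
  set z := coreCircle t with hz
  have hz0 : z ≠ 0 := coreCircle_ne_zero t
  have hDz := hD.mem_nhds ht
  have hLd : HasFDerivAt L (fderiv ℝ L z) z :=
    ((hL.contDiffAt hDz).differentiableAt (by simp)).hasFDerivAt
  set A := fderiv ℝ L z
  -- Vectors are written in the frame `z`, `i z`, radial and tangential. The tangential derivative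
  -- of `L` is read off from its values on the core.
  have hI : A (z * Complex.I) = (g' t - 1 : ℝ) * Complex.I := by
    have h1 := hLd.comp_hasDerivAt t (hasDerivAt_coreCircle t)
    have h2 : L ∘ coreCircle = fun t => ((g t - t : ℝ) : ℂ) * Complex.I := funext hLg
    rw [h2] at h1
    have h3 : HasDerivAt (fun t => ((g t - t : ℝ) : ℂ) * Complex.I)
        ((g' t - 1 : ℝ) * Complex.I) t :=
      (((hg t).sub (hasDerivAt_id t)).ofReal_comp).mul_const _
    exact h1.unique h3
  -- At time 1, after division by nonzero complex factors, the differential is triangular in this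
  -- frame with determinant `(1 + Re (A z)) g'`; positivity bounds the radial entry.
  have hp : -1 < (A z).re := by
    obtain ⟨B, hB, hBv⟩ := hasFDerivAt_logInterp hLd 1
    have hψB : fderiv ℝ ψ z = B := by
      refine (hB.congr_of_eventuallyEq ?_).fderiv
      filter_upwards [hDz] with w hw
      rw [hψL w hw]
      simp [logInterp]
    rw [hψB] at hdet
    set ζ := Complex.exp (L z) * z with hζ
    have hζ0 : ζ ≠ 0 := mul_ne_zero (Complex.exp_ne_zero _) hz0
    set m : ℂ → ℂ →L[ℝ] ℂ := fun a => (ContinuousLinearMap.mul ℝ ℂ a)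
    have hm : ∀ a, a ≠ 0 → 0 < (m a).det := by
      intro a ha
      have h3 : (m a).det = Complex.normSq a := by
        rw [det_eq_re_mul_im_sub]
        simp [m, Complex.normSq_apply]
      rw [h3]
      exact Complex.normSq_pos.2 ha
    set M : ℂ →L[ℝ] ℂ := ContinuousLinearMap.id ℝ ℂ + A.comp (m z) with hM
    have hcomp : B.comp (m z) = (m ζ).comp M := by
      ext w
      simp only [ContinuousLinearMap.comp_apply, hBv, hM, m, ContinuousLinearMap.mul_apply',
        add_apply, ContinuousLinearMap.id_apply, hζ]
      push_cast
      simp only [one_mul]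
      ring
    have h4 := congrArg ContinuousLinearMap.det hcomp
    rw [det_comp, det_comp] at h4
    have h5 : 0 < M.det := by
      have := mul_pos hdet (hm z hz0)
      rw [h4] at this
      exact pos_of_mul_pos_right this (hm ζ hζ0).le
    rw [det_eq_re_mul_im_sub] at h5
    simp only [hM, m, ContinuousLinearMap.comp_apply, ContinuousLinearMap.mul_apply',
      add_apply, ContinuousLinearMap.id_apply, hI] at h5
    simp at h5
    have h6 := hpos t
    by_contra hneg
    nlinarith
  obtain ⟨B, hB, hBv⟩ := hasFDerivAt_logInterp hLd s
  rw [hB.fderiv, hBv] at hv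
  have hv' := (mul_eq_zero.1 hv).resolve_left (Complex.exp_ne_zero _)
  -- At time `s` the diagonal entries are `1 + s Re (A z)` and `1 - s + s g'`, both positive on `[0,
  -- 1]`.
  set w := v / z with hw
  have hvw : v = w.re • z + w.im • (z * Complex.I) := by
    have : v = w * z := by rw [hw, div_mul_cancel₀ _ hz0]
    rw [this]
    nth_rewrite 1 [← Complex.re_add_im w]
    simp only [Complex.real_smul]
    ring
  have hAv : A v = w.re * A z + w.im * ((g' t - 1 : ℝ) * Complex.I) := by
    rw [hvw, map_add, map_smul, map_smul, hI]
    simp only [Complex.real_smul]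
  have h7 : z * (w + s * (w.re * A z + w.im * ((g' t - 1 : ℝ) * Complex.I))) = 0 := by
    rw [← hAv, ← hv', hw]
    field_simp
  have h8 := (mul_eq_zero.1 h7).resolve_left hz0
  have hre := congrArg Complex.re h8
  have him := congrArg Complex.im h8
  simp at hre him
  have h9 : w.re = 0 := by
    have h10 : w.re * (1 + s * (A z).re) = 0 := by linarith
    refine (mul_eq_zero.1 h10).resolve_right ?_
    rcases hs.1.eq_or_lt with h0 | h0
    · rw [← h0]; norm_num
    · have := mul_lt_mul_of_pos_left hp h0
      linarith [hs.2]
  have h11 : w.im = 0 := by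
    rw [h9] at him
    have h10 : w.im * ((1 - s) + s * g' t) = 0 := by linarith
    refine (mul_eq_zero.1 h10).resolve_right ?_
    rcases hs.1.eq_or_lt with h0 | h0
    · rw [← h0]; norm_num
    · have := mul_pos h0 (hpos t)
      linarith [hs.2]
  rw [hvw, h9, h11]
  simp

/-- A planar map near the core circle, of positive determinant and increasing on the core circle,
is joined to the identity by a family of collars. -/
theorem exists_planar_family {ψ : ℂ → ℂ} {D : Set ℂ} (hD : IsOpen D)
    (hCD : ∀ t, coreCircle t ∈ D) (hψ : ContDiffOn ℝ ∞ ψ D)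
    (hdet : ∀ t, 0 < (fderiv ℝ ψ (coreCircle t)).det) {g g' : ℝ → ℝ}
    (hg : ∀ t, HasDerivAt g (g' t) t) (hpos : ∀ t, 0 < g' t)
    (hgψ : ∀ t, ψ (coreCircle t) = coreCircle (g t))
    (hinj : ∀ t t', ψ (coreCircle t) = ψ (coreCircle t') → coreCircle t = coreCircle t') :
    ∃ (e : OpenPartialHomeomorph (ℝ × ℂ) (ℝ × ℂ)) (δ : ℝ), 0 < δ ∧ δ ≤ 1 / 2 ∧
      e.source ⊆ Prod.snd ⁻¹' D ∧ (∀ p, (e p).1 = p.1) ∧ (∀ z, (e (0, z)).2 = z) ∧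
      (∀ p ∈ e.source, (e (1, p.2)).2 = ψ p.2) ∧
      (∀ s ∈ Set.Icc (0 : ℝ) 1, ∀ z : ℂ, |‖z‖ - 3 / 2| < δ → (s, z) ∈ e.target) ∧
      ContDiffOn ℝ ∞ e e.source ∧ ContDiffOn ℝ ∞ e.symm e.target := by
  have hdeg := angle_add_two_pi hg hpos fun t t' => by
    rw [← hgψ, ← hgψ]
    exact ⟨hinj t t', fun h => by rw [h]⟩
  obtain ⟨L, D', hD', hD'D, hCD', hL, hψL, hLg⟩ := exists_log_near_core hD hCD hψ
    (continuous_iff_continuousAt.2 fun t => (hg t).continuousAt) hgψ hdeg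
  -- Keeping time as a coordinate makes the inverse smooth jointly in time and position.
  set G : ℝ × ℂ → ℝ × ℂ := fun p => (p.1, logInterp L p) with hG
  set U : Set (ℝ × ℂ) := Prod.snd ⁻¹' D' with hU
  have hUo : IsOpen U := hD'.preimage continuous_snd
  have hGs : ContDiffOn ℝ ∞ G U := contDiffOn_fst.prodMk (contDiffOn_logInterp hL)
  set C : Set ℂ := Metric.sphere 0 (3 / 2) with hC
  have hCmem : ∀ z ∈ C, ∃ t, coreCircle t = z := fun z hz =>
    ⟨Complex.arg z, coreCircle_arg (by simpa [hC] using hz)⟩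
  have hCmem' : ∀ t, coreCircle t ∈ C := fun t => by simp [hC, norm_coreCircle]
  have hCc : IsCompact C := isCompact_sphere _ _
  set K : Set (ℝ × ℂ) := Set.Icc 0 1 ×ˢ C with hKdef
  have hK : IsCompact K := isCompact_Icc.prod hCc
  have hKU : K ⊆ U := by
    rintro ⟨s, z⟩ ⟨_, hz⟩
    obtain ⟨t, rfl⟩ := hCmem z hz
    exact hCD' t
  have hGinj : Set.InjOn G K := by
    rintro ⟨s, z⟩ ⟨hs, hz⟩ ⟨s', z'⟩ ⟨_, hz'⟩ h
    obtain ⟨t, rfl⟩ := hCmem z hz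
    obtain ⟨t', rfl⟩ := hCmem z' hz'
    obtain ⟨h1, h2⟩ := Prod.mk.inj h
    simp only at h1
    subst h1
    rw [logInterp_coreCircle hLg, logInterp_coreCircle hLg] at h2
    rw [(exists_interp_eq hg hpos hdeg hs).1 t t' h2]
  have hloc : ∀ p ∈ K, IsLocalDiffeomorphAt 𝓘(ℝ, ℝ × ℂ) 𝓘(ℝ, ℝ × ℂ) ∞ G p := by
    rintro ⟨s, z⟩ hp
    have hpU := hKU hp
    obtain ⟨hs, hz⟩ := hp
    obtain ⟨t, rfl⟩ := hCmem z hz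
    have hGd : HasFDerivAt G (fderiv ℝ G (s, coreCircle t)) (s, coreCircle t) :=
      ((hGs.contDiffAt (hUo.mem_nhds hpU)).differentiableAt (by simp)).hasFDerivAt
    have hinjd : Function.Injective (fderiv ℝ G (s, coreCircle t)) := by
      rw [injective_iff_map_eq_zero]
      rintro ⟨a, v⟩ hav
      have h1 : HasFDerivAt (fun p : ℝ × ℂ => p.1)
          ((ContinuousLinearMap.fst ℝ ℝ ℂ).comp (fderiv ℝ G (s, coreCircle t)))
          (s, coreCircle t) := hGd.fst
      have h2 := h1.unique hasFDerivAt_fst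
      have ha : a = 0 := by
        have := congrArg (fun T => T (a, v)) h2
        simpa [hav] using this.symm
      subst ha
      have h3 : HasFDerivAt (fun w : ℂ => (s, w)) (ContinuousLinearMap.inr ℝ ℝ ℂ)
          (coreCircle t) := hasFDerivAt_prodMk_right s _
      have h4 : HasFDerivAt (fun w => logInterp L (s, w)) _ (coreCircle t) :=
        (HasFDerivAt.comp (coreCircle t) hGd h3).snd
      have h5 : fderiv ℝ (fun w => logInterp L (s, w)) (coreCircle t) v = 0 := by
        rw [h4.fderiv]
        simp [hav]
      rw [logInterp_fderiv_injective hD' hL hψL hg hpos hLg (hCD' t) (hdet t) hs h5]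
      rfl
    set T := (LinearEquiv.ofInjectiveEndo (fderiv ℝ G (s, coreCircle t)).toLinearMap
      hinjd).toContinuousLinearEquiv
    refine isLocalDiffeomorphAt_of_contDiffOn hUo hGs hpU (f' := T) ?_
    have hT : (T : ℝ × ℂ →L[ℝ] ℝ × ℂ) = fderiv ℝ G (s, coreCircle t) :=
      ContinuousLinearMap.ext fun _ => rfl
    rw [hT]
    exact hGd
  obtain ⟨e, he, hKe, heU, hes, hes'⟩ :=
    exists_openPartialHomeomorph_of_injOn hK hGinj hloc hUo hKU
  have hKt : K ⊆ e.target := by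
    rintro ⟨s, z⟩ ⟨hs, hz⟩
    obtain ⟨u, rfl⟩ := hCmem z hz
    obtain ⟨t, ht⟩ := (exists_interp_eq hg hpos hdeg hs).2 u
    have h1 := e.map_source (hKe (⟨hs, hCmem' t⟩ : (s, coreCircle t) ∈ K))
    rw [he] at h1
    change (s, logInterp L (s, coreCircle t)) ∈ e.target at h1
    rwa [logInterp_coreCircle hLg, ht] at h1
  -- The tube lemma gives a neighbourhood of the core, and so a width `δ`, that serves all times in
  -- `[0, 1]`.
  obtain ⟨u, v, hu, hv, hIu, hCv, huv⟩ :=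
    generalized_tube_lemma isCompact_Icc hCc e.open_target hKt
  obtain ⟨δ, hδ, hδv⟩ := hCc.exists_thickening_subset_open hv hCv
  refine ⟨e, min δ (1 / 2), lt_min hδ (by norm_num), min_le_right _ _,
    heU.trans (Set.preimage_mono hD'D), ?_, ?_, ?_, ?_, ?_, ?_⟩
  · intro p
    rw [he]
  · intro z
    rw [he]
    simp [hG, logInterp]
  · intro p hp
    rw [he, hψL p.2 (heU hp)]
    simp [hG, logInterp]
  · intro s hs z hz
    refine huv ⟨hIu hs, hδv ?_⟩
    have hz1 : 1 < ‖z‖ := by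
      have := (abs_lt.1 (hz.trans_le (min_le_right _ _))).1
      linarith
    have hz0 : (‖z‖ : ℂ) ≠ 0 := by
      rw [Complex.ofReal_ne_zero]
      linarith
    refine Metric.mem_thickening_iff.2 ⟨coreCircle (Complex.arg z), hCmem' _, ?_⟩
    rw [dist_eq_norm]
    have h1 : z - coreCircle (Complex.arg z) =
        ((‖z‖ - 3 / 2 : ℝ) : ℂ) * Complex.exp (Complex.arg z * Complex.I) := by
      nth_rewrite 1 [← Complex.norm_mul_exp_arg_mul_I z]
      rw [coreCircle]
      push_cast
      ring
    rw [h1, norm_mul, Complex.norm_exp_ofReal_mul_I, mul_one, Complex.norm_real]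
    exact hz.trans_le (min_le_left _ _)
  · rw [he]
    exact hes.contDiffOn
  · exact hes'.contDiffOn

end PlanarIsotopy

/-! ### The flip of the annulus and of a bicollar -/

section Flip

/-- The orientation preserving involution `r exp(iθ) ↦ (3 - r) exp(-iθ)` of the annulus. -/
noncomputable def annulusFlip (z : ℂ) : ℂ := ((3 * ‖z‖⁻¹ - 1 : ℝ) : ℂ) * (starRingEnd ℂ) z

theorem norm_annulusFlip {z : ℂ} (h0 : z ≠ 0) (h3 : ‖z‖ ≤ 3) : ‖annulusFlip z‖ = 3 - ‖z‖ := by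
  have hz : 0 < ‖z‖ := norm_pos_iff.2 h0
  have h1 : 0 ≤ 3 * ‖z‖⁻¹ - 1 := by
    rw [sub_nonneg, ← div_eq_mul_inv, le_div_iff₀ hz]
    linarith
  rw [annulusFlip, norm_mul, Complex.norm_real, Real.norm_of_nonneg h1, RCLike.norm_conj]
  field_simp

theorem annulusFlip_annulusFlip {z : ℂ} (h0 : z ≠ 0) (h3 : ‖z‖ < 3) :
    annulusFlip (annulusFlip z) = z := by
  have hz : 0 < ‖z‖ := norm_pos_iff.2 h0
  have h3' : 3 - ‖z‖ ≠ 0 := by linarith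
  rw [annulusFlip, norm_annulusFlip h0 h3.le, annulusFlip, map_mul, Complex.conj_ofReal,
    Complex.conj_conj, ← mul_assoc, ← Complex.ofReal_mul]
  have : (3 * (3 - ‖z‖)⁻¹ - 1) * (3 * ‖z‖⁻¹ - 1) = 1 := by
    field_simp
    ring
  rw [this]
  simp

theorem annulusFlip_mul {z u : ℂ} (hu : ‖u‖ = 1) :
    annulusFlip (z * u) = annulusFlip z * (starRingEnd ℂ) u := by
  simp only [annulusFlip, norm_mul, hu, mul_one, map_mul]
  ring

theorem contDiffAt_annulusFlip {z : ℂ} (h0 : z ≠ 0) : ContDiffAt ℝ ∞ annulusFlip z := by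
  refine ContDiffAt.mul ?_ Complex.conjCLE.contDiff.contDiffAt
  refine Complex.ofRealCLM.contDiff.contDiffAt.comp z ?_
  exact (contDiffAt_const.mul ((contDiffAt_norm ℝ h0).inv (norm_ne_zero_iff.2 h0))).sub
    contDiffAt_const

theorem det_fderiv_annulusFlip {z : ℂ} (h0 : z ≠ 0) (h3 : ‖z‖ < 3) :
    0 < (fderiv ℝ annulusFlip z).det := by
  have hz : 0 < ‖z‖ := norm_pos_iff.2 h0
  have h1 : HasFDerivAt (fun w : ℂ => ‖w‖ ^ 2) (2 • innerSL ℝ z) z :=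
    (hasStrictFDerivAt_norm_sq z).hasFDerivAt
  have h2 := h1.sqrt (by positivity)
  rw [← Nat.cast_smul_eq_nsmul ℝ, smul_smul] at h2
  simp only [Real.sqrt_sq (norm_nonneg _)] at h2
  obtain ⟨k, hkz, hk⟩ : ∃ k : ℝ, k * (z.re * z.re + z.im * z.im) = -(3 * ‖z‖⁻¹) ∧
      HasFDerivAt (fun w : ℂ => 3 * ‖w‖⁻¹ - 1) (k • innerSL ℝ z) z := by
    have h4 := (((hasDerivAt_inv hz.ne').comp_hasFDerivAt z h2).const_mul 3).sub_const 1
    rw [smul_smul, smul_smul] at h4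
    refine ⟨_, ?_, h4⟩
    rw [← Complex.normSq_apply, Complex.normSq_eq_norm_sq]
    push_cast
    field_simp
  obtain ⟨h, hh⟩ : ∃ h : ℝ, h = 3 * ‖z‖⁻¹ - 1 := ⟨_, rfl⟩
  have hpos : 0 < h := by
    rw [hh, sub_pos, ← div_eq_mul_inv, lt_div_iff₀ hz]
    linarith
  have hd : HasFDerivAt annulusFlip ((h : ℂ) • (Complex.conjCLE : ℂ →L[ℝ] ℂ) +
      (starRingEnd ℂ) z • Complex.ofRealCLM.comp (k • innerSL ℝ z)) z := by
    rw [hh]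
    exact (Complex.ofRealCLM.hasFDerivAt.comp z hk).mul Complex.conjCLE.hasFDerivAt
  -- With this relation the determinant `-(h² + h k |z|²)` equals `h`, which is positive for `|z| <
  -- 3`.
  have hkz' : k * (z.re * z.re + z.im * z.im) = -h - 1 := by rw [hkz, hh]; ring
  rw [hd.fderiv, det_eq_re_mul_im_sub]
  simp [Complex.inner]
  nlinarith

theorem annulusFlip_coreCircle (t : ℝ) : annulusFlip (coreCircle t) = coreCircle (-t) := by
  have h : (starRingEnd ℂ) (3 / 2) = 3 / 2 := by
    rw [show (3 / 2 : ℂ) = ((3 / 2 : ℝ) : ℂ) by norm_num, Complex.conj_ofReal]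
  rw [annulusFlip, norm_coreCircle, coreCircle, coreCircle, map_mul, ← Complex.exp_conj, h]
  norm_num

/-- The flip as a partial homeomorphism. -/
noncomputable def annulusFlipHomeo : OpenPartialHomeomorph ℂ ℂ where
  toFun := annulusFlip
  invFun := annulusFlip
  source := {z | 1 < ‖z‖ ∧ ‖z‖ < 2}
  target := {z | 1 < ‖z‖ ∧ ‖z‖ < 2}
  map_source' z hz := by
    have h0 : z ≠ 0 := norm_pos_iff.1 (zero_lt_one.trans hz.1)
    have := hz.1
    have := hz.2
    have h := norm_annulusFlip h0 (by linarith)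
    constructor <;> linarith
  map_target' z hz := by
    have h0 : z ≠ 0 := norm_pos_iff.1 (zero_lt_one.trans hz.1)
    have := hz.1
    have := hz.2
    have h := norm_annulusFlip h0 (by linarith)
    constructor <;> linarith
  left_inv' z hz := annulusFlip_annulusFlip (norm_pos_iff.1 (zero_lt_one.trans hz.1))
    (hz.2.trans (by norm_num))
  right_inv' z hz := annulusFlip_annulusFlip (norm_pos_iff.1 (zero_lt_one.trans hz.1))
    (hz.2.trans (by norm_num))
  open_source := (isOpen_lt continuous_const continuous_norm).inter
    (isOpen_lt continuous_norm continuous_const)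
  open_target := (isOpen_lt continuous_const continuous_norm).inter
    (isOpen_lt continuous_norm continuous_const)
  continuousOn_toFun z hz := (contDiffAt_annulusFlip
    (norm_pos_iff.1 (zero_lt_one.trans hz.1))).continuousAt.continuousWithinAt
  continuousOn_invFun z hz := (contDiffAt_annulusFlip
    (norm_pos_iff.1 (zero_lt_one.trans hz.1))).continuousAt.continuousWithinAt

end Flip

section FlippedCollar

variable {S : Type*} [TopologicalSpace S] [ChartedSpace ℂ S]
variable {c : Set S} {φ : OpenPartialHomeomorph S ℂ} {f : ℝ → ℝ} {τ : SelfDiffeo S} {ε : ℤ}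

theorem IsBicollar.flip_source (hφ : IsBicollar c φ) :
    (φ ≫ₕ annulusFlipHomeo).source = φ.source := by
  rw [OpenPartialHomeomorph.trans_source]
  exact Set.inter_eq_left.2 fun x hx => hφ.norm_mem hx

theorem IsBicollar.flip_target (hφ : IsBicollar c φ) :
    (φ ≫ₕ annulusFlipHomeo).target = {z | 1 < ‖z‖ ∧ ‖z‖ < 2} := by
  rw [OpenPartialHomeomorph.trans_target]
  refine Set.inter_eq_left.2 fun z hz => ?_
  rw [Set.mem_preimage, hφ.target_eq]
  exact annulusFlipHomeo.map_target hz

/-- Flipping reverses the direction of the core and exchanges its two sides, so orientation is kept.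
This reduces uniqueness to transitions that are increasing on the core. -/
theorem IsBicollar.flip [OrientedSurface S] (hφ : IsBicollar c φ) :
    IsBicollar c (φ ≫ₕ annulusFlipHomeo) where
  target_eq := hφ.flip_target
  smooth := by
    rw [hφ.flip_source]
    intro x hx
    have h0 : φ x ≠ 0 := norm_pos_iff.1 (zero_lt_one.trans (hφ.norm_mem hx).1)
    exact ((contDiffAt_annulusFlip h0).contMDiffAt.comp x
      (hφ.contMDiffAt hx)).contMDiffWithinAt
  smooth_symm := by
    rw [hφ.flip_target]
    have h1 : ContMDiffOn 𝓘(ℝ, ℂ) 𝓘(ℝ, ℂ) ∞ annulusFlip {z : ℂ | 1 < ‖z‖ ∧ ‖z‖ < 2} := by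
      intro z hz
      exact (contDiffAt_annulusFlip
        (norm_pos_iff.1 (zero_lt_one.trans hz.1))).contMDiffAt.contMDiffWithinAt
    refine hφ.smooth_symm.comp h1 fun z hz => ?_
    have : annulusFlip z ∈ φ.target := by
      rw [hφ.target_eq]
      exact annulusFlipHomeo.map_target hz
    exact this
  det_pos := by
    intro e he z hz
    have hz1 : z ∈ e.target := by
      have := hz.1
      simpa using this
    have hx : e.symm z ∈ φ.source := by
      rw [← hφ.flip_source]
      exact hz.2
    have hxe : e.symm z ∈ e.source := e.map_target hz1
    have hn := hφ.norm_mem hx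
    have h0 : φ (e.symm z) ≠ 0 := norm_pos_iff.1 (zero_lt_one.trans hn.1)
    have := ((hφ.isOrientedAt hx).comp_iff (g := annulusFlip)
      ((contDiffAt_annulusFlip h0).differentiableAt (by simp)) (hφ.contMDiffAt hx)).2
      (det_fderiv_annulusFlip h0 (hn.2.trans (by norm_num))) e he hxe
    rw [e.right_inv hz1] at this
    exact this
  subset_source := by
    rw [hφ.flip_source]
    exact hφ.subset_source
  image_eq := by
    have h1 : (φ ≫ₕ annulusFlipHomeo) '' c = annulusFlip '' (φ '' c) := by
      rw [Set.image_image]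
      rfl
    rw [h1, hφ.image_eq]
    have key : ∀ z : ℂ, ‖z‖ = 3 / 2 → ‖annulusFlip z‖ = 3 / 2 ∧ annulusFlip (annulusFlip z) = z := by
      intro z hz
      have h0 : z ≠ 0 := by
        rw [← norm_pos_iff, hz]
        norm_num
      refine ⟨?_, annulusFlip_annulusFlip h0 (by rw [hz]; norm_num)⟩
      rw [norm_annulusFlip h0 (by rw [hz]; norm_num), hz]
      norm_num
    ext z
    constructor
    · rintro ⟨w, hw, rfl⟩
      exact (key w hw).1
    · intro hz
      exact ⟨annulusFlip z, (key z hz).1, (key z hz).2⟩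

theorem IsTwistProfile.flip (hf : IsTwistProfile f) : IsTwistProfile fun r => 3 - f (3 - r) := by
  obtain ⟨a, b, ha, hab, hb, h1, h2⟩ := hf.eq_ends
  refine ⟨contDiff_const.sub (hf.smooth.comp (contDiff_const.sub contDiff_id)), 3 - b, 3 - a,
    by linarith, by linarith, by linarith, ?_, ?_⟩
  · intro r hr
    rw [h2 _ (by linarith)]
    norm_num
  · intro r hr
    rw [h1 _ (by linarith)]
    norm_num

/-- The phase has period one in `r`, so its conjugate, the phase at `-r`, is also the phase at `3 -
r`. This is why a flipped twist has the same sign. -/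
theorem conj_twistPhase (ε : ℤ) (r : ℝ) :
    (starRingEnd ℂ) (twistPhase ε r) = twistPhase ε (3 - r) := by
  have h3 : twistPhase ε 3 = 1 := by simpa using twistPhase_intCast ε 3
  have h4 := twistPhase_add ε r (3 - r)
  rw [add_sub_cancel, h3] at h4
  have h5 : (starRingEnd ℂ) (twistPhase ε r) * twistPhase ε r = 1 := by
    rw [← Complex.normSq_eq_conj_mul_self, Complex.normSq_eq_norm_sq, norm_twistPhase]
    simp
  calc (starRingEnd ℂ) (twistPhase ε r)
      = (starRingEnd ℂ) (twistPhase ε r) * (twistPhase ε r * twistPhase ε (3 - r)) := by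
        rw [← h4, mul_one]
    _ = twistPhase ε (3 - r) := by rw [← mul_assoc, h5, one_mul]

/-- A twist is also a twist along the flipped collar. -/
theorem IsTwistAlong.flip (hτ : IsTwistAlong ε φ f τ) (hφ : IsBicollar c φ) :
    IsTwistAlong ε (φ ≫ₕ annulusFlipHomeo) (fun r => 3 - f (3 - r)) τ := by
  constructor
  · intro x hx
    rw [hφ.flip_source] at hx
    exact hτ.1 x hx
  · intro x hx
    rw [hφ.flip_source] at hx
    have hn := hφ.norm_mem hx
    have h0 : φ x ≠ 0 := norm_pos_iff.1 (zero_lt_one.trans hn.1)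
    rw [hτ.2 x hx]
    change _ = φ.symm (annulusFlip (annulusFlip (φ x) *
      twistPhase ε (3 - f (3 - ‖annulusFlip (φ x)‖))))
    rw [annulusFlip_mul (norm_twistPhase _ _), conj_twistPhase,
      annulusFlip_annulusFlip h0 (hn.2.trans (by norm_num)),
      norm_annulusFlip h0 (hn.2.le.trans (by norm_num))]
    simp

end FlippedCollar

/-! ### Independence of the twist from the bicollar -/

section Uniqueness

variable {S : Type*} [TopologicalSpace S] [ChartedSpace ℂ S]
variable {c : Set S} {φ φ' : OpenPartialHomeomorph S ℂ} {f f' : ℝ → ℝ} {τ τ' : SelfDiffeo S}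
  {ε : ℤ}

/-- If the member at time `s` of a family of thin collars is a restriction of the collar `φ`,
then the twist at this time is the twist along `φ`. -/
theorem IsCollarFamily.isTwistAlong {N : Set (ℝ × S)} {F : ℝ × S → ℂ} {B : ℝ × ℂ → S}
    {a b a' b' s : ℝ} (h : IsCollarFamily N F B a b) (ha : a < a') (hb : b' < b)
    (h1 : ∀ r ≤ a', f r = 1) (h2 : ∀ r, b' ≤ r → f r = 2)
    (hN : ∀ x, (s, x) ∈ N → x ∈ φ.source ∧ F (s, x) = φ x)
    (hτ : ∀ x, τ x = twistFun ε N F B (fun p => f p.2) (s, x)) : IsTwistAlong ε φ f τ := by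
  constructor
  · intro x hx
    rw [hτ, twistFun_of_notMem fun h => hx (hN x h).1]
  · intro x hx
    rw [hτ]
    by_cases hxN : (s, x) ∈ N
    · rw [twistFun_of_mem hxN]
      have hm := h.mapsTo _ hxN
      simp only [(hN x hxN).2] at hm ⊢
      have hn : ‖φ x * twistPhase ε (f ‖φ x‖)‖ = ‖φ x‖ := by
        rw [norm_mul, norm_twistPhase, mul_one]
      rw [← hn] at hm
      have hB := hN _ (h.mem s _ hm.1 hm.2)
      rw [h.right_inv s _ hm.1 hm.2] at hB
      have hl := φ.left_inv hB.1
      rw [← hB.2] at hl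
      exact hl.symm
    · rw [twistFun_of_notMem hxN]
      have hph : twistPhase ε (f ‖φ x‖) = 1 := by
        by_cases h3 : ‖φ x‖ ≤ a'
        · rw [h1 _ h3, twistPhase_one]
        · by_cases h4 : b' ≤ ‖φ x‖
          · rw [h2 _ h4, twistPhase_two]
          -- The thin collar covers all heights strictly between `a` and `b`: the point over `φ x`
          -- provided by the family has the same `φ`-value as `x`, hence is `x`.
          · exfalso
            have h5 := ha.trans (not_le.1 h3)
            have h6 := (not_le.1 h4).trans hb
            have h7 := h.mem s _ h5 h6
            have hB := hN _ h7
            rw [h.right_inv s _ h5 h6] at hB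
            rw [← φ.injOn hx hB.1 hB.2] at h7
            exact hxN h7
      rw [hph, mul_one, φ.left_inv hx]

theorem IsBicollar.coreCircle_mem_target (hφ : IsBicollar c φ) (t : ℝ) :
    coreCircle t ∈ φ.target := by
  rw [hφ.mem_target, norm_coreCircle]
  norm_num

theorem IsBicollar.symm_coreCircle_mem (hφ : IsBicollar c φ) (t : ℝ) :
    φ.symm (coreCircle t) ∈ c := by
  have h := hφ.coreCircle_mem_target t
  rw [hφ.mem_iff (φ.map_target h), φ.right_inv h, norm_coreCircle]

/-- The transition between two bicollars. -/
noncomputable def transition (φ φ' : OpenPartialHomeomorph S ℂ) : ℂ → ℂ := φ' ∘ φ.symm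

theorem IsBicollar.transition_source (hφ : IsBicollar c φ) (hφ' : IsBicollar c φ') (t : ℝ) :
    coreCircle t ∈ (φ.symm ≫ₕ φ').source := by
  rw [OpenPartialHomeomorph.trans_source]
  exact ⟨hφ.coreCircle_mem_target t, hφ'.subset_source (hφ.symm_coreCircle_mem t)⟩

theorem IsBicollar.contDiffOn_transition (hφ : IsBicollar c φ) (hφ' : IsBicollar c φ') :
    ContDiffOn ℝ ∞ (transition φ φ') (φ.symm ≫ₕ φ').source := by
  rw [← contMDiffOn_iff_contDiffOn]
  refine hφ'.smooth.comp (hφ.smooth_symm.mono ?_) ?_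
  · exact fun z hz => hz.1
  · exact fun z hz => hz.2

theorem IsBicollar.norm_transition (hφ : IsBicollar c φ) (hφ' : IsBicollar c φ') (t : ℝ) :
    ‖transition φ φ' (coreCircle t)‖ = 3 / 2 :=
  (hφ'.mem_iff (hφ'.subset_source (hφ.symm_coreCircle_mem t))).1 (hφ.symm_coreCircle_mem t)

variable [OrientedSurface S]

theorem IsBicollar.det_transition (hφ : IsBicollar c φ) (hφ' : IsBicollar c φ') {z : ℂ}
    (hz : z ∈ (φ.symm ≫ₕ φ').source) : 0 < (fderiv ℝ (transition φ φ') z).det := by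
  have hx : φ.symm z ∈ φ.source := φ.map_target hz.1
  have hx' : φ.symm z ∈ φ'.source := hz.2
  have hd : DifferentiableAt ℝ (transition φ φ') z :=
    ((hφ.contDiffOn_transition hφ').contDiffAt
      ((φ.symm ≫ₕ φ').open_source.mem_nhds hz)).differentiableAt (by simp)
  have h := (hφ.isOrientedAt hx).comp_iff (g := transition φ φ')
    (by rwa [φ.right_inv hz.1]) (hφ.contMDiffAt hx)
  rw [φ.right_inv hz.1] at h
  refine h.1 ((hφ'.isOrientedAt hx').congr ?_)
  filter_upwards [φ.open_source.mem_nhds hx] with y hy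
  simp [transition, φ.left_inv hy]

/-- Twists along two bicollars of the same curve are isotopic if the bicollars induce the same
orientation on the curve. -/
theorem IsBicollar.isotopic_of_increasing (hφ : IsBicollar c φ) (hφ' : IsBicollar c φ')
    (hf : IsTwistProfile f) (hf' : IsTwistProfile f') (hτ : IsTwistAlong ε φ f τ)
    (hτ' : IsTwistAlong ε φ' f' τ') {g g' : ℝ → ℝ} (hg : ∀ t, HasDerivAt g (g' t) t)
    (hpos : ∀ t, 0 < g' t)
    (hgψ : ∀ t, transition φ φ' (coreCircle t) = coreCircle (g t)) : DiffeoIsotopic τ τ' := by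
  obtain ⟨e, δ, hδ, hδ1, heD, he1, he0, heψ, het, hes, hes'⟩ :=
    exists_planar_family (φ.symm ≫ₕ φ').open_source (hφ.transition_source hφ')
      (hφ.contDiffOn_transition hφ')
      (fun t => hφ.det_transition hφ' (hφ.transition_source hφ' t)) hg hpos hgψ
      (fun t t' h => (φ.symm ≫ₕ φ').injOn (hφ.transition_source hφ' t)
        (hφ.transition_source hφ' t') h)
  -- The interpolation is controlled only for times in `[0, 1]`, while isotopies are indexed by the
  -- whole line; `σ` maps the line smoothly into this interval.
  set σ : ℝ → ℝ := Real.smoothTransition with hσ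
  have hσI : ∀ s, σ s ∈ Set.Icc (0 : ℝ) 1 := fun s =>
    ⟨Real.smoothTransition.nonneg s, Real.smoothTransition.le_one s⟩
  have hσs : ContDiff ℝ ∞ σ := Real.smoothTransition.contDiff
  set m : ℝ × S → ℝ × ℂ := fun p => (σ p.1, φ p.2) with hm
  set A : Set (ℝ × S) := Prod.snd ⁻¹' φ.source with hA
  have hAo : IsOpen A := φ.open_source.preimage continuous_snd
  have hms : ContMDiffOn (𝓘(ℝ, ℝ).prod 𝓘(ℝ, ℂ)) 𝓘(ℝ, ℝ × ℂ) ∞ m A := by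
    refine ContMDiffOn.prodMk_space ?_ ?_
    · exact (hσs.contMDiff.comp contMDiff_fst).contMDiffOn
    · exact hφ.smooth.comp contMDiff_snd.contMDiffOn fun _ h => h
  set N₀ : Set (ℝ × S) := A ∩ m ⁻¹' e.source with hN₀
  have hN₀o : IsOpen N₀ := hms.continuousOn.isOpen_inter_preimage hAo e.open_source
  set F : ℝ × S → ℂ := fun p => (e (m p)).2 with hF
  have hFs : ContMDiffOn (𝓘(ℝ, ℝ).prod 𝓘(ℝ, ℂ)) 𝓘(ℝ, ℂ) ∞ F N₀ := by
    have h1 : ContDiffOn ℝ ∞ (fun p => (e p).2) e.source := contDiff_snd.comp_contDiffOn hes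
    exact h1.contMDiffOn.comp (hms.mono Set.inter_subset_left) fun _ h => h.2
  set N : Set (ℝ × S) := N₀ ∩ F ⁻¹' {z | 3 / 2 - δ < ‖z‖ ∧ ‖z‖ < 3 / 2 + δ} with hN
  have hNo : IsOpen N := hFs.continuousOn.isOpen_inter_preimage hN₀o
    ((isOpen_lt continuous_const continuous_norm).inter
      (isOpen_lt continuous_norm continuous_const))
  set B : ℝ × ℂ → S := fun q => φ.symm (e.symm (σ q.1, q.2)).2 with hB
  have hemem : ∀ (s : ℝ) (z : ℂ), 3 / 2 - δ < ‖z‖ → ‖z‖ < 3 / 2 + δ →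
      (σ s, z) ∈ e.target := fun s z h1 h2 =>
    het _ (hσI s) z (abs_lt.2 ⟨by linarith, by linarith⟩)
  have hefst : ∀ q ∈ e.target, (e.symm q).1 = q.1 := fun q hq => by
    rw [← he1 (e.symm q), e.right_inv hq]
  have hBt : ∀ q ∈ e.target, (e.symm q).2 ∈ φ.target := fun q hq => (heD (e.map_target hq)).1
  have hmB : ∀ (s : ℝ) (z : ℂ), (σ s, z) ∈ e.target → m (s, B (s, z)) = e.symm (σ s, z) := by
    intro s z hz
    simp only [hm, hB]
    rw [φ.right_inv (hBt _ hz)]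
    exact Prod.ext (hefst _ hz).symm rfl
  have hFB : ∀ (s : ℝ) (z : ℂ), (σ s, z) ∈ e.target → F (s, B (s, z)) = z := by
    intro s z hz
    simp only [hF]
    rw [hmB s z hz, e.right_inv hz]
  have hfam : IsCollarFamily N F B (3 / 2 - δ) (3 / 2 + δ) :=
    { isOpen := hNo
      mapsTo := fun p hp => hp.2
      left_inv := by
        intro p hp
        have h1 : (σ p.1, F p) = e (m p) := Prod.ext (he1 (m p)).symm rfl
        change φ.symm (e.symm (σ p.1, F p)).2 = p.2
        rw [h1, e.left_inv hp.1.2]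
        exact φ.left_inv hp.1.1
      mem := by
        intro s z h1 h2
        have hz := hemem s z h1 h2
        refine ⟨⟨φ.map_target (hBt _ hz), ?_⟩, ?_⟩
        · rw [Set.mem_preimage, hmB s z hz]
          exact e.map_target hz
        · rw [Set.mem_preimage, hFB s z hz]
          exact ⟨h1, h2⟩
      right_inv := fun s z h1 h2 => hFB s z (hemem s z h1 h2)
      smooth := hFs.mono Set.inter_subset_left
      smooth_inv := by
        have h1 : ContDiffOn ℝ ∞ (fun q : ℝ × ℂ => (e.symm (σ q.1, q.2)).2)
            {q : ℝ × ℂ | 3 / 2 - δ < ‖q.2‖ ∧ ‖q.2‖ < 3 / 2 + δ} := by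
          refine contDiff_snd.comp_contDiffOn (hes'.comp
            ((hσs.comp contDiff_fst).prodMk contDiff_snd).contDiffOn ?_)
          exact fun q hq => hemem q.1 q.2 hq.1 hq.2
        have h2 := h1.contMDiffOn
        rw [modelWithCornersSelf_prod, ← chartedSpaceSelf_prod] at h2
        exact hφ.smooth_symm.comp h2 fun q hq => hBt _ (hemem q.1 q.2 hq.1 hq.2) }
  -- The auxiliary profile changes only at distance at most `δ / 2` from the core, well inside the
  -- thin annulus common to all times.
  obtain ⟨f₀, hf₀, hf1, hf2⟩ := exists_isTwistProfile (a := 3 / 2 - δ / 2) (b := 3 / 2 + δ / 2)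
    (by linarith) (by linarith) (by linarith)
  have hfF : IsProfileFamily (fun p : ℝ × ℝ => f₀ p.2) (3 / 2 - δ / 2) (3 / 2 + δ / 2) :=
    ⟨hf₀.smooth.comp contDiff_snd, fun _ r hr => hf1 r hr, fun _ r hr => hf2 r hr⟩
  obtain ⟨H, hH, hHt⟩ := hfam.exists_twists hfF (by linarith) (by linarith) (by linarith) ε
  have hH0 : IsTwistAlong ε φ f₀ (H 0) := by
    refine hfam.isTwistAlong (by linarith) (by linarith) hf1 hf2 ?_ (hHt 0)
    intro x hx
    refine ⟨hx.1.1, ?_⟩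
    simp only [hF, hm, hσ, Real.smoothTransition.zero]
    exact he0 _
  have hH1 : IsTwistAlong ε φ' f₀ (H 1) := by
    refine hfam.isTwistAlong (by linarith) (by linarith) hf1 hf2 ?_ (hHt 1)
    intro x hx
    have hxs : x ∈ φ.source := hx.1.1
    have h1 : φ.symm (φ x) ∈ φ'.source := (heD hx.1.2).2
    rw [φ.left_inv hxs] at h1
    refine ⟨h1, ?_⟩
    have h2 := heψ _ hx.1.2
    simp only [hF, hm, hσ, Real.smoothTransition.one] at h2 ⊢
    rw [h2, transition, Function.comp_apply, φ.left_inv hxs]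
  -- Three moves: shrink the profile along `φ`, pass from `φ` to `φ'`, and expand the profile along
  -- `φ'`.
  exact ((hφ.isotopic_of_profiles hf hf₀ hτ hH0).trans ⟨H, hH, rfl, rfl⟩).trans
    (hφ'.isotopic_of_profiles hf₀ hf' hH1 hτ')

/-- Twists along two bicollars of the same curve are isotopic. -/
theorem IsBicollar.isotopic (hφ : IsBicollar c φ) (hφ' : IsBicollar c φ')
    (hf : IsTwistProfile f) (hf' : IsTwistProfile f') (hτ : IsTwistAlong ε φ f τ)
    (hτ' : IsTwistAlong ε φ' f' τ') : DiffeoIsotopic τ τ' := by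
  have hsm : ContDiff ℝ ∞ (transition φ φ' ∘ coreCircle) := by
    rw [← contDiffOn_univ]
    exact (hφ.contDiffOn_transition hφ').comp contDiff_coreCircle.contDiffOn
      fun t _ => hφ.transition_source hφ' t
  obtain ⟨g, g', hg'c, hg, hgψ⟩ := exists_angle (hsm.of_le (by simp))
    (hφ.norm_transition hφ')
  -- If `g'` vanished, the tangent of the core would lie in the kernel of a differential of positive
  -- determinant.
  have hne : ∀ t, g' t ≠ 0 := by
    intro t h0
    have hsrc := hφ.transition_source hφ' t
    have hd : DifferentiableAt ℝ (transition φ φ') (coreCircle t) :=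
      ((hφ.contDiffOn_transition hφ').contDiffAt
        ((φ.symm ≫ₕ φ').open_source.mem_nhds hsrc)).differentiableAt (by simp)
    have h1 := hd.hasFDerivAt.comp_hasDerivAt t (hasDerivAt_coreCircle t)
    have h2 := (hasDerivAt_coreCircle (g t)).scomp t (hg t)
    rw [show transition φ φ' ∘ coreCircle = coreCircle ∘ g from funext hgψ] at h1
    have h3 := h1.unique h2
    rw [h0, zero_smul] at h3
    have hdet := hφ.det_transition hφ' hsrc
    have hker : LinearMap.ker (fderiv ℝ (transition φ φ') (coreCircle t)).toLinearMap ≠ ⊥ := by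
      rw [Submodule.ne_bot_iff]
      exact ⟨_, h3, mul_ne_zero (coreCircle_ne_zero t) Complex.I_ne_zero⟩
    exact hdet.ne' (LinearMap.det_eq_zero_iff_ker_ne_bot.2 hker)
  by_cases hpos : ∀ t, 0 < g' t
  · exact hφ.isotopic_of_increasing hφ' hf hf' hτ hτ' hg hpos hgψ
  · push Not at hpos
    obtain ⟨t₀, ht₀⟩ := hpos
    have hneg : ∀ t, g' t < 0 := by
      intro t
      by_contra ht
      obtain ⟨u, hu⟩ := mem_range_of_exists_le_of_exists_ge hg'c ⟨t₀, ht₀⟩ ⟨t, not_lt.1 ht⟩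
      exact hne u hu
    -- Without zeros the continuous `g'` has constant sign; when it is negative, flipping `φ'` turns
    -- `g` into `-g`.
    refine hφ.isotopic_of_increasing hφ'.flip hf hf'.flip hτ (hτ'.flip hφ') (g := fun t => -g t)
      (fun t => (hg t).neg) (fun t => neg_pos.2 (hneg t)) fun t => ?_
    rw [← annulusFlip_coreCircle, ← hgψ]
    rfl

end Uniqueness

/-! ### Angle parametrization and velocity of embedded curves -/

section CurveParametrization

variable {S : Type*} [TopologicalSpace S] [ChartedSpace ℂ S]

theorem contMDiff_circle_coe : ContMDiff (𝓡 1) 𝓘(ℝ, ℂ) ∞ (fun z : Circle => (z : ℂ)) := by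
  have := finrank_real_complex_fact'
  exact contMDiff_coe_sphere (E := ℂ) (n := 1)

/-- The parametrization of a closed curve by the angle. -/
noncomputable def angleCurve (γ : Circle → S) (t : ℝ) : S := γ (Circle.exp t)

theorem coreCircle_eq_circleExp (t : ℝ) : coreCircle t = 3 / 2 * (Circle.exp t : ℂ) := by
  rw [coreCircle, Circle.coe_exp]

variable [IsManifold 𝓘(ℝ, ℂ) ∞ S] {γ : Circle → S}

omit [IsManifold 𝓘(ℝ, ℂ) ∞ S] in
theorem contMDiff_angleCurve (hγ : Manifold.IsSmoothEmbedding (𝓡 1) 𝓘(ℝ, ℂ) ∞ γ) :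
    ContMDiff 𝓘(ℝ, ℝ) 𝓘(ℝ, ℂ) ∞ (angleCurve γ) := by
  have := finrank_real_complex_fact'
  exact hγ.contMDiff.comp (contMDiff_circleExp (m := ∞))

theorem contDiffAt_chart_angleCurve (hγ : Manifold.IsSmoothEmbedding (𝓡 1) 𝓘(ℝ, ℂ) ∞ γ) {t : ℝ}
    {e : OpenPartialHomeomorph S ℂ} (he : e ∈ atlas ℂ S) (ht : angleCurve γ t ∈ e.source) :
    ContDiffAt ℝ ∞ (e ∘ angleCurve γ) t := by
  rw [← contMDiffAt_iff_contDiffAt]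
  exact (contMDiffAt_of_mem_atlas he ht).comp t (contMDiff_angleCurve hγ).contMDiffAt

omit [IsManifold 𝓘(ℝ, ℂ) ∞ S] in
/-- An embedded curve has a smooth local left inverse. -/
theorem exists_local_left_inverse (hγ : Manifold.IsSmoothEmbedding (𝓡 1) 𝓘(ℝ, ℂ) ∞ γ)
    (p : Circle) : ∃ k : S → ℂ, ContMDiffAt 𝓘(ℝ, ℂ) 𝓘(ℝ, ℂ) ∞ k (γ p) ∧
      ∀ᶠ z in nhds p, k (γ z) = z := by
  obtain ⟨F, _, _, hF⟩ := hγ.isImmersion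
  have h := hF p
  have hw : ∀ z ∈ h.domChart.source, h.codChart (γ z) = h.equiv (h.domChart z, 0) := by
    intro z hz
    have hzt : h.domChart z ∈ (h.domChart.extend (𝓡 1)).target := by
      simpa using h.domChart.map_source hz
    have := h.writtenInCharts hzt
    simpa [h.domChart.left_inv hz] using this
  -- In the normal form of an immersion the curve is `u ↦ (u, 0)` up to a linear equivalence, so
  -- projection to the first factor recovers the parameter.
  set l : ℂ → EuclideanSpace ℝ (Fin 1) := fun w => (h.equiv.symm w).1 with hl
  have hlw : ∀ z ∈ h.domChart.source, l (h.codChart (γ z)) = h.domChart z := by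
    intro z hz
    simp [hl, hw z hz]
  have hls : ContDiff ℝ ∞ l := contDiff_fst.comp h.equiv.symm.contDiff
  refine ⟨fun y => (h.domChart.symm (l (h.codChart y)) : ℂ), ?_, ?_⟩
  · have h1 : ContMDiffAt 𝓘(ℝ, ℂ) 𝓘(ℝ, ℂ) ∞ h.codChart (γ p) :=
      (contMDiffOn_of_mem_maximalAtlas h.codChart_mem_maximalAtlas).contMDiffAt
        (h.codChart.open_source.mem_nhds h.mem_codChart_source)
    have h2 : ContMDiffAt 𝓘(ℝ, ℂ) (𝓡 1) ∞ (fun y => l (h.codChart y)) (γ p) :=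
      hls.contMDiff.contMDiffAt.comp (γ p) h1
    have h3 : ContMDiffAt (𝓡 1) (𝓡 1) ∞ h.domChart.symm (l (h.codChart (γ p))) := by
      rw [hlw p h.mem_domChart_source]
      exact (contMDiffOn_symm_of_mem_maximalAtlas h.domChart_mem_maximalAtlas).contMDiffAt
        (h.domChart.open_target.mem_nhds (h.domChart.map_source h.mem_domChart_source))
    have h4 := ContMDiffAt.comp (γ p) (g := h.domChart.symm) (f := fun y => l (h.codChart y)) h3 h2
    exact contMDiff_circle_coe.contMDiffAt.comp (γ p) h4
  · filter_upwards [h.domChart.open_source.mem_nhds h.mem_domChart_source] with z hz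
    rw [hlw z hz, h.domChart.left_inv hz]

/-- An embedded curve has non-zero velocity in charts. -/
theorem deriv_chart_angleCurve_ne_zero (hγ : Manifold.IsSmoothEmbedding (𝓡 1) 𝓘(ℝ, ℂ) ∞ γ) {t : ℝ}
    {e : OpenPartialHomeomorph S ℂ} (he : e ∈ atlas ℂ S) (ht : angleCurve γ t ∈ e.source) :
    deriv (e ∘ angleCurve γ) t ≠ 0 := by
  intro h0
  -- Composing the curve with `k` recovers the standard circle, whose velocity is nonzero; zero
  -- velocity in the chart would contradict the chain rule.
  obtain ⟨k, hk, hkγ⟩ := exists_local_left_inverse hγ (Circle.exp t)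
  have hd : HasDerivAt (e ∘ angleCurve γ) 0 t := by
    rw [← h0]
    exact ((contDiffAt_chart_angleCurve hγ he ht).differentiableAt (by simp)).hasDerivAt
  have hke := (differentiableAt_comp_chart_symm hk he ht).hasFDerivAt
  have h1 := hke.comp_hasDerivAt t hd
  rw [map_zero] at h1
  have h2 : HasDerivAt (fun t : ℝ => 3 / 2 * ((k ∘ e.symm) ∘ (e ∘ angleCurve γ)) t) (3 / 2 * 0) t :=
    h1.const_mul _
  have h3 : coreCircle =ᶠ[nhds t]
      fun t : ℝ => 3 / 2 * ((k ∘ e.symm) ∘ (e ∘ angleCurve γ)) t := by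
    have hc : ContinuousAt (angleCurve γ) t := (contMDiff_angleCurve hγ).continuous.continuousAt
    filter_upwards [hc.eventually (e.open_source.mem_nhds ht),
      Circle.exp.continuous.continuousAt.eventually hkγ] with u hu hu'
    rw [coreCircle_eq_circleExp, ← hu']
    simp only [Function.comp_apply, e.left_inv hu]
    rfl
  have h4 := (h2.congr_of_eventuallyEq h3).unique (hasDerivAt_coreCircle t)
  rw [mul_zero] at h4
  exact mul_ne_zero (coreCircle_ne_zero t) Complex.I_ne_zero h4.symm

end CurveParametrization

/-! ### Local collar functions and their gluing -/

section LocalCollar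

variable {S : Type*} [TopologicalSpace S] [ChartedSpace ℂ S] [OrientedSurface S]

theorem eventually_isOrientedAt {F : S → ℂ} {x : S}
    (hF : ∀ᶠ y in nhds x, ContMDiffAt 𝓘(ℝ, ℂ) 𝓘(ℝ, ℂ) ∞ F y) (hx : IsOrientedAt F x) :
    ∀ᶠ y in nhds x, IsOrientedAt F y := by
  set e := chartAt ℂ x
  have he : e ∈ atlas ℂ S := chart_mem_atlas ℂ x
  have hxe : x ∈ e.source := mem_chart_source ℂ x
  have hc : ContinuousAt (fun y => (fderiv ℝ (F ∘ e.symm) (e y)).det) x := by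
    have h1 : ContDiffAt ℝ 0 (fderiv ℝ (F ∘ e.symm)) (e x) :=
      (contDiffAt_comp_chart_symm hF.self_of_nhds he hxe).fderiv_right (m := 0) (by simp)
    exact ContinuousLinearMap.continuous_det.continuousAt.comp
      (ContinuousAt.comp (f := e) h1.continuousAt (e.continuousAt hxe))
  filter_upwards [hF, e.open_source.mem_nhds hxe, hc.eventually_const_lt (hx e he hxe)]
    with y hy hye hdet
  exact isOrientedAt_of_det_pos hy he hye hdet

variable {γ : Circle → S}

/-- Near each of its points, an embedded curve in an oriented surface is mapped to the core circle
by an orientation preserving function. -/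
theorem exists_local_collar (hγ : Manifold.IsSmoothEmbedding (𝓡 1) 𝓘(ℝ, ℂ) ∞ γ) (p : Circle) :
    ∃ (U : Set S) (F : S → ℂ), IsOpen U ∧ γ p ∈ U ∧ ContMDiffOn 𝓘(ℝ, ℂ) 𝓘(ℝ, ℂ) ∞ F U ∧
      (∀ z, γ z ∈ U → F (γ z) = 3 / 2 * z) ∧ ∀ y ∈ U, IsOrientedAt F y := by
  set t₀ : ℝ := Complex.arg p with ht₀
  have hpt : Circle.exp t₀ = p := Circle.exp_arg p
  have hβ₀ : angleCurve γ t₀ = γ p := by rw [angleCurve, hpt]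
  set e := chartAt ℂ (γ p)
  have he : e ∈ atlas ℂ S := chart_mem_atlas ℂ _
  have hpe : γ p ∈ e.source := mem_chart_source ℂ _
  have hβe : angleCurve γ t₀ ∈ e.source := by rwa [hβ₀]
  set α : ℝ → ℂ := e ∘ angleCurve γ with hα
  set T : Set ℝ := angleCurve γ ⁻¹' e.source with hT
  have hTo : IsOpen T := e.open_source.preimage (contMDiff_angleCurve hγ).continuous
  have hαs : ∀ t ∈ T, ContDiffAt ℝ ∞ α t := fun t ht => contDiffAt_chart_angleCurve hγ he ht
  set a := deriv α t₀ with ha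
  have ha0 : a ≠ 0 := deriv_chart_angleCurve_ne_zero hγ he hβe
  -- The real axis runs along the curve and the imaginary direction leaves it along `i a`, so the
  -- differential at `t₀` is multiplication by `a`. The collar function is the inverse of `G`
  -- followed by `w ↦ (3/2) exp(i w)`.
  set G : ℂ → ℂ := fun w => α w.re + w.im * (Complex.I * a) with hG
  have hGs : ContDiffOn ℝ ∞ G (Complex.re ⁻¹' T) := by
    intro w hw
    refine ContDiffAt.contDiffWithinAt (ContDiffAt.add ?_ ?_)
    · exact (hαs _ hw).comp w Complex.reCLM.contDiff.contDiffAt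
    · exact (Complex.ofRealCLM.contDiff.comp Complex.imCLM.contDiff).contDiffAt.mul contDiffAt_const
  have hGT : IsOpen (Complex.re ⁻¹' T) := hTo.preimage Complex.continuous_re
  have hGt : (t₀ : ℂ) ∈ Complex.re ⁻¹' T := by simpa [hT] using hβe
  have hGd : HasFDerivAt G (ContinuousLinearMap.mul ℝ ℂ a) t₀ := by
    have h1 : HasDerivAt α a ((t₀ : ℂ).re) := ((hαs t₀ hβe).differentiableAt (by simp)).hasDerivAt
    have h2 := (HasFDerivAt.comp (t₀ : ℂ) h1.hasFDerivAt Complex.reCLM.hasFDerivAt).add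
      ((Complex.ofRealCLM.hasFDerivAt.comp (t₀ : ℂ) Complex.imCLM.hasFDerivAt).mul_const
        (Complex.I * a))
    refine HasFDerivAt.congr_fderiv (f := G) h2 ?_
    ext w
    simp
    nth_rewrite 3 [← Complex.re_add_im w]
    ring
  have hinj : Function.Injective (ContinuousLinearMap.mul ℝ ℂ a) := fun v w h =>
    mul_left_cancel₀ ha0 h
  set A := (LinearEquiv.ofInjectiveEndo (ContinuousLinearMap.mul ℝ ℂ a).toLinearMap
    hinj).toContinuousLinearEquiv
  have hA : (A : ℂ →L[ℝ] ℂ) = ContinuousLinearMap.mul ℝ ℂ a := ContinuousLinearMap.ext fun _ => rfl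
  obtain ⟨Φ, hΦt, hΦG⟩ := isLocalDiffeomorphAt_of_contDiffOn hGT hGs hGt (f' := A)
    (by rw [hA]; exact hGd)
  have hGt₀ : G t₀ = e (γ p) := by simp [hG, hα, hβ₀]
  have hΦp : Φ (t₀ : ℂ) = e (γ p) := by rw [← hΦG hΦt, hGt₀]
  have hVp : e (γ p) ∈ Φ.target := by
    rw [← hΦp]
    exact Φ.map_source hΦt
  set E : ℂ → ℂ := fun w => 3 / 2 * Complex.exp (w * Complex.I) with hE
  have hEs : ContDiff ℝ ∞ E := contDiff_const.mul (contDiff_id.mul contDiff_const).cexp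
  set F : S → ℂ := fun y => E (Φ.invFun (e y)) with hF
  have hFs : ∀ y ∈ e.source, e y ∈ Φ.target → ContMDiffAt 𝓘(ℝ, ℂ) 𝓘(ℝ, ℂ) ∞ F y := by
    intro y hy hyt
    have h1 : ContMDiffAt 𝓘(ℝ, ℂ) 𝓘(ℝ, ℂ) ∞ Φ.invFun (e y) :=
      (Φ.contMDiffOn_invFun _ hyt).contMDiffAt (Φ.open_target.mem_nhds hyt)
    exact hEs.contMDiff.contMDiffAt.comp y (h1.comp y (contMDiffAt_of_mem_atlas he hy))
  have hcurve : ∀ t ∈ T, (t : ℂ) ∈ Φ.source → F (angleCurve γ t) = coreCircle t := by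
    intro t ht htΦ
    have h1 : e (angleCurve γ t) = Φ (t : ℂ) := by
      rw [← hΦG htΦ]
      simp [hG, hα]
    have h2 : Φ.invFun (e (angleCurve γ t)) = (t : ℂ) := by
      rw [h1]
      exact Φ.left_inv htΦ
    simp only [hF, h2, hE]
    rfl
  have hFnear : ∀ᶠ y in nhds (γ p), ContMDiffAt 𝓘(ℝ, ℂ) 𝓘(ℝ, ℂ) ∞ F y := by
    filter_upwards [e.open_source.mem_nhds hpe,
      (e.continuousAt hpe).eventually (Φ.open_target.mem_nhds hVp)] with y hy hy'
    exact hFs y hy hy'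
  have hor : IsOrientedAt F (γ p) := by
    refine isOrientedAt_of_det_pos hFnear.self_of_nhds he hpe ?_
    -- In the chart, `F ∘ G` is the exponential map. Both its differential and that of `G` at `t₀`
    -- are multiplications by nonzero complex numbers, hence of positive determinant, and so is the
    -- differential of `F`.
    have h1 : ((F ∘ e.symm) ∘ G) =ᶠ[nhds (t₀ : ℂ)] E := by
      have hGc : ContinuousAt G t₀ := hGd.continuousAt
      filter_upwards [Φ.open_source.mem_nhds hΦt,
        hGc.eventually (by rw [hGt₀]; exact e.open_target.mem_nhds (e.map_source hpe))]
        with w hw hw'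
      have h2 : Φ.invFun (G w) = w := by
        rw [hΦG hw]
        exact Φ.left_inv hw
      simp only [hF, Function.comp_apply, e.right_inv hw', h2]
    have h2 : DifferentiableAt ℝ (F ∘ e.symm) (G t₀) := by
      rw [hGt₀]
      exact differentiableAt_comp_chart_symm hFnear.self_of_nhds he hpe
    have h3 := fderiv_comp (t₀ : ℂ) h2 hGd.differentiableAt
    rw [h1.fderiv_eq, hGd.fderiv, hGt₀] at h3
    have h4 := congrArg ContinuousLinearMap.det h3
    rw [det_comp] at h4
    have hmul : ∀ b : ℂ, (ContinuousLinearMap.mul ℝ ℂ b).det = Complex.normSq b := by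
      intro b
      rw [det_eq_re_mul_im_sub]
      simp [Complex.normSq_apply]
    have h5 : (fderiv ℝ E t₀).det = Complex.normSq (coreCircle t₀ * Complex.I) := by
      rw [← hmul]
      have h6 : HasDerivAt E (coreCircle t₀ * Complex.I) (t₀ : ℂ) := by
        have := (((hasDerivAt_id (t₀ : ℂ)).mul_const Complex.I).cexp).const_mul (3 / 2 : ℂ)
        refine HasDerivAt.congr_deriv (f := E) this ?_
        simp only [coreCircle, id_eq, one_mul]
        ring
      have h7 := h6.hasFDerivAt.restrictScalars ℝ
      rw [h7.fderiv]
      congr 1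
      ext w
      simp
      ring
    rw [h5, hmul] at h4
    have h8 : 0 < Complex.normSq (coreCircle t₀ * Complex.I) :=
      Complex.normSq_pos.2 (mul_ne_zero (coreCircle_ne_zero _) Complex.I_ne_zero)
    rw [h4] at h8
    exact pos_of_mul_pos_left h8 (Complex.normSq_nonneg a)
  have hγnear : ∀ᶠ z in nhds p, F (γ z) = 3 / 2 * z := by
    -- A branch of the angle that is continuous at `p`, obtained by rotating `p` to 1.
    set θ : Circle → ℝ := fun z => t₀ + Complex.arg (z / p : Circle) with hθ
    have hθp : θ p = t₀ := by simp [hθ]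
    have hθc : ContinuousAt θ p := by
      refine continuousAt_const.add ?_
      have h1 : ContinuousAt (fun z : Circle => ((z / p : Circle) : ℂ)) p :=
        (continuous_subtype_val.comp (continuous_id.div_const p)).continuousAt
      refine ContinuousAt.comp (g := Complex.arg) ?_ h1
      refine Complex.continuousAt_arg ?_
      simp [Complex.one_mem_slitPlane]
    have hθe : ∀ z, Circle.exp (θ z) = z := by
      intro z
      simp only [hθ]
      rw [Circle.exp_add, hpt, Circle.exp_arg]
      simp
    have hev : ∀ᶠ t in nhds t₀, t ∈ T ∧ (t : ℂ) ∈ Φ.source :=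
      (hTo.eventually_mem hβe).and
        (Complex.continuous_ofReal.continuousAt.eventually (Φ.open_source.mem_nhds hΦt))
    rw [← hθp] at hev
    filter_upwards [hθc.eventually hev] with z hz
    have := hcurve _ hz.1 hz.2
    rwa [angleCurve, coreCircle_eq_circleExp, hθe] at this
  -- Here the topological embedding is used: points of the curve close to `γ p` in the surface come
  -- from parameters close to `p`.
  have hγnear' : ∀ᶠ y in nhds (γ p), ∀ z, γ z = y → F (γ z) = 3 / 2 * z := by
    rw [hγ.isEmbedding.isInducing.nhds_eq_comap] at hγnear
    obtain ⟨V, hV, hVs⟩ := Filter.mem_comap.1 hγnear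
    filter_upwards [hV] with y hy z hz
    exact hVs (show γ z ∈ V by rwa [hz])
  obtain ⟨U, hU, hUo, hpU⟩ := mem_nhds_iff.1
    ((hFnear.and (eventually_isOrientedAt hFnear hor)).and hγnear')
  exact ⟨U, F, hUo, hpU, fun y hy => (hU hy).1.1.contMDiffWithinAt,
    fun z hz => (hU hz).2 z rfl, fun y hy => (hU hy).1.2⟩

end LocalCollar

section GlobalCollar

/-- The oriented area of the parallelogram spanned by `A v` and `A (i v)`. With `A v` fixed it is
linear in `A (i v)`, so it respects sums of maps that agree on `v`. -/
theorem det_mul_normSq (A : ℂ →L[ℝ] ℂ) (v : ℂ) :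
    A.det * Complex.normSq v = ((starRingEnd ℂ) (A v) * A (v * Complex.I)).im := by
  have h : ∀ w : ℂ, A w = w.re * A 1 + w.im * A Complex.I := by
    intro w
    have h1 : w = w.re • (1 : ℂ) + w.im • Complex.I := by
      simp [Complex.re_add_im]
    nth_rewrite 1 [h1]
    rw [map_add, map_smul, map_smul]
    simp only [Complex.real_smul]
  rw [h v, h (v * Complex.I), det_eq_re_mul_im_sub]
  simp [Complex.normSq_apply]
  ring

/-- A convex combination of linear maps of positive determinant, which agree on a non-zero vector,
has positive determinant. -/
theorem det_sum_pos {ι : Type*} {s : Finset ι} {A : ι → ℂ →L[ℝ] ℂ} {r : ι → ℝ} {u v : ℂ}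
    (hr : ∀ i ∈ s, 0 ≤ r i) (hsum : ∑ i ∈ s, r i = 1) (hA : ∀ i ∈ s, 0 < (A i).det)
    (hv : v ≠ 0) (hAv : ∀ i ∈ s, A i v = u) : 0 < (∑ i ∈ s, r i • A i).det := by
  have hv' : 0 < Complex.normSq v := Complex.normSq_pos.2 hv
  have h1 : (∑ i ∈ s, r i • A i) v = u := by
    rw [sum_apply]
    calc ∑ i ∈ s, (r i • A i) v = ∑ i ∈ s, r i • u :=
          Finset.sum_congr rfl fun i hi => by rw [← hAv i hi]; rfl
      _ = u := by rw [← Finset.sum_smul, hsum, one_smul]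
  have h2 : (∑ i ∈ s, r i • A i).det * Complex.normSq v =
      ∑ i ∈ s, r i * ((A i).det * Complex.normSq v) := by
    rw [det_mul_normSq, h1, sum_apply, Finset.mul_sum, Complex.im_sum]
    refine Finset.sum_congr rfl fun i hi => ?_
    rw [det_mul_normSq, hAv i hi]
    simp
    ring
  have h3 : 0 < ∑ i ∈ s, r i * ((A i).det * Complex.normSq v) := by
    obtain ⟨j, hj, hrj⟩ : ∃ j ∈ s, 0 < r j := by
      by_contra hcon
      push Not at hcon
      have := Finset.sum_nonpos hcon
      rw [hsum] at this
      linarith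
    exact Finset.sum_pos' (fun i hi => mul_nonneg (hr i hi) (mul_pos (hA i hi) hv').le)
      ⟨j, hj, mul_pos hrj (mul_pos (hA j hj) hv')⟩
  rw [← h2] at h3
  exact pos_of_mul_pos_left h3 hv'.le

variable {S : Type*} [TopologicalSpace S] [ChartedSpace ℂ S] [OrientedSurface S] {γ : Circle → S}

/-- An embedded curve in an oriented surface is mapped to the core circle by a smooth function
which preserves the orientation at all points of the curve. -/
theorem exists_global_collar (hγ : Manifold.IsSmoothEmbedding (𝓡 1) 𝓘(ℝ, ℂ) ∞ γ) :
    ∃ F : S → ℂ, ContMDiff 𝓘(ℝ, ℂ) 𝓘(ℝ, ℂ) ∞ F ∧ (∀ z, F (γ z) = 3 / 2 * z) ∧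
      ∀ z, IsOrientedAt F (γ z) := by
  have : LocallyCompactSpace S := ChartedSpace.locallyCompactSpace ℂ S
  choose U f hUo hpU hfs hfγ hfo using exists_local_collar hγ
  have hcl : IsClosed (Set.range γ) := (isCompact_range hγ.contMDiff.continuous).isClosed
  obtain ⟨ρ, hρ⟩ := SmoothPartitionOfUnity.exists_isSubordinate 𝓘(ℝ, ℂ) hcl U hUo (by
    rintro _ ⟨p, rfl⟩
    exact Set.mem_iUnion.2 ⟨p, hpU p⟩)
  set F : S → ℂ := fun y => ∑ᶠ i, ρ i y • f i y with hF
  have hFs : ContMDiff 𝓘(ℝ, ℂ) 𝓘(ℝ, ℂ) ∞ F := hρ.contMDiff_finsum_smul hUo hfs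
  refine ⟨F, hFs, fun z => ?_, fun z => ?_⟩
  · simp only [hF]
    rw [← ρ.sum_finsupport_smul_eq_finsum]
    have h1 : ∀ i ∈ ρ.finsupport (γ z), ρ i (γ z) • f i (γ z) = ρ i (γ z) • (3 / 2 * (z : ℂ)) := by
      intro i hi
      rw [hfγ i z (hρ i (subset_tsupport _ ((ρ.mem_finsupport _).1 hi)))]
    rw [Finset.sum_congr rfl h1, ← Finset.sum_smul, ρ.sum_finsupport _ (Set.mem_range_self z), one_smul]
  · set y := γ z with hy
    set e := chartAt ℂ y
    have he : e ∈ atlas ℂ S := chart_mem_atlas ℂ _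
    have hye : y ∈ e.source := mem_chart_source ℂ _
    refine isOrientedAt_of_det_pos hFs.contMDiffAt he hye ?_
    set s := ρ.fintsupport y with hs
    have hsU : ∀ i ∈ s, y ∈ U i := fun i hi => hρ i ((ρ.mem_fintsupport_iff y i).1 hi)
    have hfat : ∀ i ∈ s, ContMDiffAt 𝓘(ℝ, ℂ) 𝓘(ℝ, ℂ) ∞ (f i) y := fun i hi =>
      (hfs i).contMDiffAt ((hUo i).mem_nhds (hsU i hi))
    have hte : Filter.Tendsto e.symm (nhds (e y)) (nhds y) := by
      simpa [e.left_inv hye] using (e.continuousAt_symm (e.map_source hye)).tendsto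
    set A : Circle → ℂ →L[ℝ] ℂ := fun i => fderiv ℝ (f i ∘ e.symm) (e y) with hA
    have hAd : ∀ i ∈ s, HasFDerivAt (f i ∘ e.symm) (A i) (e y) := fun i hi =>
      (differentiableAt_comp_chart_symm (hfat i hi) he hye).hasFDerivAt
    have hsymm := (contMDiffOn_symm_of_mem_maximalAtlas (I := 𝓘(ℝ, ℂ)) (n := ∞)
      (IsManifold.subset_maximalAtlas he)).contMDiffAt (e.open_target.mem_nhds (e.map_source hye))
    have hρs : ∀ i, ContDiffAt ℝ ∞ (fun w => ρ i (e.symm w)) (e y) := by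
      intro i
      rw [← contMDiffAt_iff_contDiffAt]
      exact (ρ i).contMDiff.contMDiffAt.comp (e y) hsymm
    set R : Circle → ℂ →L[ℝ] ℝ := fun i => fderiv ℝ (fun w => ρ i (e.symm w)) (e y) with hR
    have hRd : ∀ i, HasFDerivAt (fun w => ρ i (e.symm w)) (R i) (e y) := fun i =>
      ((hρs i).differentiableAt (by simp)).hasFDerivAt
    have hsum1 : ∑ i ∈ s, ρ i y = 1 :=
      ρ.sum_finsupport' y (Set.mem_range_self z) (ρ.finsupport_subset_fintsupport y)
    -- The weights sum to 1 only on the curve, but to at most 1 everywhere, so the sum has a local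
    -- maximum at `y` and its differential vanishes there.
    have hRsum : ∑ i ∈ s, R i = 0 := by
      have h1 : HasFDerivAt (fun w => ∑ i ∈ s, ρ i (e.symm w)) (∑ i ∈ s, R i) (e y) :=
        HasFDerivAt.fun_sum fun i _ => hRd i
      refine IsLocalMax.hasFDerivAt_eq_zero (f := fun w => ∑ i ∈ s, ρ i (e.symm w)) ?_ h1
      filter_upwards [hte.eventually (ρ.eventually_finsupport_subset y)] with w hw
      simp only [e.left_inv hye, hsum1]
      have h2 : ∑ᶠ i, ρ i (e.symm w) = ∑ i ∈ s, ρ i (e.symm w) := by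
        refine finsum_eq_sum_of_support_subset _ ?_
        rw [← ρ.coe_finsupport]
        exact_mod_cast hw
      rw [← h2]
      exact ρ.sum_le_one _
    have hFd : HasFDerivAt (F ∘ e.symm) (∑ i ∈ s, ρ i y • A i) (e y) := by
      have h1 : HasFDerivAt (fun w => ∑ i ∈ s, ρ i (e.symm w) • f i (e.symm w))
          (∑ i ∈ s, (ρ i y • A i + (R i).smulRight (3 / 2 * (z : ℂ)))) (e y) := by
        refine HasFDerivAt.fun_sum fun i hi => ?_
        have h2 := (hRd i).smul (hAd i hi)
        rw [Function.comp_apply, e.left_inv hye, hy, hfγ i z (hsU i hi)] at h2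
        exact h2
      -- All local functions take the same value at `y`, so the terms with derivatives of the
      -- weights add up to zero.
      have h3 : ∑ i ∈ s, (ρ i y • A i + (R i).smulRight (3 / 2 * (z : ℂ))) =
          ∑ i ∈ s, ρ i y • A i := by
        rw [Finset.sum_add_distrib]
        have h4 : ∑ i ∈ s, (R i).smulRight (3 / 2 * (z : ℂ)) =
            (∑ i ∈ s, R i).smulRight (3 / 2 * (z : ℂ)) := by
          ext w
          simp only [sum_apply, ContinuousLinearMap.smulRight_apply,
            Finset.sum_smul]
        rw [h4, hRsum]
        ext w
        simp
      rw [h3] at h1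
      refine h1.congr_of_eventuallyEq ?_
      filter_upwards [hte.eventually (ρ.eventually_finsupport_subset y)] with w hw
      simp only [hF, Function.comp_apply]
      refine finsum_eq_sum_of_support_subset _ ?_
      refine (Function.support_smul_subset_left (fun i => ρ i (e.symm w)) fun i => f i (e.symm w)).trans ?_
      rw [← ρ.coe_finsupport]
      exact_mod_cast hw
    set t : ℝ := Complex.arg z with ht
    have htz : Circle.exp t = z := Circle.exp_arg z
    have hβ : angleCurve γ t = y := by rw [angleCurve, htz]
    have hβe : angleCurve γ t ∈ e.source := by rwa [hβ]
    have hβd : HasDerivAt (e ∘ angleCurve γ) (deriv (e ∘ angleCurve γ) t) t :=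
      ((contDiffAt_chart_angleCurve hγ he hβe).differentiableAt (by simp)).hasDerivAt
    rw [hFd.fderiv]
    -- All local functions agree along the curve, so their differentials agree on its velocity, the
    -- common nonzero vector required.
    refine det_sum_pos (u := coreCircle t * Complex.I) (v := deriv (e ∘ angleCurve γ) t)
      (fun i _ => ρ.nonneg i y) hsum1 (fun i hi => hfo i y (hsU i hi) e he hye)
      (deriv_chart_angleCurve_ne_zero hγ he hβe) fun i hi => ?_
    have h1 : HasDerivAt ((f i ∘ e.symm) ∘ (e ∘ angleCurve γ))
        (A i (deriv (e ∘ angleCurve γ) t)) t := by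
      refine HasFDerivAt.comp_hasDerivAt t ?_ hβd
      rw [Function.comp_apply, hβ]
      exact hAd i hi
    have h2 : coreCircle =ᶠ[nhds t] (f i ∘ e.symm) ∘ (e ∘ angleCurve γ) := by
      have hc : ContinuousAt (angleCurve γ) t := (contMDiff_angleCurve hγ).continuous.continuousAt
      filter_upwards [hc.eventually (e.open_source.mem_nhds hβe),
        hc.eventually ((hUo i).mem_nhds (by rw [hβ]; exact hsU i hi))] with u hu hu'
      simp only [Function.comp_apply, e.left_inv hu]
      rw [coreCircle_eq_circleExp, ← hfγ i _ hu']
      rfl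
    exact (h1.congr_of_eventuallyEq h2).unique (hasDerivAt_coreCircle t)

end GlobalCollar

/-! ### Radial rescaling and existence of bicollars -/

section RadialScaling

/-- The radial map of the plane which scales the distance to the core circle by `k`. -/
noncomputable def radialScaling (k : ℝ) (z : ℂ) : ℂ :=
  ((k + 3 / 2 * (1 - k) * ‖z‖⁻¹ : ℝ) : ℂ) * z

theorem norm_radialScaling {k : ℝ} {z : ℂ} (h0 : z ≠ 0) (h : 0 ≤ 3 / 2 + k * (‖z‖ - 3 / 2)) :
    ‖radialScaling k z‖ = 3 / 2 + k * (‖z‖ - 3 / 2) := by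
  have hz : 0 < ‖z‖ := norm_pos_iff.2 h0
  have h1 : k + 3 / 2 * (1 - k) * ‖z‖⁻¹ = (3 / 2 + k * (‖z‖ - 3 / 2)) / ‖z‖ := by
    field_simp
    ring
  rw [radialScaling, norm_mul, Complex.norm_real, h1, Real.norm_of_nonneg (by positivity)]
  field_simp

theorem radialScaling_inv {k : ℝ} {z : ℂ} (hk : k ≠ 0) (h0 : z ≠ 0)
    (h : 0 < 3 / 2 + k * (‖z‖ - 3 / 2)) : radialScaling k⁻¹ (radialScaling k z) = z := by
  have hz : 0 < ‖z‖ := norm_pos_iff.2 h0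
  rw [radialScaling, norm_radialScaling h0 h.le, radialScaling, ← mul_assoc, ← Complex.ofReal_mul]
  have : (k⁻¹ + 3 / 2 * (1 - k⁻¹) * (3 / 2 + k * (‖z‖ - 3 / 2))⁻¹) *
      (k + 3 / 2 * (1 - k) * ‖z‖⁻¹) = 1 := by
    have h1 : k + 3 / 2 * (1 - k) * ‖z‖⁻¹ = (3 / 2 + k * (‖z‖ - 3 / 2)) / ‖z‖ := by
      field_simp
      ring
    rw [h1]
    set n := 3 / 2 + k * (‖z‖ - 3 / 2) with hn
    have h2 : ‖z‖ = 3 / 2 + k⁻¹ * (n - 3 / 2) := by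
      rw [hn]
      field_simp
      ring
    have h3 : k⁻¹ + 3 / 2 * (1 - k⁻¹) * n⁻¹ = ‖z‖ / n := by
      rw [h2]
      field_simp
      ring
    rw [h3]
    field_simp
  rw [this]
  simp

theorem contDiffAt_radialScaling (k : ℝ) {z : ℂ} (h0 : z ≠ 0) :
    ContDiffAt ℝ ∞ (radialScaling k) z := by
  refine ContDiffAt.mul ?_ contDiffAt_id
  refine Complex.ofRealCLM.contDiff.contDiffAt.comp z ?_
  exact contDiffAt_const.add
    (contDiffAt_const.mul ((contDiffAt_norm ℝ h0).inv (norm_ne_zero_iff.2 h0)))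

/-- The determinant is the product of the radial stretch `k` and the tangential stretch `m`, the
ratio of the new radius to the old. -/
theorem det_fderiv_radialScaling {k : ℝ} (hk : 0 < k) {z : ℂ} (h0 : z ≠ 0)
    (h : 0 < 3 / 2 + k * (‖z‖ - 3 / 2)) : 0 < (fderiv ℝ (radialScaling k) z).det := by
  have hz : 0 < ‖z‖ := norm_pos_iff.2 h0
  have h1 : HasFDerivAt (fun w : ℂ => ‖w‖ ^ 2) (2 • innerSL ℝ z) z :=
    (hasStrictFDerivAt_norm_sq z).hasFDerivAt
  have h2 := h1.sqrt (by positivity)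
  rw [← Nat.cast_smul_eq_nsmul ℝ, smul_smul] at h2
  simp only [Real.sqrt_sq (norm_nonneg _)] at h2
  obtain ⟨a, haz, ha⟩ : ∃ a : ℝ, a * (z.re * z.re + z.im * z.im) = -(3 / 2 * (1 - k) * ‖z‖⁻¹) ∧
      HasFDerivAt (fun w : ℂ => k + 3 / 2 * (1 - k) * ‖w‖⁻¹) (a • innerSL ℝ z) z := by
    have h4 := (((hasDerivAt_inv hz.ne').comp_hasFDerivAt z h2).const_mul
      (3 / 2 * (1 - k))).const_add k
    rw [smul_smul, smul_smul] at h4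
    refine ⟨_, ?_, h4⟩
    rw [← Complex.normSq_apply, Complex.normSq_eq_norm_sq]
    push_cast
    field_simp
  obtain ⟨m, hm⟩ : ∃ m : ℝ, m = k + 3 / 2 * (1 - k) * ‖z‖⁻¹ := ⟨_, rfl⟩
  have hpos : 0 < m := by
    have h1 : k + 3 / 2 * (1 - k) * ‖z‖⁻¹ = (3 / 2 + k * (‖z‖ - 3 / 2)) / ‖z‖ := by
      field_simp
      ring
    rw [hm, h1]
    positivity
  have hd : HasFDerivAt (radialScaling k) ((m : ℂ) • ContinuousLinearMap.id ℝ ℂ +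
      z • Complex.ofRealCLM.comp (a • innerSL ℝ z)) z := by
    rw [hm]
    exact (Complex.ofRealCLM.hasFDerivAt.comp z ha).mul (hasFDerivAt_id z)
  have haz' : a * (z.re * z.re + z.im * z.im) = k - m := by rw [haz, hm]; ring
  have hdet : (fderiv ℝ (radialScaling k) z).det = m * k := by
    rw [hd.fderiv, det_eq_re_mul_im_sub]
    simp [Complex.inner]
    linear_combination m * haz'
  rw [hdet]
  positivity

/-- The radial scaling of a thin annulus around the core circle onto the annulus
`{z | 1 < |z| < 2}`. -/
noncomputable def radialScalingHomeo {δ : ℝ} (hδ : 0 < δ) (hδ' : δ ≤ 1 / 2) :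
    OpenPartialHomeomorph ℂ ℂ where
  -- The factor takes the half-width `δ` to the half-width `1 / 2` of the target annulus.
  toFun := radialScaling (2 * δ)⁻¹
  invFun := radialScaling (2 * δ)
  source := {z | 3 / 2 - δ < ‖z‖ ∧ ‖z‖ < 3 / 2 + δ}
  target := {z | 1 < ‖z‖ ∧ ‖z‖ < 2}
  map_source' z hz := by
    have h0 : z ≠ 0 := norm_pos_iff.1 (by linarith [hz.1])
    have h1 : -(1 / 2) < (2 * δ)⁻¹ * (‖z‖ - 3 / 2) := by
      rw [inv_mul_eq_div, lt_div_iff₀ (by positivity)]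
      linarith [hz.1]
    have h2 : (2 * δ)⁻¹ * (‖z‖ - 3 / 2) < 1 / 2 := by
      rw [inv_mul_eq_div, div_lt_iff₀ (by positivity)]
      linarith [hz.2]
    have h3 := norm_radialScaling (k := (2 * δ)⁻¹) h0 (by linarith)
    constructor <;> linarith
  map_target' z hz := by
    have h0 : z ≠ 0 := norm_pos_iff.1 (zero_lt_one.trans hz.1)
    have h1 : -δ < 2 * δ * (‖z‖ - 3 / 2) := by nlinarith [hz.1]
    have h2 : 2 * δ * (‖z‖ - 3 / 2) < δ := by nlinarith [hz.2]
    have h3 := norm_radialScaling (k := 2 * δ) h0 (by linarith)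
    constructor <;> linarith
  left_inv' z hz := by
    have h1 : -(1 / 2) < (2 * δ)⁻¹ * (‖z‖ - 3 / 2) := by
      rw [inv_mul_eq_div, lt_div_iff₀ (by positivity)]
      linarith [hz.1]
    have := radialScaling_inv (k := (2 * δ)⁻¹) (by positivity)
      (norm_pos_iff.1 (by linarith [hz.1])) (by linarith)
    rwa [inv_inv] at this
  right_inv' z hz := by
    have h1 : -δ < 2 * δ * (‖z‖ - 3 / 2) := by nlinarith [hz.1]
    exact radialScaling_inv (by positivity) (norm_pos_iff.1 (zero_lt_one.trans hz.1)) (by linarith)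
  open_source := (isOpen_lt continuous_const continuous_norm).inter
    (isOpen_lt continuous_norm continuous_const)
  open_target := (isOpen_lt continuous_const continuous_norm).inter
    (isOpen_lt continuous_norm continuous_const)
  continuousOn_toFun z hz := (contDiffAt_radialScaling _
    (norm_pos_iff.1 (by linarith [hz.1]))).continuousAt.continuousWithinAt
  continuousOn_invFun z hz := (contDiffAt_radialScaling _
    (norm_pos_iff.1 (zero_lt_one.trans hz.1))).continuousAt.continuousWithinAt

end RadialScaling

section Existence

variable {S : Type*} [TopologicalSpace S] [ChartedSpace ℂ S] [OrientedSurface S]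

/-- The inverse function theorem for orientation preserving functions on a surface. -/
theorem IsOrientedAt.isLocalDiffeomorphAt {F : S → ℂ} {x : S} (hx : IsOrientedAt F x)
    (hF : ContMDiff 𝓘(ℝ, ℂ) 𝓘(ℝ, ℂ) ∞ F) :
    IsLocalDiffeomorphAt 𝓘(ℝ, ℂ) 𝓘(ℝ, ℂ) ∞ F x := by
  set e := chartAt ℂ x
  have he : e ∈ atlas ℂ S := chart_mem_atlas ℂ x
  have hxe : x ∈ e.source := mem_chart_source ℂ x
  have hsmooth : ContDiffOn ℝ ∞ (F ∘ e.symm) e.target := by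
    rw [← contMDiffOn_iff_contDiffOn]
    exact hF.comp_contMDiffOn (contMDiffOn_symm_of_mem_maximalAtlas (I := 𝓘(ℝ, ℂ)) (n := ∞)
      (IsManifold.subset_maximalAtlas he))
  have hdet := hx e he hxe
  set A := fderiv ℝ (F ∘ e.symm) (e x) with hA
  have hA0 : (A : ℂ →ₗ[ℝ] ℂ).det ≠ 0 := hdet.ne'
  set T := (LinearEquiv.ofIsUnitDet (v := Complex.basisOneI) (v' := Complex.basisOneI)
    (f := (A : ℂ →ₗ[ℝ] ℂ)) (by
      rw [LinearMap.det_toMatrix]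
      exact isUnit_iff_ne_zero.2 hA0)).toContinuousLinearEquiv
  have hT : (T : ℂ →L[ℝ] ℂ) = A := ContinuousLinearMap.ext fun _ => rfl
  have h1 : IsLocalDiffeomorphAt 𝓘(ℝ, ℂ) 𝓘(ℝ, ℂ) ∞ (F ∘ e.symm) (e x) := by
    refine isLocalDiffeomorphAt_of_contDiffOn e.open_target hsmooth (e.map_source hxe)
      (f' := T) ?_
    rw [hT]
    exact (differentiableAt_comp_chart_symm hF.contMDiffAt he hxe).hasFDerivAt
  obtain ⟨Ψ, hΨ, hΨF⟩ := h1
  let Φ : PartialDiffeomorph 𝓘(ℝ, ℂ) 𝓘(ℝ, ℂ) S ℂ ∞ :=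
    ⟨e.toPartialEquiv, e.open_source, e.open_target,
      contMDiffOn_of_mem_maximalAtlas (IsManifold.subset_maximalAtlas he),
      contMDiffOn_symm_of_mem_maximalAtlas (IsManifold.subset_maximalAtlas he)⟩
  refine ⟨Φ.trans Ψ, ⟨hxe, hΨ⟩, fun y hy => ?_⟩
  have h2 := hΨF hy.2
  have h3 : e.symm (e y) = y := e.left_inv hy.1
  change F (e.symm (e y)) = _ at h2
  rw [h3] at h2
  exact h2

/-- A simple closed curve in an oriented surface has a bicollar. -/
theorem SimpleClosedCurve.exists_isBicollar (c : SimpleClosedCurve S) :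
    ∃ φ, IsBicollar c.1 φ := by
  obtain ⟨γ, hγ, hc⟩ := c.2
  obtain ⟨F, hF, hFγ, hFo⟩ := exists_global_collar hγ
  have : Nonempty S := ⟨γ 1⟩
  have hcK : IsCompact c.1 := hc ▸ isCompact_range hγ.contMDiff.continuous
  have hinj : Set.InjOn F c.1 := by
    rw [← hc]
    rintro _ ⟨z, rfl⟩ _ ⟨w, rfl⟩ h
    rw [hFγ, hFγ] at h
    have : z = w := Subtype.ext (mul_left_cancel₀ (by norm_num) h)
    rw [this]
  have hFo' : ∀ x ∈ c.1, IsOrientedAt F x := by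
    rw [← hc]
    rintro _ ⟨z, rfl⟩
    exact hFo z
  -- Orientation is an open condition, so the collar can be confined to points where `F` is
  -- oriented, as `det_pos` demands on its whole source.
  have hU : IsOpen {x | IsOrientedAt F x} := isOpen_iff_mem_nhds.2 fun x hx =>
    eventually_isOrientedAt (Filter.Eventually.of_forall fun _ => hF.contMDiffAt) hx
  obtain ⟨e, he, hce, heU, -, hes⟩ := exists_openPartialHomeomorph_of_injOn hcK hinj
    (fun x hx => (hFo' x hx).isLocalDiffeomorphAt hF) hU hFo'
  have himage : F '' c.1 = {z : ℂ | ‖z‖ = 3 / 2} := by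
    rw [← hc, ← Set.range_comp]
    ext w
    constructor
    · rintro ⟨z, rfl⟩
      simp [hFγ, Circle.norm_coe]
    · intro hw
      refine ⟨Circle.exp (Complex.arg w), ?_⟩
      rw [Function.comp_apply, hFγ, ← coreCircle_eq_circleExp, coreCircle_arg hw]
  have hsub : F '' c.1 ⊆ e.target := by
    rintro _ ⟨x, hx, rfl⟩
    rw [← he]
    exact e.map_source (hce hx)
  obtain ⟨δ, hδ, hδe⟩ := (hcK.image hF.continuous).exists_thickening_subset_open e.open_target hsub
  have hη : 0 < min δ (1 / 2) := lt_min hδ (by norm_num)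
  have hη' : min δ (1 / 2) ≤ 1 / 2 := min_le_right _ _
  set η := min δ (1 / 2) with hηdef
  have hthin : ∀ z : ℂ, 3 / 2 - η < ‖z‖ → ‖z‖ < 3 / 2 + η → z ∈ e.target := by
    intro z h1 h2
    refine hδe (Metric.mem_thickening_iff.2 ⟨coreCircle (Complex.arg z), ?_, ?_⟩)
    · rw [himage]
      exact norm_coreCircle _
    · have h3 : z - coreCircle (Complex.arg z) =
          ((‖z‖ - 3 / 2 : ℝ) : ℂ) * Complex.exp (Complex.arg z * Complex.I) := by
        nth_rewrite 1 [← Complex.norm_mul_exp_arg_mul_I z]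
        rw [coreCircle]
        push_cast
        ring
      rw [dist_eq_norm, h3, norm_mul, Complex.norm_exp_ofReal_mul_I, mul_one, Complex.norm_real,
        Real.norm_eq_abs, abs_lt]
      have := min_le_left δ (1 / 2)
      constructor <;> linarith
  set g := radialScalingHomeo hη hη' with hg
  have hgs : ∀ z, z ∈ g.source ↔ 3 / 2 - η < ‖z‖ ∧ ‖z‖ < 3 / 2 + η := fun z => Iff.rfl
  have hg0 : ∀ z ∈ g.source, z ≠ 0 := fun z hz => norm_pos_iff.1 (by linarith [hz.1])
  have htarget : (e ≫ₕ g).target = {z : ℂ | 1 < ‖z‖ ∧ ‖z‖ < 2} := by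
    rw [OpenPartialHomeomorph.trans_target]
    refine Set.inter_eq_left.2 fun z hz => ?_
    have := g.map_target hz
    exact hthin _ this.1 this.2
  have hmem : ∀ x ∈ (e ≫ₕ g).source, F x ∈ g.source := by
    intro x hx
    rw [OpenPartialHomeomorph.trans_source] at hx
    rw [← he]
    exact hx.2
  refine ⟨e ≫ₕ g, htarget, ?_, ?_, ?_, ?_, ?_⟩
  · intro x hx
    rw [OpenPartialHomeomorph.coe_trans, he]
    exact ((contDiffAt_radialScaling _ (hg0 _ (hmem x hx))).contMDiffAt.comp x
      hF.contMDiffAt).contMDiffWithinAt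
  · rw [htarget]
    have h1 : ContMDiffOn 𝓘(ℝ, ℂ) 𝓘(ℝ, ℂ) ∞ g.symm {z : ℂ | 1 < ‖z‖ ∧ ‖z‖ < 2} := by
      intro z hz
      exact (contDiffAt_radialScaling _
        (norm_pos_iff.1 (zero_lt_one.trans hz.1))).contMDiffAt.contMDiffWithinAt
    refine hes.comp h1 fun z hz => ?_
    have := g.map_target hz
    exact hthin _ this.1 this.2
  · intro a ha z hz
    have hz1 : z ∈ a.target := by simpa using hz.1
    have hx : a.symm z ∈ (e ≫ₕ g).source := hz.2
    have hxg := hmem _ hx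
    have hxU : IsOrientedAt F (a.symm z) := heU hx.1
    have hpos : 0 < 3 / 2 + (2 * η)⁻¹ * (‖F (a.symm z)‖ - 3 / 2) := by
      have : -(1 / 2) < (2 * η)⁻¹ * (‖F (a.symm z)‖ - 3 / 2) := by
        rw [inv_mul_eq_div, lt_div_iff₀ (by positivity)]
        linarith [hxg.1]
      linarith
    have := (hxU.comp_iff (g := radialScaling (2 * η)⁻¹)
      ((contDiffAt_radialScaling _ (hg0 _ hxg)).differentiableAt (by simp)) hF.contMDiffAt).2
      (det_fderiv_radialScaling (by positivity) (hg0 _ hxg) hpos) a ha (a.map_target hz1)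
    rw [a.right_inv hz1, ← he] at this
    exact this
  · intro x hx
    rw [OpenPartialHomeomorph.trans_source]
    refine ⟨hce hx, ?_⟩
    have h1 : F x ∈ F '' c.1 := ⟨x, hx, rfl⟩
    rw [himage] at h1
    rw [Set.mem_preimage, he, hgs, h1]
    constructor <;> linarith
  · have h1 : (e ≫ₕ g) '' c.1 = radialScaling (2 * η)⁻¹ '' (F '' c.1) := by
      rw [Set.image_image, OpenPartialHomeomorph.coe_trans, he]
      rfl
    have h2 : ∀ z : ℂ, ‖z‖ = 3 / 2 → radialScaling (2 * η)⁻¹ z = z := by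
      intro z hz
      rw [radialScaling, hz]
      have : (2 * η)⁻¹ + 3 / 2 * (1 - (2 * η)⁻¹) * (3 / 2)⁻¹ = 1 := by ring
      rw [this]
      simp
    rw [h1, himage]
    exact (Set.image_congr fun z hz => h2 z hz).trans (Set.image_id' _)

end Existence

/-! ### Dehn twists and the quandle operations -/

section DehnTwists

variable {S : Type*} [TopologicalSpace S] [ChartedSpace ℂ S] {ε : ℤ}
  {c d x x' y y' : SimpleClosedCurve S} {τ τ' h : SelfDiffeo S}

/-- A Dehn twist with sign `ε`. -/
def IsDehnTwist (ε : ℤ) (c : SimpleClosedCurve S) (τ : SelfDiffeo S) : Prop :=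
  ∃ τ₀ : SelfDiffeo S, IsModelTwist ε c.1 τ₀ ∧ DiffeoIsotopic τ₀ τ

theorem isModelTwist_iff {c : Set S} : IsModelTwist ε c τ ↔
    ∃ φ f, IsBicollar c φ ∧ IsTwistProfile f ∧ IsTwistAlong ε φ f τ :=
  Iff.rfl

theorem IsModelTwist.isDehnTwist (hτ : IsModelTwist ε c.1 τ) : IsDehnTwist ε c τ :=
  ⟨τ, hτ, DiffeoIsotopic.refl τ⟩

variable [OrientedSurface S]

theorem exists_isModelTwist (ε : ℤ) (c : SimpleClosedCurve S) : ∃ τ, IsModelTwist ε c.1 τ := by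
  obtain ⟨φ, hφ⟩ := c.exists_isBicollar
  obtain ⟨f, hf, -⟩ := exists_isTwistProfile (a := 5 / 4) (b := 7 / 4) (by norm_num) (by norm_num)
    (by norm_num)
  obtain ⟨τ, hτ⟩ := hφ.exists_isTwistAlong hf ε
  exact ⟨τ, isModelTwist_iff.2 ⟨φ, f, hφ, hf, hτ⟩⟩

theorem IsModelTwist.isotopic (hτ : IsModelTwist ε c.1 τ) (hτ' : IsModelTwist ε c.1 τ') :
    DiffeoIsotopic τ τ' := by
  obtain ⟨φ, f, hφ, hf, h⟩ := isModelTwist_iff.1 hτ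
  obtain ⟨φ', f', hφ', hf', h'⟩ := isModelTwist_iff.1 hτ'
  exact hφ.isotopic hφ' hf hf' h h'

/-- Naturality of twists. It is used with `h` the end of an isotopy, for well-definedness, and with
`h` itself a twist, for distributivity. -/
theorem IsModelTwist.map (hτ : IsModelTwist ε c.1 τ) (hh : ∀ x, PreservesOrientationAt h x) :
    IsModelTwist ε (c.map h).1 ((h.symm.trans τ).trans h) := by
  obtain ⟨φ, f, hφ, hf, hτ⟩ := isModelTwist_iff.1 hτ
  exact isModelTwist_iff.2 ⟨mapCollar h φ, f, hφ.map hh, hf, hτ.map h⟩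

omit [OrientedSurface S] in
theorem IsModelTwist.symm (hτ : IsModelTwist ε c.1 τ) : IsModelTwist (-ε) c.1 τ.symm := by
  obtain ⟨φ, f, hφ, hf, hτ⟩ := isModelTwist_iff.1 hτ
  exact isModelTwist_iff.2 ⟨φ, f, hφ, hf, hτ.symm hφ⟩

theorem IsModelTwist.map_eq (hτ : IsModelTwist ε c.1 τ) : c.map τ = c := by
  obtain ⟨φ, f, hφ, hf, hτ⟩ := isModelTwist_iff.1 hτ
  exact Subtype.ext (hτ.image_eq hφ)

theorem IsModelTwist.preservesOrientationAt (hτ : IsModelTwist ε c.1 τ) (x : S) :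
    PreservesOrientationAt τ x := by
  obtain ⟨φ, f, hφ, hf, hτ⟩ := isModelTwist_iff.1 hτ
  exact hτ.preservesOrientationAt hφ hf x

/-- Dehn twists of the same sign about isotopic curves are isotopic. -/
theorem IsDehnTwist.isotopic (hcd : CurveIsotopic c d) (hτ : IsDehnTwist ε c τ)
    (hτ' : IsDehnTwist ε d τ') : DiffeoIsotopic τ τ' := by
  obtain ⟨τ₀, h₀, hτ⟩ := hτ
  obtain ⟨τ₁, h₁, hτ'⟩ := hτ'
  obtain ⟨H, hH, hH0, hH1⟩ := hcd
  -- Conjugation by `H 1` stays in the isotopy class of `τ₀` and produces a model twist about `d`,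
  -- so both twists are compared about one curve.
  have hh : DiffeoIsotopic (Diffeomorph.refl 𝓘(ℝ, ℂ) S ∞) (H 1) := ⟨H, hH, hH0, rfl⟩
  have hd : c.map (H 1) = d := Subtype.ext hH1
  have h₂ := h₀.map (preservesOrientationAt_of_isotopic hh)
  rw [hd] at h₂
  exact hτ.symm.trans ((hh.conj τ₀).trans ((h₂.isotopic h₁).trans hτ'))

theorem IsDehnTwist.curveIsotopic_map (hx : CurveIsotopic x x') (hy : CurveIsotopic y y')
    (hτ : IsDehnTwist ε y τ) (hτ' : IsDehnTwist ε y' τ') :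
    CurveIsotopic (x.map τ) (x'.map τ') :=
  curveIsotopic_trans (hx.map τ) (curveIsotopic_map_of_diffeoIsotopic (hτ.isotopic hy hτ') x')

/-- The operation on isotopy classes given by the Dehn twists with sign `ε`. -/
noncomputable def twistAction (ε : ℤ) (X Y : IsotopyClass S) : IsotopyClass S :=
  ⟦X.out.map (exists_isModelTwist ε Y.out).choose⟧

theorem IsDehnTwist.twistAction_mk (hτ : IsDehnTwist ε y τ) (x : SimpleClosedCurve S) :
    twistAction ε ⟦x⟧ ⟦y⟧ = ⟦x.map τ⟧ :=
  Quotient.sound ((exists_isModelTwist ε _).choose_spec.isDehnTwist.curveIsotopic_map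
    (Quotient.mk_out x) (Quotient.mk_out y) hτ)

theorem IsModelTwist.twistAction_mk (hτ : IsModelTwist ε y.1 τ) (x : SimpleClosedCurve S) :
    twistAction ε ⟦x⟧ ⟦y⟧ = ⟦x.map τ⟧ :=
  hτ.isDehnTwist.twistAction_mk x

theorem twistAction_self (ε : ℤ) (X : IsotopyClass S) : twistAction ε X X = X := by
  induction X using Quotient.ind with | _ x
  obtain ⟨τ, hτ⟩ := exists_isModelTwist ε x
  rw [hτ.twistAction_mk, hτ.map_eq]

theorem twistAction_neg_twistAction (ε : ℤ) (X Y : IsotopyClass S) :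
    twistAction (-ε) (twistAction ε X Y) Y = X := by
  induction X using Quotient.ind with | _ x
  induction Y using Quotient.ind with | _ y
  obtain ⟨τ, hτ⟩ := exists_isModelTwist ε y
  rw [hτ.twistAction_mk, hτ.symm.twistAction_mk, SimpleClosedCurve.map_symm_map]

/-- For `h` a twist about `z` and `t` one about `y`, `h t = (h t h⁻¹) h`, and `h t h⁻¹` is a twist
about `h(y)` with the sign of `t`. The two signs play no role. -/
theorem twistAction_twistAction (ε δ : ℤ) (X Y Z : IsotopyClass S) :
    twistAction δ (twistAction ε X Y) Z =
      twistAction ε (twistAction δ X Z) (twistAction δ Y Z) := by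
  induction X using Quotient.ind with | _ x
  induction Y using Quotient.ind with | _ y
  induction Z using Quotient.ind with | _ z
  obtain ⟨τ, hτ⟩ := exists_isModelTwist ε y
  obtain ⟨h, hh⟩ := exists_isModelTwist δ z
  rw [hτ.twistAction_mk, hh.twistAction_mk, hh.twistAction_mk, hh.twistAction_mk,
    (hτ.map hh.preservesOrientationAt).twistAction_mk, SimpleClosedCurve.map_trans,
    SimpleClosedCurve.map_trans, SimpleClosedCurve.map_symm_map]

end DehnTwists

end DehnQuandle

/-- On the set of isotopy classes of simple closed curves in an oriented surface, the operations
`x ▷ y = t_y⁺(x)` and `x ⊵ y = t_y⁻(x)` are well defined (twists exist, and the class of the image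
does not depend on the representatives `x`, `y` or on the twist about `y`) and satisfy the quandle
axioms. -/
theorem proposition14 (S : Type*) [TopologicalSpace S] [ChartedSpace ℂ S] [OrientedSurface S] :
    (∀ c : DehnQuandle.SimpleClosedCurve S,
      (∃ τ : DehnQuandle.SelfDiffeo S, DehnQuandle.IsPositiveDehnTwist c τ) ∧
      (∃ τ : DehnQuandle.SelfDiffeo S, DehnQuandle.IsNegativeDehnTwist c τ)) ∧
    ∃ act inv : DehnQuandle.IsotopyClass S → DehnQuandle.IsotopyClass S →
        DehnQuandle.IsotopyClass S,
      (∀ (x y : DehnQuandle.SimpleClosedCurve S) (τ : DehnQuandle.SelfDiffeo S),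
        DehnQuandle.IsPositiveDehnTwist y τ → act ⟦x⟧ ⟦y⟧ = ⟦x.map τ⟧) ∧
      (∀ (x y : DehnQuandle.SimpleClosedCurve S) (τ : DehnQuandle.SelfDiffeo S),
        DehnQuandle.IsNegativeDehnTwist y τ → inv ⟦x⟧ ⟦y⟧ = ⟦x.map τ⟧) ∧
      DehnQuandle.IsQuandle act inv := by
  -- Positive and negative Dehn twists are by definition the cases `1` and `-1` of `IsDehnTwist`.
  refine ⟨fun c => ⟨?_, ?_⟩, DehnQuandle.twistAction 1, DehnQuandle.twistAction (-1),
    fun x y τ hτ => DehnQuandle.IsDehnTwist.twistAction_mk hτ x,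
    fun x y τ hτ => DehnQuandle.IsDehnTwist.twistAction_mk hτ x,
    DehnQuandle.twistAction_self 1, DehnQuandle.twistAction_neg_twistAction 1,
    fun X Y => ?_, DehnQuandle.twistAction_twistAction 1 1⟩
  · obtain ⟨τ, hτ⟩ := DehnQuandle.exists_isModelTwist 1 c
    exact ⟨τ, hτ.isDehnTwist⟩
  · obtain ⟨τ, hτ⟩ := DehnQuandle.exists_isModelTwist (-1) c
    exact ⟨τ, hτ.isDehnTwist⟩
  · simpa using DehnQuandle.twistAction_neg_twistAction (-1) X Y
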